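/- Let $\Lambda$ be the ring of symmetric functions over $\mathbb{Z}$ in countably many variables (symmetric formal power series of bounded degree), let $\Lambda_d$ be its degree-$d$ part, and let $\Lambda_{\mathbb{C}}$ be the ring of symmetric functions over $\mathbb{C}$, in which the power sums $p_\lambda$ form a basis. For a partition $\lambda=(1^{m_1(\lambda)}2^{m_2(\lambda)}\cdots)$ let $\ell(\lambda)=\sum_i m_i(\lambda)$ and $z_\lambda=\prod_{i\ge1} i^{m_i(\lambda)}m_i(\lambda)!$. For a positive integer $s$, the $s$-form is the bilinear form on $\Lambda_{\mathbb{C}}$ with $$\langle p_\lambda,p_\mu\rangle_s=\delta_{\lambda\mu}\,s^{\ell(\lambda)}z_\lambda .$$ Let $p$ be a prime and $r\ge 0$ an integer. Put $d_p(a)=\sum_{j\ge1}\lfloor a/p^j\rfloor$ and $$D_r(\lambda)=\prod_{\substack{n\ge1\\ (n,p)=1}}\ \prod_{i=0}^{r-1}p^{(r-i)\,m_{p^in}(\lambda)+d_p(m_{p^in}(\lambda))}.$$ Theorem. Suppose $r\le p$. Then: (1) For every $d\ge0$, the elementary divisors of the restriction of $\langle\cdot,\cdot\rangle_{p^r}$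 to $\Lambda_d$, that is, the diagonal entries (units included, with multiplicity) of the Smith normal form of its Gram matrix with respect to $\mathbb{Z}$-bases of $\Lambda_d$, form the multiset $\{D_r(\lambda):\lambda\vdash d\}$. (2) There exist $\mathbb{Z}$-bases $(G^{(r)}_\lambda)$ and $(N^{(r)}_\lambda)$ of $\Lambda$, indexed by all partitions $\lambda$, with $G^{(r)}_\lambda$ and $N^{(r)}_\lambda$ homogeneous of degree $|\lambda|$, such that, as formal power series in $x_1,x_2,\dots,y_1,y_2,\dots$, $$\Big(\prod_{i,j}(1-x_iy_j)^{-1}\Big)^{p^r}=\sum_\lambda D_r(\lambda)\,G^{(r)}_\lambda(x)\,N^{(r)}_\lambda(y).$$ -/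

import Mathlib

open scoped MvPowerSeries.WithPiTopology

noncomputable section

namespace SymFun

/-- The ring of symmetric functions over `R` in the variables `x_0, x_1, x_2, …`: formal power
series that are invariant under permutations of the variables and have bounded degree. -/
def symFun (R : Type*) [CommRing R] : Subalgebra R (MvPowerSeries ℕ R) where
  carrier := {f | (∀ σ : Equiv.Perm ℕ, MvPowerSeries.rename σ f = f) ∧
    ∃ N : ℕ, ∀ m : ℕ →₀ ℕ, MvPowerSeries.coeff m f ≠ 0 → m.degree ≤ N}
  mul_mem' := by
    rintro f g ⟨hf, N, hN⟩ ⟨hg, N', hN'⟩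
    refine ⟨fun σ => by rw [map_mul, hf, hg], N + N', fun m hm => ?_⟩
    rw [MvPowerSeries.coeff_mul] at hm
    obtain ⟨⟨a, b⟩, hab, hne⟩ := Finset.exists_ne_zero_of_sum_ne_zero hm
    rw [Finset.HasAntidiagonal.mem_antidiagonal] at hab
    have ha := hN a (left_ne_zero_of_mul hne)
    have hb := hN' b (right_ne_zero_of_mul hne)
    rw [← hab]
    simp only [map_add]
    omega
  add_mem' := by
    rintro f g ⟨hf, N, hN⟩ ⟨hg, N', hN'⟩
    refine ⟨fun σ => by rw [map_add, hf, hg], max N N', fun m hm => ?_⟩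
    by_cases h : MvPowerSeries.coeff m f = 0
    · have h' : MvPowerSeries.coeff m g ≠ 0 := by
        intro h'
        apply hm
        rw [map_add, h, h', add_zero]
      exact (hN' m h').trans (le_max_right _ _)
    · exact (hN m h).trans (le_max_left _ _)
  algebraMap_mem' r := by
    classical
    refine ⟨fun σ => AlgHom.commutes _ r, 0, fun m hm => ?_⟩
    rw [MvPowerSeries.algebraMap_apply, MvPowerSeries.coeff_C] at hm
    have : m = 0 := by
      by_contra h
      exact hm (if_neg h)
    simp [this]

/-- The degree-`d` part of the ring of symmetric functions. -/
def symDeg (R : Type*) [CommRing R] (d : ℕ) : Submodule R (symFun R) where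
  carrier := {f | ∀ m : ℕ →₀ ℕ, MvPowerSeries.coeff m (f : MvPowerSeries ℕ R) ≠ 0 → m.degree = d}
  add_mem' := by
    intro f g hf hg m hm
    by_cases h : MvPowerSeries.coeff m (f : MvPowerSeries ℕ R) = 0
    · refine hg m fun h' => hm ?_
      simp [h, h']
    · exact hf m h
  zero_mem' := by
    intro m hm
    simp at hm
  smul_mem' := by
    intro c f hf m hm
    refine hf m fun h => hm ?_
    simp [h]

/-- All partitions (of all natural numbers); `⟨d, μ⟩` is the partition `μ ⊢ d`. -/
abbrev Par : Type := Σ d : ℕ, d.Partition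

open Classical in
/-- The power series `∑_i x_i ^ n`, for `n ≥ 1`. -/
def psumSeries (R : Type*) [CommSemiring R] (n : ℕ) : MvPowerSeries ℕ R :=
  fun m => if ∃ i, m = Finsupp.single i n then 1 else 0

section helper

open Classical in
theorem coeff_psumSeries (R : Type*) [CommSemiring R] (n : ℕ) (m : ℕ →₀ ℕ) :
    MvPowerSeries.coeff m (psumSeries R n) = if ∃ i, m = Finsupp.single i n then 1 else 0 := rfl

theorem coeff_rename_perm {R : Type*} [CommSemiring R] (σ : Equiv.Perm ℕ) (f : MvPowerSeries ℕ R)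
    (m : ℕ →₀ ℕ) : MvPowerSeries.coeff (m.mapDomain σ) (MvPowerSeries.rename σ f) =
      MvPowerSeries.coeff m f := by
  have := MvPowerSeries.coeff_embDomain_rename σ.toEmbedding f m
  rw [Finsupp.embDomain_eq_mapDomain] at this
  exact this

theorem psumSeries_mem (R : Type*) [CommRing R] (n : ℕ) : psumSeries R n ∈ symFun R := by
  classical
  refine ⟨fun σ => ?_, n, fun m hm => ?_⟩
  · ext m
    obtain ⟨m, rfl⟩ := (Finsupp.mapDomain_surjective σ.surjective) m
    rw [coeff_rename_perm, coeff_psumSeries, coeff_psumSeries]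
    congr 1
    apply propext
    constructor
    · rintro ⟨i, rfl⟩
      exact ⟨σ i, by rw [Finsupp.mapDomain_single]⟩
    · rintro ⟨i, hi⟩
      refine ⟨σ.symm i, Finsupp.mapDomain_injective σ.injective ?_⟩
      rw [hi, Finsupp.mapDomain_single, Equiv.apply_symm_apply]
  · rw [coeff_psumSeries] at hm
    split_ifs at hm with h
    · obtain ⟨i, rfl⟩ := h
      simp
    · exact absurd rfl hm

/-- The multiset of nonzero exponents. -/
def vals (m : ℕ →₀ ℕ) : Multiset ℕ := m.support.val.map m

theorem card_vals (m : ℕ →₀ ℕ) : Multiset.card (vals m) = m.support.card := by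
  simp [vals]

theorem sum_vals (m : ℕ →₀ ℕ) : (vals m).sum = m.degree := rfl

theorem pos_of_mem_vals {m : ℕ →₀ ℕ} {a : ℕ} (h : a ∈ vals m) : 0 < a := by
  simp only [vals, Multiset.mem_map, Finset.mem_val, Finsupp.mem_support_iff] at h
  obtain ⟨i, hi, rfl⟩ := h
  omega

theorem vals_single_add {i a : ℕ} {v : ℕ →₀ ℕ} (ha : 0 < a) (hi : i ∉ v.support) :
    vals (Finsupp.single i a + v) = a ::ₘ vals v := by
  classical
  have hs : (Finsupp.single i a + v).support = insert i v.support := by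
    rw [Finsupp.support_add_eq, Finsupp.support_single _ ha.ne', Finset.insert_eq]
    rw [Finsupp.support_single _ ha.ne']
    simpa using hi
  rw [vals, hs, Finset.insert_val_of_notMem hi, Multiset.map_cons]
  have hvi : v i = 0 := by simpa using hi
  congr 1
  · simp [hvi]
  · refine Multiset.map_congr rfl fun j hj => ?_
    have : j ≠ i := by
      rintro rfl
      exact hi hj
    simp [this.symm]

theorem exists_vals (s : Multiset ℕ) (hs : ∀ a ∈ s, 0 < a) : ∃ m : ℕ →₀ ℕ, vals m = s := by
  induction s using Multiset.induction with
  | empty => exact ⟨0, by simp [vals]⟩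
  | cons a s ih =>
    obtain ⟨v, hv⟩ := ih fun b hb => hs b (Multiset.mem_cons_of_mem hb)
    obtain ⟨i, hi⟩ := Infinite.exists_notMem_finset v.support
    exact ⟨_, by rw [vals_single_add (hs a (Multiset.mem_cons_self _ _)) hi, hv]⟩

theorem ncard_fiber (m : ℕ →₀ ℕ) {c : ℕ} (hc : c ≠ 0) :
    Nat.card {i // m i = c} = (vals m).count c := by
  classical
  have : {i | m i = c} = (m.support.filter fun i => c = m i : Finset ℕ) := by
    ext i
    simp only [Set.mem_ofPred_eq, Finset.coe_filter, Finsupp.mem_support_iff]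
    constructor
    · rintro rfl
      exact ⟨hc, rfl⟩
    · rintro ⟨_, h⟩
      exact h.symm
  rw [vals, Multiset.count_map, ← Finset.filter_val, Finset.card_val]
  change Nat.card ({i | m i = c} : Set ℕ) = _
  rw [this, Nat.card_coe_set_eq, Set.ncard_coe_finset]

theorem exists_perm {m m' : ℕ →₀ ℕ} (h : vals m = vals m') :
    ∃ σ : Equiv.Perm ℕ, m.mapDomain σ = m' := by
  have key : ∀ c, Nonempty ({i // m i = c} ≃ {i // m' i = c}) := by
    intro c
    by_cases hc : c = 0
    · subst hc
      have inf : ∀ v : ℕ →₀ ℕ, Infinite {i // v i = 0} := by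
        intro v
        have : ({i | v i = 0} : Set ℕ).Infinite := by
          have h2 : ({i | v i = 0} : Set ℕ) = (v.support : Set ℕ)ᶜ := by
            ext i
            simp
          rw [h2]
          exact v.support.finite_toSet.infinite_compl
        exact this.to_subtype
      have := inf m
      have := inf m'
      exact nonempty_equiv_of_countable
    · have fin : ∀ v : ℕ →₀ ℕ, Finite {i // v i = c} := by
        intro v
        have : ({i | v i = c} : Set ℕ).Finite := by
          refine v.support.finite_toSet.subset ?_
          rintro i rfl
          simpa using hc
        exact this.to_subtype
      have := fin m
      have := fin m'
      rw [← Finite.card_eq, ncard_fiber m hc, ncard_fiber m' hc, h]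
  have e : ∀ c, {i // m i = c} ≃ {i // m' i = c} := fun c => Classical.choice (key c)
  refine ⟨Equiv.ofFiberEquiv e, ?_⟩
  ext j
  obtain ⟨i, rfl⟩ := (Equiv.ofFiberEquiv e).surjective j
  rw [Finsupp.mapDomain_apply (Equiv.injective _)]
  exact (Equiv.ofFiberEquiv_map e i).symm

theorem coeff_eq_of_vals {R : Type*} [CommRing R] {f : MvPowerSeries ℕ R} (hf : f ∈ symFun R)
    {m m' : ℕ →₀ ℕ} (h : vals m = vals m') :
    MvPowerSeries.coeff m f = MvPowerSeries.coeff m' f := by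
  obtain ⟨σ, rfl⟩ := exists_perm h
  conv_rhs => rw [← hf.1 σ]
  rw [coeff_rename_perm]

/-- The product of the power sums of the parts. -/
def psumProd (R : Type*) [CommSemiring R] (s : Multiset ℕ) : MvPowerSeries ℕ R :=
  (s.map (psumSeries R)).prod

theorem map_psumProd (R : Type*) [CommSemiring R] (s : Multiset ℕ) :
    MvPowerSeries.map (Nat.castRingHom R) (psumProd ℕ s) = psumProd R s := by
  classical
  rw [psumProd, psumProd, map_multiset_prod, Multiset.map_map]
  congr 1
  refine Multiset.map_congr rfl fun n _ => ?_
  ext m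
  simp only [Function.comp_apply, MvPowerSeries.coeff_map, coeff_psumSeries]
  split_ifs <;> simp

theorem vals_eq_of_coeff_ne_zero (s : Multiset ℕ) (hs : ∀ a ∈ s, 0 < a) (m : ℕ →₀ ℕ)
    (hm : MvPowerSeries.coeff m (psumProd ℕ s) ≠ 0) :
    m.support.card ≤ Multiset.card s ∧ (m.support.card = Multiset.card s → vals m = s) := by
  classical
  induction s using Multiset.induction generalizing m with
  | empty =>
    have : m = 0 := by
      by_contra h
      apply hm
      simp [psumProd, MvPowerSeries.coeff_one, h]
    subst this
    simp [vals]
  | cons a s ih =>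
    rw [psumProd, Multiset.map_cons, Multiset.prod_cons, MvPowerSeries.coeff_mul] at hm
    obtain ⟨⟨u, v⟩, huv, hne⟩ := Finset.exists_ne_zero_of_sum_ne_zero hm
    rw [Finset.HasAntidiagonal.mem_antidiagonal] at huv
    have hu := left_ne_zero_of_mul hne
    have hv := right_ne_zero_of_mul hne
    rw [coeff_psumSeries] at hu
    have hu' : ∃ i, u = Finsupp.single i a := by
      by_contra h
      exact hu (if_neg h)
    obtain ⟨i, rfl⟩ := hu'
    obtain ⟨h1, h2⟩ := ih (fun b hb => hs b (Multiset.mem_cons_of_mem hb)) v hv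
    have ha := hs a (Multiset.mem_cons_self _ _)
    simp only at huv
    subst huv
    by_cases hi : i ∈ v.support
    · have hsub : (Finsupp.single i a + v).support ⊆ v.support := by
        refine Finsupp.support_add.trans (Finset.union_subset ?_ subset_rfl)
        rw [Finsupp.support_single _ ha.ne']
        simpa using hi
      have := Finset.card_le_card hsub
      rw [Multiset.card_cons]
      constructor
      · omega
      · intro h
        omega
    · have e := vals_single_add ha hi
      have ec := congrArg Multiset.card e
      rw [card_vals, Multiset.card_cons, card_vals] at ec
      rw [e, ec, Multiset.card_cons]
      refine ⟨by omega, fun h => ?_⟩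
      rw [h2 (by omega)]

theorem coeff_psumProd_pos (s : Multiset ℕ) (hs : ∀ a ∈ s, 0 < a) (m : ℕ →₀ ℕ)
    (hm : vals m = s) : 0 < MvPowerSeries.coeff m (psumProd ℕ s) := by
  classical
  induction s using Multiset.induction generalizing m with
  | empty =>
    have : m = 0 := by
      have h := congrArg Multiset.card hm
      rw [card_vals] at h
      simpa using h
    subst this
    simp [psumProd]
  | cons a s ih =>
    have ha := hs a (Multiset.mem_cons_self _ _)
    have hmem : a ∈ vals m := by
      rw [hm]
      exact Multiset.mem_cons_self _ _
    obtain ⟨i, hi, hia⟩ := Multiset.mem_map.1 hmem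
    have hsplit : Finsupp.single i a + m.erase i = m := by
      rw [← hia]
      exact Finsupp.single_add_erase i m
    have hv : vals (m.erase i) = s := by
      have h := vals_single_add (v := m.erase i) (i := i) ha (by simp)
      rw [hsplit, hm] at h
      exact ((Multiset.cons_inj_right a).1 h).symm
    have hpos := ih (fun b hb => hs b (Multiset.mem_cons_of_mem hb)) _ hv
    rw [psumProd, Multiset.map_cons, Multiset.prod_cons, MvPowerSeries.coeff_mul]
    have hanti : (Finsupp.single i a, m.erase i) ∈ Finset.HasAntidiagonal.antidiagonal m :=
      Finset.HasAntidiagonal.mem_antidiagonal.2 hsplit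
    refine lt_of_lt_of_le ?_ (Finset.single_le_sum
      (f := fun q : (ℕ →₀ ℕ) × (ℕ →₀ ℕ) => MvPowerSeries.coeff q.1 (psumSeries ℕ a) *
        MvPowerSeries.coeff q.2 (s.map (psumSeries ℕ)).prod) (fun _ _ => Nat.zero_le _) hanti)
    simp only
    rw [coeff_psumSeries, if_pos ⟨i, rfl⟩, one_mul]
    exact hpos

end helper

/-- The power sum symmetric function `p_n`, for `n ≥ 1`. -/
def psum (R : Type*) [CommRing R] (n : ℕ) : symFun R := ⟨psumSeries R n, psumSeries_mem R n⟩

/-- The power sum symmetric function `p_μ = p_{μ_1} p_{μ_2} ⋯`. -/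
def psumPar (R : Type*) [CommRing R] (μ : Par) : symFun R := (μ.2.parts.map (psum R)).prod

section helper

theorem coe_psumPar (R : Type*) [CommRing R] (μ : Par) :
    (psumPar R μ : MvPowerSeries ℕ R) = psumProd R μ.2.parts := by
  rw [psumPar, psumProd]
  change (symFun R).val _ = _
  rw [map_multiset_prod, Multiset.map_map]
  rfl

theorem par_ext {μ ν : Par} (h : μ.2.parts = ν.2.parts) : μ = ν := by
  obtain ⟨d, μ⟩ := μ
  obtain ⟨e, ν⟩ := ν
  have : d = e := by
    rw [← μ.parts_sum, ← ν.parts_sum]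
    exact congrArg _ h
  subst this
  congr 1
  exact Nat.Partition.ext h

theorem parts_pos (μ : Par) : ∀ a ∈ μ.2.parts, 0 < a := fun _ ha => μ.2.parts_pos ha

theorem coeff_psumPar (K : Type*) [Field K] (μ : Par) (m : ℕ →₀ ℕ) :
    MvPowerSeries.coeff m (psumPar K μ : MvPowerSeries ℕ K) =
      (MvPowerSeries.coeff m (psumProd ℕ μ.2.parts) : ℕ) := by
  rw [coe_psumPar, ← map_psumProd, MvPowerSeries.coeff_map]
  rfl

variable (K : Type*) [Field K] [CharZero K]

theorem vals_eq_of_coeff_psumPar {μ : Par} {m : ℕ →₀ ℕ}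
    (h : MvPowerSeries.coeff m (psumPar K μ : MvPowerSeries ℕ K) ≠ 0) :
    m.support.card ≤ Multiset.card μ.2.parts ∧
      (m.support.card = Multiset.card μ.2.parts → vals m = μ.2.parts) := by
  rw [coeff_psumPar] at h
  exact vals_eq_of_coeff_ne_zero _ (parts_pos μ) m fun h' => h (by rw [h', Nat.cast_zero])

theorem coeff_psumPar_ne_zero {μ : Par} {m : ℕ →₀ ℕ} (h : vals m = μ.2.parts) :
    MvPowerSeries.coeff m (psumPar K μ : MvPowerSeries ℕ K) ≠ 0 := by
  rw [coeff_psumPar]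
  exact Nat.cast_ne_zero.2 (coeff_psumProd_pos _ (parts_pos μ) m h).ne'

/-- The coefficient of a monomial, as a linear functional on symmetric functions. -/
def coeffLin (m : ℕ →₀ ℕ) : symFun K →ₗ[K] K :=
  (MvPowerSeries.coeff m).comp (symFun K).val.toLinearMap

theorem linearIndependent_psumPar : LinearIndependent K (psumPar K) := by
  classical
  rw [linearIndependent_iff']
  intro t g hg
  by_contra hne
  push Not at hne
  obtain ⟨i0, hi0, hgi0⟩ := hne
  obtain ⟨i, hi, hmax⟩ := Finset.exists_max_image (t.filter fun i => g i ≠ 0)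
    (fun i : Par => Multiset.card i.2.parts) ⟨i0, Finset.mem_filter.2 ⟨hi0, hgi0⟩⟩
  rw [Finset.mem_filter] at hi
  obtain ⟨m, hm⟩ := exists_vals i.2.parts (parts_pos i)
  have h := congrArg (coeffLin K m) hg
  rw [map_sum, map_zero, Finset.sum_eq_single i] at h
  · rw [map_smul, smul_eq_mul] at h
    exact (mul_ne_zero hi.2 (coeff_psumPar_ne_zero K hm)) h
  · intro j hj hji
    rw [map_smul, smul_eq_mul]
    by_cases hgj : g j = 0
    · rw [hgj, zero_mul]
    · have hle := hmax j (Finset.mem_filter.2 ⟨hj, hgj⟩)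
      by_contra hc
      obtain ⟨h1, h2⟩ := vals_eq_of_coeff_psumPar K (right_ne_zero_of_mul hc)
      have hcard := congrArg Multiset.card hm
      rw [card_vals] at hcard
      have := h2 (by omega)
      exact hji (par_ext (this.symm.trans hm))
  · exact fun h => absurd hi.1 h

theorem mem_span_psumPar (k : ℕ) : ∀ f : symFun K,
    (∀ m : ℕ →₀ ℕ, coeffLin K m f ≠ 0 → m.support.card < k) →
      f ∈ Submodule.span K (Set.range (psumPar K)) := by
  classical
  induction k with
  | zero =>
    intro f hf
    have : f = 0 := by
      apply Subtype.ext
      ext m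
      by_contra h
      exact absurd (hf m h) (Nat.not_lt_zero _)
    rw [this]
    exact Submodule.zero_mem _
  | succ k ih =>
    intro f hf
    obtain ⟨N, hN⟩ := f.2.2
    choose ex hex using fun μ : Par => exists_vals μ.2.parts (parts_pos μ)
    set T : Finset Par := ((Finset.range (N + 1)).sigma fun d => (Finset.univ : Finset d.Partition)
      ).filter fun μ => Multiset.card μ.2.parts = k with hT
    have hTmem : ∀ μ : Par, μ ∈ T ↔ μ.1 ≤ N ∧ Multiset.card μ.2.parts = k := by
      intro μ
      simp [hT]
    set c : Par → K := fun μ => coeffLin K (ex μ) f / coeffLin K (ex μ) (psumPar K μ) with hc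
    have hg : ∑ μ ∈ T, c μ • psumPar K μ ∈ Submodule.span K (Set.range (psumPar K)) :=
      Submodule.sum_mem _ fun μ _ => Submodule.smul_mem _ _ (Submodule.subset_span ⟨μ, rfl⟩)
    have hsub : f - ∑ μ ∈ T, c μ • psumPar K μ ∈ Submodule.span K (Set.range (psumPar K)) := by
      apply ih
      intro m hm
      by_contra hlt
      push Not at hlt
      apply hm
      rw [map_sub, map_sum]
      have hcase : ∀ μ ∈ T, coeffLin K m (psumPar K μ) ≠ 0 →
          m.support.card = k ∧ vals m = μ.2.parts := by
        intro μ hμ hne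
        obtain ⟨h1, h2⟩ := vals_eq_of_coeff_psumPar K hne
        have h3 := ((hTmem μ).1 hμ).2
        have h4 : m.support.card = k := by omega
        exact ⟨h4, h2 (by omega)⟩
      by_cases hμ : ∃ μ ∈ T, vals m = μ.2.parts
      · obtain ⟨μ, hμT, hμ⟩ := hμ
        rw [Finset.sum_eq_single μ]
        · have e1 : coeffLin K m f = coeffLin K (ex μ) f :=
            coeff_eq_of_vals f.2 (hμ.trans (hex μ).symm)
          have e2 : coeffLin K m (psumPar K μ) = coeffLin K (ex μ) (psumPar K μ) :=
            coeff_eq_of_vals (psumPar K μ).2 (hμ.trans (hex μ).symm)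
          have e3 : coeffLin K (ex μ) (psumPar K μ) ≠ 0 := coeff_psumPar_ne_zero K (hex μ)
          rw [map_smul, smul_eq_mul, e1, e2, hc]
          simp only
          rw [div_mul_cancel₀ _ e3, sub_self]
        · intro ν hν hne
          rw [map_smul, smul_eq_mul]
          by_contra hcn
          have := (hcase ν hν (right_ne_zero_of_mul hcn)).2
          exact hne (par_ext (this.symm.trans hμ))
        · exact fun h => absurd hμT h
      · rw [Finset.sum_eq_zero, sub_zero]
        · by_contra hne
          have h1 := hf m hne
          have h2 : m.support.card = k := by omega
          refine hμ ⟨⟨m.degree, vals m, fun h => pos_of_mem_vals h, sum_vals m⟩, ?_, rfl⟩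
          rw [hTmem]
          exact ⟨hN m hne, by rw [card_vals, h2]⟩
        · intro ν hν
          rw [map_smul, smul_eq_mul]
          by_contra hcn
          exact hμ ⟨ν, hν, (hcase ν hν (right_ne_zero_of_mul hcn)).2⟩
    have := Submodule.add_mem _ hsub hg
    rwa [sub_add_cancel] at this

theorem top_le_span_psumPar : ⊤ ≤ Submodule.span K (Set.range (psumPar K)) := by
  intro f _
  obtain ⟨N, hN⟩ := f.2.2
  refine mem_span_psumPar K (N + 1) f fun m hm => Nat.lt_succ_of_le (le_trans ?_ (hN m hm))
  rw [← sum_vals, ← card_vals]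
  exact Multiset.card_nsmul_le_sum (fun a ha => pos_of_mem_vals ha) |>.trans' (by simp)

end helper

/-- Over a field of characteristic zero the power sums `p_μ` form a basis. -/
def psumBasis (K : Type*) [Field K] [CharZero K] : Module.Basis Par K (symFun K) :=
  Module.Basis.mk (linearIndependent_psumPar K) (top_le_span_psumPar K)

/-- `z_μ = ∏_{i ≥ 1} i ^ {m_i} m_i!`, where `m_i` is the multiplicity of `i` in `μ`. -/
def zPar (μ : Par) : ℕ :=
  ∏ i ∈ Finset.Icc 1 μ.1, i ^ μ.2.parts.count i * (μ.2.parts.count i).factorial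

/-- The `s`-form: the bilinear form with `⟨p_μ, p_ν⟩_s = δ_{μν} s ^ {ℓ(μ)} z_μ`. -/
def sForm (K : Type*) [Field K] [CharZero K] (s : K) :
    symFun K →ₗ[K] symFun K →ₗ[K] K :=
  (psumBasis K).constr K fun μ =>
    (s ^ Multiset.card μ.2.parts * (zPar μ : K)) • (psumBasis K).coord μ

open Classical in
theorem sForm_psumPar (K : Type*) [Field K] [CharZero K] (s : K) (μ ν : Par) :
    sForm K s (psumPar K μ) (psumPar K ν) =
      if μ = ν then s ^ Multiset.card μ.2.parts * (zPar μ : K) else 0 := by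
  have h : ∀ ρ, psumPar K ρ = psumBasis K ρ := fun ρ => by rw [psumBasis, Module.Basis.mk_apply]
  rw [h, h, sForm, Module.Basis.constr_basis, LinearMap.smul_apply, Module.Basis.coord_apply,
    Module.Basis.repr_self, Finsupp.single_apply, smul_eq_mul]
  by_cases e : μ = ν
  · simp [e]
  · simp [e, Ne.symm e]

/-- The inclusion of symmetric functions over `ℤ` into symmetric functions over `ℂ`. -/
def toComplex : symFun ℤ →+ symFun ℂ where
  toFun f := ⟨MvPowerSeries.map (Int.castRingHom ℂ) f, fun σ => by
      rw [MvPowerSeries.rename_map, f.2.1 σ], by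
      obtain ⟨N, hN⟩ := f.2.2
      refine ⟨N, fun m hm => hN m fun h => hm ?_⟩
      rw [MvPowerSeries.coeff_map, h, map_zero]⟩
  map_zero' := Subtype.ext (map_zero _)
  map_add' f g := Subtype.ext (map_add _ _ _)

/-- The restriction of the `s`-form to the degree-`d` part of the ring of symmetric functions
over `ℤ`. -/
def sFormDeg (s d : ℕ) : symDeg ℤ d →+ symDeg ℤ d →+ ℂ where
  toFun f :=
    { toFun := fun g => sForm ℂ s (toComplex f) (toComplex g)
      map_zero' := by simp
      map_add' := fun g g' => by simp }
  map_zero' := by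
    ext g
    simp
  map_add' f f' := by
    ext g
    simp

/-- With respect to suitable `ℤ`-bases `u` and `v` of `M`, the Gram matrix of the form `B` is the
Smith normal form `diag(a_0, a_1, …)` with `a_0 ∣ a_1 ∣ ⋯`, and `S` is the multiset
`{a_0, a_1, …}`. -/
def HasElementaryDivisors {M : Type*} [AddCommGroup M] (B : M →+ M →+ ℂ) (S : Multiset ℕ) : Prop :=
  ∃ (n : ℕ) (a : Fin n → ℕ) (u v : Module.Basis (Fin n) ℤ M),
    (∀ i j, i ≤ j → a i ∣ a j) ∧
    (∀ i j, B (u i) (v j) = if i = j then (a i : ℂ) else 0) ∧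
    (Finset.univ : Finset (Fin n)).val.map a = S

/-- `d_p(a) = ∑_{j ≥ 1} ⌊a / p ^ j⌋`; for `p ≥ 2` the terms with `j > a` vanish. -/
def dp (p a : ℕ) : ℕ := ∑ j ∈ Finset.Icc 1 a, a / p ^ j

/-- `D_r(μ) = ∏_{(n,p)=1} ∏_{i<r} p ^ ((r - i) m_{p^i n}(μ) + d_p(m_{p^i n}(μ)))`; for `μ ⊢ d` the
factors with `n > d` are `1`. -/
def divisorD (p r : ℕ) {d : ℕ} (μ : d.Partition) : ℕ :=
  ∏ n ∈ (Finset.Icc 1 d).filter (fun n => n.Coprime p), ∏ i ∈ Finset.range r,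
    p ^ ((r - i) * μ.parts.count (p ^ i * n) + dp p (μ.parts.count (p ^ i * n)))

/-- `f ↦ f(x)`, where the `x`-variables are indexed by `Sum.inl`. -/
def inX : MvPowerSeries ℕ ℤ →ₐ[ℤ] MvPowerSeries (ℕ ⊕ ℕ) ℤ :=
  MvPowerSeries.rename (Function.Embedding.inl : ℕ ↪ ℕ ⊕ ℕ)

/-- `f ↦ f(y)`, where the `y`-variables are indexed by `Sum.inr`. -/
def inY : MvPowerSeries ℕ ℤ →ₐ[ℤ] MvPowerSeries (ℕ ⊕ ℕ) ℤ :=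
  MvPowerSeries.rename (Function.Embedding.inr : ℕ ↪ ℕ ⊕ ℕ)

/-- The factor `(1 - x_i y_j)⁻¹`. -/
def cauchyFactor (ij : ℕ × ℕ) : MvPowerSeries (ℕ ⊕ ℕ) ℤ :=
  MvPowerSeries.invOfUnit (1 - MvPowerSeries.X (Sum.inl ij.1) * MvPowerSeries.X (Sum.inr ij.2)) 1

theorem cauchyFactor_mul (ij : ℕ × ℕ) : cauchyFactor ij *
    (1 - MvPowerSeries.X (Sum.inl ij.1) * MvPowerSeries.X (Sum.inr ij.2)) = 1 := by
  rw [mul_comm]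
  exact MvPowerSeries.mul_invOfUnit _ _ (by simp)

/-- `Π(x, y) = ∏_{i,j} (1 - x_i y_j)⁻¹`, an infinite product in the topology of coefficientwise
convergence. -/
def cauchyKernel : MvPowerSeries (ℕ ⊕ ℕ) ℤ := ∏' ij : ℕ × ℕ, cauchyFactor ij

/-- The product that defines `Π(x, y)` converges. -/
theorem multipliable_cauchyFactor : Multipliable cauchyFactor := by
  set w : ℕ ⊕ ℕ → ℕ := Sum.elim id id with hw
  rw [← Nat.pairEquiv.symm.multipliable_iff]
  have key : ∀ ij : ℕ × ℕ, ((ij.1 + ij.2 : ℕ) : ℕ∞) ≤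
      MvPowerSeries.weightedOrder w (cauchyFactor ij - 1) := by
    intro ij
    have e : cauchyFactor ij - 1 =
        MvPowerSeries.monomial (Finsupp.single (Sum.inl ij.1) 1 + Finsupp.single (Sum.inr ij.2) 1) 1
          * cauchyFactor ij := by
      have h := cauchyFactor_mul ij
      have h2 : (MvPowerSeries.monomial (R := ℤ)
          (Finsupp.single (Sum.inl ij.1) 1 + Finsupp.single (Sum.inr ij.2) 1) 1) =
          MvPowerSeries.X (Sum.inl ij.1) * MvPowerSeries.X (Sum.inr ij.2) := by
        rw [MvPowerSeries.X, MvPowerSeries.X, MvPowerSeries.monomial_mul_monomial, mul_one]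
      rw [h2]
      linear_combination h
    rw [e]
    refine le_trans ?_ (MvPowerSeries.le_weightedOrder_mul w)
    refine le_trans ?_ le_self_add
    rw [MvPowerSeries.weightedOrder_monomial_of_ne_zero _ one_ne_zero]
    rw [map_add, Finsupp.weight_single, Finsupp.weight_single]
    simp [hw]
  have h1 : (cauchyFactor ∘ Nat.pairEquiv.symm) =
      (1 + (fun k => cauchyFactor (Nat.pairEquiv.symm k) - 1) ·) := by
    funext k
    simp
  rw [h1]
  apply MvPowerSeries.WithPiTopology.multipliable_one_add_of_tendsto_weightedOrder_atTop_nhds_top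
    (w := w)
  rw [ENat.tendsto_nhds_top_iff_natCast_lt]
  intro N
  have hfin : {k : ℕ | (Nat.unpair k).1 + (Nat.unpair k).2 ≤ N}.Finite := by
    have : {q : ℕ × ℕ | q.1 + q.2 ≤ N}.Finite :=
      ((Set.finite_Iic N).prod (Set.finite_Iic N)).subset fun q hq => by
        simp only [Set.mem_ofPred_eq] at hq
        simp only [Set.mem_prod, Set.mem_Iic]
        omega
    exact this.preimage (Nat.pairEquiv.symm.injective.injOn)
  have hev := hfin.eventually_cofinite_notMem
  rw [Nat.cofinite_eq_atTop] at hev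
  filter_upwards [hev] with k hk
  refine lt_of_lt_of_le ?_ (key _)
  simp only [Set.mem_ofPred_eq, not_le] at hk
  exact_mod_cast hk

end SymFun

end

noncomputable section

namespace SymFun

/-! Let θ be the plethysm on Λ that repeats each variable s = p^r times, so that θ p_n = p^r p_n.
Then ⟨f, g⟩_s = ⟨θ f, g⟩, where ⟨ , ⟩ is the Hall form, and the Hall form is unimodular on Λ_d
because the h_λ are dual to the monomial functions. The elementary divisors of the s-form are
therefore those of θ on Λ_d. Likewise the coefficient of y^b in the s-th power of the Cauchy kernel
is θ(h_b)(x). So both assertions follow from bases u, v of Λ_d with θ u_λ = D_r(λ) v_λ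
(`exists_theta_bases`): the form becomes diagonal with respect to u and the dual basis of v, and the
kernel expands in v and the dual basis of u.

The cokernel of θ is p-primary, so Smith's theorem reduces the search for u and v to a problem
modulo p (`exists_bases_of_spansMod`): it suffices to find families g_λ and t_λ in Λ_d, each
spanning modulo p, with θ g_λ = p^{e_λ} t_λ. Indeed the number of λ with e_λ ≥ j is the dimension of
the image in Λ_d/p of {x : θ x ∈ p^j Λ_d}, which depends on θ only.

These families come from a p-derivation. The Adams operation φ, f ↦ f(x_1^p, x_2^p, …), lifts the
Frobenius, so φ f = f^p + p δf. It commutes with θ, hence so does δ. The pairing of δ^k p_n with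
p_{p^k n} is n, so modulo p the elements δ^k p_n with n prime to p generate Λ (`mem_lowerRing_gen`).
Fix such an n and put x = p_n.

Targets: since δ(p^{a+1} t) = p^a (φ t - p^{(p-1)(a+1)} t^p), each δ removes one factor p, and θ(δ^i
x) = p^{r-i} t_i for i ≤ r, with θ(δ^{r+k} x) = δ^k t_r. Modulo p and the δ^j x with j < k, the
element δ^k t_i is the power (δ^k x)^{p^i} (`iterate_delta_tgt_sub_mem`).

Sources: from θ g = p^e t with e > 0 one builds g_k ≡ ± g^{p^k} mod p with θ g_k = p^{e_k} δ^k t and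
e_{k+1} = p e_k + 1. If c has base p digits c_k, then ∏ g_k^{c_k} ≡ ± g^c, and its image carries
exactly p^{e c + d_p(c)}. With g = δ^i x, e = r - i and c = m_{p^i n}(λ) these are the factors of
D_r(λ).

Modulo p the sources are, up to sign, all monomials in the generators. The targets are products of
(δ^k t_i)^{c_{i,k}} for i < r, where c_{i,k} is the k-th digit of m_{p^i n}, and of powers of δ^k
t_r. Collected by k, with the digits transposed, they provide one monic polynomial in δ^k x of each
degree, because each degree is uniquely ∑_{i<r} c_i p^i + p^r q with 0 ≤ c_i < p. Triangularity then
shows that the targets span modulo p (`spansMod_tgtFam`). -/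

/-- A lift `φ` of the Frobenius of a ring in which `p` is cancelable, together with the induced
`p`-derivation `δ`, so that `φ a = a ^ p + p δ a`. -/
structure FrobLift (p : ℕ) (A : Type*) [CommRing A] where
  /-- the lift of the Frobenius -/
  φ : A →+* A
  /-- the `p`-derivation -/
  δ : A → A
  spec : ∀ a, φ a = a ^ p + p * δ a
  cancel : ∀ a b : A, (p : A) * a = p * b → a = b

/-! ### Calculus of a `p`-derivation and filtrations by subrings -/

namespace FrobLift

variable {p : ℕ} {A : Type*} [CommRing A] (F : FrobLift p A)

theorem delta_eq {a b : A} (h : F.φ a = a ^ p + p * b) : F.δ a = b :=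
  F.cancel _ _ (by linear_combination h - F.spec a)

theorem phi_delta (a : A) : F.φ (F.δ a) = F.δ (F.φ a) := by
  refine (F.delta_eq (F.cancel _ _ ?_)).symm
  have h := congrArg F.φ (F.spec a)
  rw [map_add, map_pow, map_mul, map_natCast] at h
  linear_combination (p : A) * h

theorem phi_iterate_delta (k : ℕ) (a : A) : F.φ (F.δ^[k] a) = F.δ^[k] (F.φ a) :=
  (Function.Commute.iterate_right (f := F.φ) (g := F.δ) F.phi_delta k) a

/-- Each application of `δ` costs one factor `p`: the two terms `φ` and `p`-th power carry `p ^ (a +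
1)` and `p ^ (p (a + 1))`, and their difference is divided by `p`. -/
theorem delta_prime_pow_mul (hp : p ≠ 0) (a : ℕ) (t : A) :
    F.δ (p ^ (a + 1) * t) = p ^ a * (F.φ t - p ^ ((p - 1) * (a + 1)) * t ^ p) := by
  apply F.delta_eq
  obtain ⟨q, rfl⟩ := Nat.exists_eq_succ_of_ne_zero hp
  rw [map_mul, map_pow, map_natCast, Nat.succ_sub_one, mul_pow, ← pow_mul,
    show (a + 1) * q.succ = q * (a + 1) + (a + 1) by rw [Nat.succ_eq_add_one]; ring]
  ring

/-- The condition that `δ^k f ∈ E (n + k)` for `k ≤ K`. -/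
def InFilt (E : ℕ → Subring A) : ℕ → ℕ → A → Prop
  | 0, n, f => f ∈ E n
  | K + 1, n, f => InFilt E K n f ∧ InFilt E K (n + 1) (F.δ f)

variable {F} {E : ℕ → Subring A}

theorem InFilt.succ (hE : Monotone E) {K n : ℕ} {f : A} (h : F.InFilt E K n f) :
    F.InFilt E K (n + 1) f := by
  induction K generalizing n f with
  | zero => exact hE n.le_succ h
  | succ K ih => exact ⟨ih h.1, ih h.2⟩

theorem InFilt.mem {K n : ℕ} {f : A} (h : F.InFilt E K n f) : f ∈ E n := by
  induction K generalizing n f with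
  | zero => exact h
  | succ K ih => exact ih h.1

/-- `δ (a + b)` and `δ (a b)` are integral polynomials in `a`, `b`, `δ a`, `δ b`, so the condition
passes to sums and products by induction on `K`. Monotonicity lets `a` and `b` themselves be used
one level higher. -/
theorem exists_subring_inFilt (hp : p.Prime) (hE : Monotone E) (K n : ℕ) :
    ∃ S : Subring A, ∀ f, f ∈ S ↔ F.InFilt E K n f := by
  induction K generalizing n with
  | zero => exact ⟨E n, fun f => Iff.rfl⟩
  | succ K ih =>
    obtain ⟨S, hS⟩ := ih n
    obtain ⟨S', hS'⟩ := ih (n + 1)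
    have hle : ∀ {f}, f ∈ S → f ∈ S' := fun {f} hf => (hS' f).2 (((hS f).1 hf).succ hE)
    have key : ∀ f, F.InFilt E (K + 1) n f ↔ f ∈ S ∧ F.δ f ∈ S' := fun f => by
      rw [hS, hS']; rfl
    have hadd : ∀ a ∈ S', ∀ b ∈ S', ∃ r ∈ S', (a + b) ^ p = a ^ p + b ^ p + p * r := by
      intro a ha b hb
      -- The binomial remainder is computed inside the subring `S'`, so that it stays there.
      obtain ⟨r, hr⟩ := exists_add_pow_prime_eq hp (⟨a, ha⟩ : S') ⟨b, hb⟩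
      refine ⟨a * b * r, mul_mem (mul_mem ha hb) r.2, ?_⟩
      have := congrArg (Subtype.val) hr
      push_cast at this ⊢
      linear_combination this
    refine ⟨{ carrier := {f | f ∈ S ∧ F.δ f ∈ S'}
              mul_mem' := ?_
              one_mem' := ?_
              add_mem' := ?_
              zero_mem' := ?_
              neg_mem' := ?_ }, fun f => (key f).symm⟩
    · rintro a b ⟨ha, ha'⟩ ⟨hb, hb'⟩
      refine ⟨mul_mem ha hb, ?_⟩
      rw [F.delta_eq (a := a * b) (b := a ^ p * F.δ b + b ^ p * F.δ a + p * (F.δ a * F.δ b))]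
      · exact add_mem (add_mem (mul_mem (pow_mem (hle ha) _) hb')
          (mul_mem (pow_mem (hle hb) _) ha')) (mul_mem (natCast_mem _ _) (mul_mem ha' hb'))
      · rw [map_mul, F.spec, F.spec]
        ring
    · refine ⟨one_mem _, ?_⟩
      rw [F.delta_eq (a := 1) (b := 0) (by simp)]
      exact zero_mem _
    · rintro a b ⟨ha, ha'⟩ ⟨hb, hb'⟩
      refine ⟨add_mem ha hb, ?_⟩
      obtain ⟨r, hr, e⟩ := hadd a (hle ha) b (hle hb)
      rw [F.delta_eq (a := a + b) (b := F.δ a + F.δ b - r)]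
      · exact sub_mem (add_mem ha' hb') hr
      · rw [map_add, F.spec, F.spec, e]
        ring
    · refine ⟨zero_mem _, ?_⟩
      rw [F.delta_eq (a := 0) (b := 0) (by simp [hp.ne_zero])]
      exact zero_mem _
    · rintro a ⟨ha, ha'⟩
      refine ⟨neg_mem ha, ?_⟩
      obtain ⟨r, hr, e⟩ := hadd a (hle ha) (-a) (neg_mem (hle ha))
      -- Using the sum formula for `a + (-a) = 0` avoids a separate treatment of the sign of `(-1) ^
      -- p` when `p = 2`.
      rw [add_neg_cancel, zero_pow hp.ne_zero] at e
      rw [F.delta_eq (a := -a) (b := r - F.δ a)]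
      · exact sub_mem hr ha'
      · rw [map_neg, F.spec]
        linear_combination e

theorem InFilt.add (hp : p.Prime) (hE : Monotone E) {K n : ℕ} {f g : A}
    (hf : F.InFilt E K n f) (hg : F.InFilt E K n g) : F.InFilt E K n (f + g) := by
  obtain ⟨S, hS⟩ := exists_subring_inFilt (F := F) hp hE K n
  rw [← hS] at *
  exact add_mem hf hg

theorem InFilt.mul (hp : p.Prime) (hE : Monotone E) {K n : ℕ} {f g : A}
    (hf : F.InFilt E K n f) (hg : F.InFilt E K n g) : F.InFilt E K n (f * g) := by
  obtain ⟨S, hS⟩ := exists_subring_inFilt (F := F) hp hE K n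
  rw [← hS] at *
  exact mul_mem hf hg

theorem InFilt.neg (hp : p.Prime) (hE : Monotone E) {K n : ℕ} {f : A}
    (hf : F.InFilt E K n f) : F.InFilt E K n (-f) := by
  obtain ⟨S, hS⟩ := exists_subring_inFilt (F := F) hp hE K n
  rw [← hS] at *
  exact neg_mem hf

theorem InFilt.pow (hp : p.Prime) (hE : Monotone E) {K n : ℕ} {f : A}
    (hf : F.InFilt E K n f) (j : ℕ) : F.InFilt E K n (f ^ j) := by
  obtain ⟨S, hS⟩ := exists_subring_inFilt (F := F) hp hE K n
  rw [← hS] at *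
  exact pow_mem hf j

theorem inFilt_natCast (hp : p.Prime) (hE : Monotone E) (K n j : ℕ) :
    F.InFilt E K n (j : A) := by
  obtain ⟨S, hS⟩ := exists_subring_inFilt (F := F) hp hE K n
  rw [← hS] at *
  exact natCast_mem _ j

/-- A factor `p` gains one level: `p u` lies in every `E n`, and `δ (p u) = u ^ p + p δ u - p ^ (p -
1) u ^ p`, where the middle term is handled by induction. -/
theorem InFilt.prime_mul (hp : p.Prime) (hE : Monotone E) (hpE : ∀ n a, (p : A) * a ∈ E n)
    {K n : ℕ} {u : A} (hu : F.InFilt E K (n + 1) u) : F.InFilt E K n (p * u) := by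
  induction K generalizing n u with
  | zero => exact hpE n u
  | succ K ih =>
    refine ⟨ih hu.1, ?_⟩
    have e := F.delta_prime_pow_mul hp.ne_zero 0 u
    rw [zero_add, pow_one, pow_zero, one_mul, F.spec, mul_one, ← Nat.cast_pow] at e
    rw [e, sub_eq_add_neg]
    exact ((hu.1.pow hp hE p).add hp hE (ih hu.2)).add hp hE
      (((inFilt_natCast hp hE _ _ _).mul hp hE (hu.1.pow hp hE p)).neg hp hE)

/-- A perturbation `b` one level below `a` keeps this gap under `δ`: `δ (a + b) - δ a = δ b - a b r`
with `r` a polynomial in `a` and `b`. The induction replaces `(a, b)` by `(δ a, δ (a + b) - δ a)`.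
-/
theorem iterate_delta_add_sub_mem (hp : p.Prime) (hE : Monotone E) {K n : ℕ} {a b : A}
    (ha : F.InFilt E K (n + 1) a) (hb : F.InFilt E K n b) :
    F.δ^[K] (a + b) - F.δ^[K] a ∈ E (n + K) := by
  induction K generalizing n a b with
  | zero => simpa using hb.mem
  | succ K ih =>
    rw [Function.iterate_succ_apply, Function.iterate_succ_apply]
    have e : F.δ (a + b) = F.δ a + (F.δ (a + b) - F.δ a) := by ring
    rw [e, show n + (K + 1) = n + 1 + K by ring]
    refine ih ha.2 ?_
    obtain ⟨S, hS⟩ := exists_subring_inFilt (F := F) hp hE K (n + 1)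
    rw [← hS]
    have ha' := (hS _).2 ha.1
    have hb' := (hS _).2 (hb.1.succ hE)
    obtain ⟨r, hr⟩ := exists_add_pow_prime_eq hp (⟨a, ha'⟩ : S) ⟨b, hb'⟩
    have hr' := congrArg Subtype.val hr
    push_cast at hr'
    have e2 : F.δ (a + b) - F.δ a = F.δ b - a * b * r := by
      rw [F.delta_eq (a := a + b) (b := F.δ a + F.δ b - a * b * r)]
      · ring
      · rw [map_add, F.spec, F.spec, hr']
        ring
    rw [e2]
    exact sub_mem ((hS _).2 hb.2) (mul_mem (mul_mem ha' hb') r.2)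

theorem inFilt_of_forall {f : A} {K n : ℕ} (h : ∀ k ≤ K, ∀ m, n + k ≤ m → F.δ^[k] f ∈ E m) :
    F.InFilt E K n f := by
  induction K generalizing n f with
  | zero => exact h 0 le_rfl n (by omega)
  | succ K ih =>
    refine ⟨ih fun k hk => h k (by omega), ih fun k hk m hm => ?_⟩
    exact h (k + 1) (by omega) m (by omega)

/-- If `δ^k s` is monic of degree `q` in `δ^k x` modulo lower terms, for all `k`, then
`δ^k (φ s - p ^ c s ^ p)` is monic of degree `p q`. -/
theorem monic_step (hp : p.Prime) (hE : Monotone E) (hpE : ∀ n a, (p : A) * a ∈ E n)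
    {x s : A} (hx : ∀ k, F.δ^[k] x ∈ E (k + 1)) {q c : ℕ}
    (hs : ∀ k, F.δ^[k] s - (F.δ^[k] x) ^ q ∈ E k) (k : ℕ) :
    F.δ^[k] (F.φ s - p ^ (c + 1) * s ^ p) - (F.δ^[k] x) ^ (p * q) ∈ E k := by
  have hsE : ∀ j, F.δ^[j] s ∈ E (j + 1) := fun j => by
    have := add_mem (hE j.le_succ (hs j)) (pow_mem (hx j) q)
    rwa [sub_add_cancel] at this
  have hsF : ∀ K, F.InFilt E K 1 s := fun K =>
    inFilt_of_forall fun j _ m hm => hE (by omega) (hsE j)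
  -- The factor `p` puts the correction term one level below `φ s`, so it does not affect the
  -- leading term of `δ^k`.
  have hb : F.InFilt E k 0 (-(p ^ (c + 1) * s ^ p)) := by
    rw [pow_succ', mul_assoc, ← Nat.cast_pow]
    exact InFilt.neg hp hE (InFilt.prime_mul hp hE hpE
      ((inFilt_natCast hp hE _ _ _).mul hp hE ((hsF k).pow hp hE p)))
  have ha : F.InFilt E k 1 (F.φ s) := by
    rw [F.spec]
    exact ((hsF k).pow hp hE p).add hp hE
      (InFilt.prime_mul hp hE hpE (hsF (k + 1)).2)
  have h1 := iterate_delta_add_sub_mem hp hE ha hb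
  rw [zero_add, ← sub_eq_add_neg] at h1
  -- `δ` commutes with `φ`, and `φ` is the `p`-th power modulo `p`.
  have h2 : F.δ^[k] (F.φ s) - (F.δ^[k] x) ^ (p * q) ∈ E k := by
    rw [← phi_iterate_delta, F.spec, mul_comm p q, pow_mul]
    obtain ⟨r, hr⟩ := exists_add_pow_prime_eq hp (F.δ^[k] s - (F.δ^[k] x) ^ q) ((F.δ^[k] x) ^ q)
    rw [sub_add_cancel] at hr
    rw [hr]
    have := add_mem (pow_mem (hs k) p) (hpE k ((F.δ^[k] s - (F.δ^[k] x) ^ q) *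
      ((F.δ^[k] x) ^ q) * r + F.δ (F.δ^[k] s)))
    convert this using 1
    ring
  have := add_mem h1 h2
  rwa [sub_add_sub_cancel] at this

/-! ### Elements divisible by controlled powers of `p` under `θ` -/

variable (F)

/-- The elements `t_i` with `θ (δ^i x) = p ^ (r - i) t_i` when `θ x = p ^ r x`. -/
def tgt (r : ℕ) (x : A) : ℕ → A
  | 0 => x
  | i + 1 => F.φ (tgt r x i) - p ^ ((p - 1) * (r - i)) * tgt r x i ^ p

/-- For `i < r` the exponent `(p - 1) (r - i)` is positive, so the passage from `t_i` to `t_{i+1}`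
is an instance of `monic_step` and multiplies the degree by `p`. -/
theorem iterate_delta_tgt_sub_mem (hp : p.Prime) (hE : Monotone E)
    (hpE : ∀ n a, (p : A) * a ∈ E n) {x : A} (hx : ∀ k, F.δ^[k] x ∈ E (k + 1)) (r i : ℕ)
    (hi : i ≤ r) (k : ℕ) : F.δ^[k] (F.tgt r x i) - (F.δ^[k] x) ^ p ^ i ∈ E k := by
  induction i generalizing k with
  | zero => simp [tgt]
  | succ i ih =>
    have hpos : 0 < (p - 1) * (r - i) :=
      Nat.mul_pos (by have := hp.two_le; omega) (by omega)
    obtain ⟨c, hc⟩ := Nat.exists_eq_succ_of_ne_zero hpos.ne'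
    rw [tgt, hc, pow_succ' p i]
    exact monic_step hp hE hpE hx (fun k => ih (by omega) k) k

variable {F} {θ : A →+* A}

theorem map_delta (hθ : ∀ a, θ (F.φ a) = F.φ (θ a)) (a : A) : θ (F.δ a) = F.δ (θ a) := by
  refine (F.delta_eq ?_).symm
  rw [← hθ, F.spec, map_add, map_pow, map_mul, map_natCast]

theorem map_iterate_delta (hθ : ∀ a, θ (F.φ a) = F.φ (θ a)) (k : ℕ) (a : A) :
    θ (F.δ^[k] a) = F.δ^[k] (θ a) :=
  (Function.Commute.iterate_right (f := θ) (g := F.δ) (map_delta hθ) k) a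

/-- `θ` commutes with `δ`, and `delta_prime_pow_mul` takes away one of the `r` factors `p` at each
step. -/
theorem map_iterate_delta_eq (hθ : ∀ a, θ (F.φ a) = F.φ (θ a)) (hp : p ≠ 0) {r : ℕ} {x : A}
    (hx : θ x = p ^ r * x) {i : ℕ} (hi : i ≤ r) : θ (F.δ^[i] x) = p ^ (r - i) * F.tgt r x i := by
  induction i with
  | zero => simpa [tgt] using hx
  | succ i ih =>
    rw [Function.iterate_succ_apply', map_delta hθ, ih (by omega),
      show r - i = (r - (i + 1)) + 1 by omega, F.delta_prime_pow_mul hp, tgt,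
      show r - (i + 1) + 1 = r - i by omega]

/-- After `r` steps the factors `p` are used up; from then on `δ` is just iterated on `t_r`. -/
theorem map_iterate_delta_add (hθ : ∀ a, θ (F.φ a) = F.φ (θ a)) (hp : p ≠ 0) {r : ℕ} {x : A}
    (hx : θ x = p ^ r * x) (k : ℕ) :
    θ (F.δ^[k + r] x) = F.δ^[k] (F.tgt r x r) := by
  rw [Function.iterate_add_apply, map_iterate_delta hθ, map_iterate_delta_eq hθ hp hx le_rfl]
  simp

/-- The exponents `e_0 = e` and `e_{k+1} = p e_k + 1`. -/
def srcExp (p e : ℕ) : ℕ → ℕ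
  | 0 => e
  | k + 1 => p * srcExp p e k + 1

variable (F) in
/-- The elements `g_0 = g` and `g_{k+1} = p ^ ((p - 1) e_k) φ(g_k) - g_k ^ p`. -/
def src (e : ℕ) (g : A) : ℕ → A
  | 0 => g
  | k + 1 => p ^ ((p - 1) * srcExp p e k) * F.φ (src e g k) - src e g k ^ p

/-- The factor `p ^ ((p - 1) e_k)` in the recursion balances the two terms: both images are
divisible by `p ^ (p e_k)`, and `φ (δ^k t) - (δ^k t) ^ p = p δ^{k+1} t` supplies the extra `p` in
`e_{k+1} = p e_k + 1`. -/
theorem map_src (hθ : ∀ a, θ (F.φ a) = F.φ (θ a)) (hp : p ≠ 0) {e : ℕ} {g t : A}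
    (h : θ g = p ^ e * t) (k : ℕ) :
    θ (F.src e g k) = p ^ srcExp p e k * F.δ^[k] t := by
  induction k with
  | zero => simpa [src, srcExp] using h
  | succ k ih =>
    obtain ⟨q, rfl⟩ := Nat.exists_eq_succ_of_ne_zero hp
    rw [src, srcExp, map_sub, map_mul, map_pow, map_natCast, map_pow, hθ, ih, map_mul, map_pow,
      map_natCast, F.spec, Function.iterate_succ_apply', Nat.succ_sub_one, mul_pow, ← pow_mul]
    generalize srcExp q.succ e k = E
    rw [show q.succ * E + 1 = q * E + E + 1 by rw [Nat.succ_eq_add_one]; ring,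
      show E * q.succ = q * E + E by rw [Nat.succ_eq_add_one]; ring]
    ring

/-- All `e_k` are positive, so the term with `φ` vanishes modulo `p` and `g_{k+1} ≡ -g_k ^ p`. This
is why `e > 0` is required. -/
theorem src_congr (hp : p.Prime) {e : ℕ} (he : 0 < e) (g : A) (k : ℕ) :
    ∃ (ε : ℤ) (b : A), (ε = 1 ∨ ε = -1) ∧ F.src e g k = ε * g ^ p ^ k + p * b := by
  induction k with
  | zero => exact ⟨1, 0, Or.inl rfl, by simp [src]⟩
  | succ k ih =>
    obtain ⟨ε, b, hε, h⟩ := ih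
    have hpos : 0 < (p - 1) * srcExp p e k := by
      refine Nat.mul_pos (by have := hp.two_le; omega) ?_
      cases k with
      | zero => exact he
      | succ k => simp [srcExp]
    obtain ⟨c, hc⟩ := Nat.exists_eq_succ_of_ne_zero hpos.ne'
    obtain ⟨r, hr⟩ := exists_add_pow_prime_eq hp ((ε : A) * g ^ p ^ k) (p * b)
    obtain ⟨q, hq⟩ := Nat.exists_eq_succ_of_ne_zero hp.ne_zero
    refine ⟨-ε ^ p, p ^ c * F.φ (F.src e g k) - p ^ q * b ^ p -
      (ε : A) * g ^ p ^ k * (p * b) * r, ?_, ?_⟩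
    · rcases hε with rfl | rfl
      · simp
      · rcases neg_one_pow_eq_or ℤ p with h | h <;> simp [h]
    · rw [src, hc]
      have : F.src e g k ^ p = ((ε : A) * g ^ p ^ k) ^ p + (p : A) ^ q.succ * b ^ p +
          p * ((ε : A) * g ^ p ^ k * (p * b) * r) := by
        rw [← hq, h, hr]
        ring
      rw [this, mul_pow, ← pow_mul, ← pow_succ, pow_succ (p : A) c, pow_succ (p : A) q]
      push_cast
      ring

end FrobLift

/-! ### Smith normal form from families that span modulo `p` -/

section Lattice

variable {M : Type*} [AddCommGroup M] {ι : Type*} [Fintype ι]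

/-- The family `g` generates the abelian group `M` modulo `p`. -/
def SpansMod (p : ℕ) (g : ι → M) : Prop :=
  ∀ x : M, ∃ (c : ι → ℤ) (y : M), x = ∑ i, c i • g i + (p : ℤ) • y

theorem SpansMod.pow {p : ℕ} {g : ι → M} (hg : SpansMod p g) (j : ℕ) (x : M) :
    ∃ (c : ι → ℤ) (y : M), x = ∑ i, c i • g i + ((p : ℤ) ^ j) • y := by
  induction j with
  | zero => exact ⟨0, x, by simp⟩
  | succ j ih =>
    obtain ⟨c, y, hy⟩ := ih
    obtain ⟨c', y', hy'⟩ := hg y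
    refine ⟨c + (p : ℤ) ^ j • c', y', ?_⟩
    rw [hy]
    nth_rewrite 1 [hy']
    simp only [Pi.add_apply, Pi.smul_apply, add_smul, Finset.sum_add_distrib, smul_add,
      Finset.smul_sum, smul_smul, smul_eq_mul, pow_succ]
    abel

variable (p : ℕ) (b : Module.Basis ι ℤ M)

/-- Reduction of the coordinates modulo `p`. -/
def redMod : M →+ (ι → ZMod p) where
  toFun x i := (b.repr x i : ZMod p)
  map_zero' := by ext; simp
  map_add' x y := by ext; simp

theorem redMod_smul {ι : Type*} (b : Module.Basis ι ℤ M) (c : ℤ) (x : M) :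
    redMod p b (c • x) = (c : ZMod p) • redMod p b x := by
  ext i
  simp [redMod]

theorem redMod_eq_zero {x : M} : redMod p b x = 0 ↔ ∃ y, x = (p : ℤ) • y := by
  constructor
  · intro h
    have h' : ∀ i, (p : ℤ) ∣ b.repr x i := fun i =>
      (ZMod.intCast_zmod_eq_zero_iff_dvd _ _).1 (congrFun h i)
    choose c hc using h'
    refine ⟨∑ i, c i • b i, ?_⟩
    rw [Finset.smul_sum, ← b.sum_repr x]
    refine Finset.sum_congr rfl fun i _ => ?_
    rw [hc, smul_smul]
  · rintro ⟨y, rfl⟩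
    rw [redMod_smul]
    simp

theorem redMod_surjective : Function.Surjective (redMod p b) := by
  intro w
  choose c hc using fun i => ZMod.intCast_surjective (w i)
  refine ⟨∑ i, c i • b i, ?_⟩
  ext i
  change ((b.repr _ i : ℤ) : ZMod p) = _
  rw [b.repr_sum_self, hc]

variable [hp : Fact p.Prime]

/-- The family has as many members as the rank, so spanning modulo `p` forces independence modulo
`p`. -/
theorem SpansMod.linearIndependent {g : ι → M} (hg : SpansMod p g) :
    LinearIndependent (ZMod p) fun i => redMod p b (g i) := by
  apply linearIndependent_of_top_le_span_of_card_eq_finrank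
  · rintro w -
    obtain ⟨x, rfl⟩ := redMod_surjective p b w
    obtain ⟨c, y, rfl⟩ := hg x
    rw [map_add, (redMod_eq_zero p b).2 ⟨y, rfl⟩, add_zero, map_sum]
    refine Submodule.sum_mem _ fun i _ => ?_
    rw [redMod_smul]
    exact Submodule.smul_mem _ _ (Submodule.subset_span ⟨i, rfl⟩)
  · simp

theorem smul_int_cancel {M ι : Type*} [AddCommGroup M] (b : Module.Basis ι ℤ M)
    {n : ℤ} (hn : n ≠ 0) {x y : M} (h : n • x = n • y) : x = y := by
  apply b.repr.injective
  ext i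
  have := congrArg (fun z => b.repr z i) h
  simp only [map_smul, Finsupp.smul_apply, smul_eq_mul] at this
  exact mul_left_cancel₀ hn this

/-- Independence modulo `p` makes every coefficient divisible by `p`; dividing the relation by `p`
in the torsion-free group `M` gives a descent on `j`. -/
theorem SpansMod.pow_dvd (p : ℕ) (b : Module.Basis ι ℤ M) [hp : Fact p.Prime]
    {g : ι → M} (hg : SpansMod p g) (j : ℕ) (c : ι → ℤ) (y : M)
    (h : ∑ i, c i • g i = ((p : ℤ) ^ j) • y) (i : ι) : (p : ℤ) ^ j ∣ c i := by
  have hp0 : (p : ℤ) ≠ 0 := by exact_mod_cast hp.out.ne_zero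
  induction j generalizing c with
  | zero => simp
  | succ j ih =>
    have h1 : ∀ i, (p : ℤ) ∣ c i := by
      have h0 := congrArg (redMod p b) h
      rw [pow_succ', mul_smul, (redMod_eq_zero p b).2 ⟨_, rfl⟩, map_sum] at h0
      simp only [redMod_smul] at h0
      have := Fintype.linearIndependent_iff.1 (hg.linearIndependent p b) _ h0
      exact fun i => (ZMod.intCast_zmod_eq_zero_iff_dvd _ _).1 (this i)
    choose c' hc' using h1
    have h2 : ∑ i, c' i • g i = ((p : ℤ) ^ j) • y := by
      apply smul_int_cancel b hp0
      rw [← mul_smul, ← pow_succ', ← h, Finset.smul_sum]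
      refine Finset.sum_congr rfl fun i _ => ?_
      rw [hc', mul_smul]
    rw [hc', pow_succ']
    exact mul_dvd_mul_left _ (ih c' h2)

/-- The number of exponents `≥ j` only depends on `θ`. -/
theorem finrank_span_redMod (θ : M →ₗ[ℤ] M) {g t : ι → M} {e : ι → ℕ} (hg : SpansMod p g)
    (ht : SpansMod p t)
    (hθ : ∀ i, θ (g i) = ((p : ℤ) ^ e i) • t i) (j : ℕ) :
    Module.finrank (ZMod p) (Submodule.span (ZMod p)
      (redMod p b '' {x | ∃ y, θ x = ((p : ℤ) ^ j) • y})) = Nat.card {i // j ≤ e i} := by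
  have hli := hg.linearIndependent p b
  have key : Submodule.span (ZMod p) (redMod p b '' {x | ∃ y, θ x = ((p : ℤ) ^ j) • y}) =
      Submodule.span (ZMod p) (Set.range fun i : {i // j ≤ e i} => redMod p b (g i)) := by
    apply le_antisymm
    · rw [Submodule.span_le]
      rintro _ ⟨x, ⟨y, hy⟩, rfl⟩
      -- Modulo `p ^ (j + 1)` the error term both disappears under reduction and has an image under
      -- `θ` divisible by `p ^ j`.
      obtain ⟨c, z, rfl⟩ := hg.pow (j + 1) x
      have h1 : ∑ i, (c i * (p : ℤ) ^ e i) • t i = ((p : ℤ) ^ j) • (y - (p : ℤ) • θ z) := by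
        rw [smul_sub, ← hy, map_add, map_sum, map_smul, smul_smul, ← pow_succ, add_sub_cancel_right]
        refine Finset.sum_congr rfl fun i _ => ?_
        rw [map_smul, hθ, smul_smul]
      have h2 := ht.pow_dvd p b j _ _ h1
      rw [SetLike.mem_coe, map_add, pow_succ', mul_smul, (redMod_eq_zero p b).2 ⟨_, rfl⟩, add_zero,
        map_sum]
      refine Submodule.sum_mem _ fun i _ => ?_
      rw [redMod_smul]
      by_cases hi : j ≤ e i
      · exact Submodule.smul_mem _ _ (Submodule.subset_span ⟨⟨i, hi⟩, rfl⟩)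
      · have h3 : (p : ℤ) ∣ c i := by
          have h4 := h2 i
          rw [show j = (j - e i - 1) + 1 + e i by omega, pow_add] at h4
          have h5 := Int.dvd_of_mul_dvd_mul_right
            (pow_ne_zero _ (by exact_mod_cast hp.out.ne_zero)) h4
          exact (Dvd.intro_left _ (pow_succ _ _).symm).trans h5
        rw [(ZMod.intCast_zmod_eq_zero_iff_dvd _ _).2 h3, zero_smul]
        exact Submodule.zero_mem _
    · rw [Submodule.span_le]
      rintro _ ⟨⟨i, hi⟩, rfl⟩
      refine Submodule.subset_span ⟨g i, ⟨(p : ℤ) ^ (e i - j) • t i, ?_⟩, rfl⟩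
      rw [hθ, smul_smul, ← pow_add]
      congr 2
      omega
  rw [key, Nat.card_eq_fintype_card]
  exact finrank_span_eq_card (hli.comp (Subtype.val : {i // j ≤ e i} → ι) Subtype.val_injective)

/-- Differences of consecutive counts give the sizes of the fibres of `e` and `f`, which are then
matched value by value. -/
theorem exists_equiv_of_card_le {e f : ι → ℕ}
    (h : ∀ j, Nat.card {i // j ≤ e i} = Nat.card {i // j ≤ f i}) :
    ∃ σ : ι ≃ ι, ∀ i, f (σ i) = e i := by
  classical
  have hc : ∀ j, Nat.card {i // e i = j} = Nat.card {i // f i = j} := by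
    intro j
    have key : ∀ f : ι → ℕ, Nat.card {i // j ≤ f i} =
        Nat.card {i // f i = j} + Nat.card {i // j + 1 ≤ f i} := by
      intro f
      simp only [Nat.card_eq_fintype_card, Fintype.card_subtype]
      rw [← Finset.card_union_of_disjoint]
      · congr 1
        ext i
        simp
        omega
      · rw [Finset.disjoint_filter]
        intros
        omega
    have h1 := key e
    have h2 := key f
    have h3 := h j
    have h4 := h (j + 1)
    omega
  have eq : ∀ j, {i // e i = j} ≃ {i // f i = j} := fun j =>
    Classical.choice ((Finite.card_eq).1 (hc j))
  exact ⟨Equiv.ofFiberEquiv eq, fun i => Equiv.ofFiberEquiv_map eq i⟩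

/-- An endomorphism of a lattice that is diagonal with respect to two families that are bases
modulo `p` is diagonal with the same entries with respect to two bases of the lattice, if its
cokernel is `p`-primary. -/
theorem exists_bases_of_spansMod (p : ℕ) (b : Module.Basis ι ℤ M) [hp : Fact p.Prime]
    (θ : M →ₗ[ℤ] M) {g t : ι → M} {e : ι → ℕ} (hg : SpansMod p g) (ht : SpansMod p t)
    (hθ : ∀ i, θ (g i) = ((p : ℤ) ^ e i) • t i)
    (hco : ∀ x, ∃ (K : ℕ) (y : M), θ y = ((p : ℤ) ^ K) • x) :
    ∃ u v : Module.Basis ι ℤ M, ∀ i, θ (u i) = ((p : ℤ) ^ e i) • v i := by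
  classical
  have hp0 : (p : ℤ) ≠ 0 := by exact_mod_cast hp.out.ne_zero
  have hfin : Module.Finite ℤ M := Module.Finite.of_basis b
  have hfree : Module.Free ℤ M := Module.Free.of_basis b
  -- The range contains a multiple `p ^ K b_i` of each basis vector, so it has full rank, as the
  -- Smith normal form with square diagonal requires.
  have hrank : Module.finrank ℤ (LinearMap.range θ) = Module.finrank ℤ M := by
    apply le_antisymm (Submodule.finrank_le _)
    choose K y hy using fun i => hco (b i)
    have hli : LinearIndependent ℤ fun i => (⟨θ (y i), y i, rfl⟩ : LinearMap.range θ) := by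
      apply LinearIndependent.of_comp (LinearMap.range θ).subtype
      rw [Fintype.linearIndependent_iff]
      intro c hc i
      simp only [Function.comp_apply, Submodule.subtype_apply, hy, smul_smul] at hc
      have := Fintype.linearIndependent_iff.1 b.linearIndependent _ hc i
      exact (mul_eq_zero.1 this).resolve_right (pow_ne_zero _ hp0)
    rw [Module.finrank_eq_card_basis b]
    exact hli.fintype_card_le_finrank
  have hinj : Function.Injective θ := by
    rw [← LinearMap.ker_eq_bot]
    have h := Submodule.finrank_quotient_add_finrank (LinearMap.ker θ)
    rw [θ.quotKerEquivRange.finrank_eq] at h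
    exact Submodule.finrank_eq_zero.1 (by omega)
  obtain ⟨b', a, ab, hab⟩ := Submodule.exists_smith_normal_form_of_rank_eq b hrank
  set u := ab.map (LinearEquiv.ofInjective θ hinj).symm with hu
  have hu1 : ∀ i, θ (u i) = a i • b' i := by
    intro i
    rw [← hab, hu, Module.Basis.map_apply]
    exact congrArg Subtype.val
      (LinearEquiv.apply_symm_apply (LinearEquiv.ofInjective θ hinj) (ab i))
  -- Since some `p ^ K b'_i` lies in the range, the diagonal entry divides `p ^ K`; its sign is
  -- moved into the basis below.
  have ha : ∀ i, ∃ (f : ℕ) (w : ℤˣ), a i = w * (p : ℤ) ^ f := by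
    intro i
    obtain ⟨K, y, hy⟩ := hco (b' i)
    have h1 : a i ∣ (p : ℤ) ^ K := by
      have h2 := congrArg (fun z => b'.repr z i) hy
      rw [← u.sum_repr y] at h2
      simp only [map_sum, map_smul, hu1, Module.Basis.repr_self, Finsupp.smul_single,
        smul_eq_mul, mul_one, Finsupp.coe_finsetSum, Finset.sum_apply, Finsupp.single_apply,
        Finset.sum_ite_eq', Finset.mem_univ, if_true] at h2
      exact ⟨_, by rw [← h2, mul_comm]⟩
    have h3 : (a i).natAbs ∣ p ^ K := by
      have := Int.natAbs_dvd_natAbs.2 h1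
      simpa [Int.natAbs_pow] using this
    obtain ⟨f, -, hf⟩ := (Nat.dvd_prime_pow hp.out).1 h3
    rcases Int.natAbs_eq (a i) with h | h
    · exact ⟨f, 1, by rw [h, hf]; simp⟩
    · exact ⟨f, -1, by rw [h, hf]; simp⟩
  choose f w hfw using ha
  set v := b'.unitsSMul w with hv
  have huv : ∀ i, θ (u i) = ((p : ℤ) ^ f i) • v i := by
    intro i
    rw [hu1, hv, Module.Basis.unitsSMul_apply, hfw, Units.smul_def, smul_smul, mul_comm]
  have hspan : ∀ b : Module.Basis ι ℤ M, SpansMod p b := fun b x =>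
    ⟨fun i => b.repr x i, 0, by rw [smul_zero, add_zero, b.sum_repr]⟩
  -- The Smith bases span modulo `p` as well, so both exponent families are counted by the same
  -- dimensions.
  obtain ⟨σ, hσ⟩ := exists_equiv_of_card_le (e := e) (f := f) fun j => by
    rw [← finrank_span_redMod p b θ hg ht hθ j,
      ← finrank_span_redMod p b θ (hspan u) (hspan v) huv j]
  refine ⟨u.reindex σ.symm, v.reindex σ.symm, fun i => ?_⟩
  rw [Module.Basis.reindex_apply, Module.Basis.reindex_apply, Equiv.symm_symm, huv, hσ]

end Lattice

/-! ### Base `p` digits, the exponents of `D_r`, and partitions indexed by `p ^ k n` -/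

section Digits

/-- The `k`-th digit of `m` in base `p`. -/
def digit (p k m : ℕ) : ℕ := m / p ^ k % p

theorem digit_zero_right (p k : ℕ) : digit p k 0 = 0 := by simp [digit]

theorem digit_lt {p : ℕ} (hp : 0 < p) (k m : ℕ) : digit p k m < p := Nat.mod_lt _ hp

theorem digit_succ (p k m : ℕ) : digit p (k + 1) m = digit p k (m / p) := by
  rw [digit, digit, pow_succ', Nat.div_div_eq_div_mul]

theorem sum_digit_add (p K m : ℕ) :
    ∑ k ∈ Finset.range K, digit p k m * p ^ k + p ^ K * (m / p ^ K) = m := by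
  induction K with
  | zero => simp
  | succ K ih =>
    rw [Finset.sum_range_succ]
    conv_rhs => rw [← ih]
    have h := Nat.div_add_mod (m / p ^ K) p
    rw [Nat.div_div_eq_div_mul, ← pow_succ] at h
    conv_rhs => rw [← h]
    rw [digit]
    ring

theorem sum_digit {p K m : ℕ} (h : m < p ^ K) :
    ∑ k ∈ Finset.range K, digit p k m * p ^ k = m := by
  have := sum_digit_add p K m
  rwa [Nat.div_eq_of_lt h, mul_zero, add_zero] at this

theorem digit_sum {p : ℕ} (hp : 0 < p) {K : ℕ} {c : ℕ → ℕ} (hc : ∀ k, c k < p) {j : ℕ}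
    (hj : j < K) : digit p j (∑ k ∈ Finset.range K, c k * p ^ k) = c j := by
  induction K generalizing c j with
  | zero => omega
  | succ K ih =>
    have e : ∑ k ∈ Finset.range (K + 1), c k * p ^ k =
        c 0 + p * ∑ k ∈ Finset.range K, c (k + 1) * p ^ k := by
      rw [Finset.sum_range_succ', Finset.mul_sum, add_comm]
      congr 1
      · simp
      · exact Finset.sum_congr rfl fun k _ => by ring
    rw [e]
    cases j with
    | zero => simp [digit, Nat.add_mul_mod_self_left, Nat.mod_eq_of_lt (hc 0)]
    | succ j =>
      rw [digit_succ, Nat.add_mul_div_left _ _ hp, Nat.div_eq_of_lt (hc 0), zero_add]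
      exact ih (fun k => hc (k + 1)) (by omega)

/-- The recursion is affine in its initial value; the part independent of `e` is `1 + p + ⋯ + p ^ (k
- 1)`. -/
theorem srcExp_eq (p e k : ℕ) : FrobLift.srcExp p e k = e * p ^ k + FrobLift.srcExp p 0 k := by
  induction k with
  | zero => simp [FrobLift.srcExp]
  | succ k ih =>
    rw [FrobLift.srcExp, FrobLift.srcExp, ih]
    ring

theorem srcExp_zero_succ (p k : ℕ) :
    FrobLift.srcExp p 0 (k + 1) = p ^ k + FrobLift.srcExp p 0 k := by
  induction k with
  | zero => simp [FrobLift.srcExp]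
  | succ k ih =>
    have h : FrobLift.srcExp p 0 (k + 1) = p * FrobLift.srcExp p 0 k + 1 := rfl
    rw [FrobLift.srcExp, ih, mul_add, add_assoc, ← h, ih]
    ring

theorem dp_eq_sum {p : ℕ} (hp : 2 ≤ p) {a N : ℕ} (h : a ≤ N) :
    dp p a = ∑ j ∈ Finset.Icc 1 N, a / p ^ j := by
  refine Finset.sum_subset (Finset.Icc_subset_Icc_right h) fun j _ hj => ?_
  rw [Finset.mem_Icc] at hj
  apply Nat.div_eq_of_lt
  by_cases h0 : 1 ≤ j
  · calc a < j := by omega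
      _ < p ^ j := Nat.lt_pow_self (by omega)
  · rw [Finset.mem_Icc] at *
    omega

theorem dp_rec {p : ℕ} (hp : 2 ≤ p) (a : ℕ) : dp p a = a / p + dp p (a / p) := by
  rw [dp_eq_sum hp (Nat.div_le_self a p), dp_eq_sum hp (Nat.le_succ a)]
  rw [← Finset.add_sum_Ioc_eq_sum_Icc (by omega), pow_one]
  congr 1
  refine (Finset.sum_bij (fun j _ => j + 1) ?_ (fun _ _ _ _ h => Nat.succ_injective h) ?_ ?_).symm
  · intro j hj
    rw [Finset.mem_Icc] at hj
    rw [Finset.mem_Ioc]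
    omega
  · intro j hj
    rw [Finset.mem_Ioc] at hj
    exact ⟨j - 1, Finset.mem_Icc.2 (by omega), by omega⟩
  · exact fun j _ => by rw [Nat.div_div_eq_div_mul, ← pow_succ']

/-- The origin of the exponents in `D_r`. The part `e p ^ k` of `e_k` sums to `e m`; the part `1 + p
+ ⋯ + p ^ (k - 1)` sums to `d_p(m)`, because `⌊m / p ^ j⌋` is the sum of `p ^ (k - j)` times the
`k`-th digit over `k ≥ j`. -/
theorem sum_digit_mul_srcExp {p : ℕ} (hp : 2 ≤ p) (e : ℕ) {K m : ℕ} (h : m < p ^ K) :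
    ∑ k ∈ Finset.range K, digit p k m * FrobLift.srcExp p e k = e * m + dp p m := by
  have key : ∀ K m, m < p ^ K →
      ∑ k ∈ Finset.range K, digit p k m * FrobLift.srcExp p 0 k = dp p m := by
    intro K
    induction K with
    | zero =>
      intro m hm
      have : m = 0 := by simpa using hm
      simp [this, dp]
    | succ K ih =>
      intro m hm
      have hm' : m / p < p ^ K := Nat.div_lt_of_lt_mul (by rwa [← pow_succ'])
      rw [Finset.sum_range_succ', FrobLift.srcExp, mul_zero, add_zero, dp_rec hp, ← ih _ hm']
      have e1 := sum_digit hm'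
      rw [show m / p + ∑ k ∈ Finset.range K, digit p k (m / p) * FrobLift.srcExp p 0 k =
        ∑ k ∈ Finset.range K, digit p k (m / p) * p ^ k +
          ∑ k ∈ Finset.range K, digit p k (m / p) * FrobLift.srcExp p 0 k by rw [e1]]
      rw [← Finset.sum_add_distrib]
      refine Finset.sum_congr rfl fun k _ => ?_
      rw [digit_succ, srcExp_zero_succ]
      ring
  rw [← key K m h]
  rw [show e * m = e * ∑ k ∈ Finset.range K, digit p k m * p ^ k by rw [sum_digit h],
    Finset.mul_sum, ← Finset.sum_add_distrib]
  refine Finset.sum_congr rfl fun k _ => ?_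
  rw [srcExp_eq p e]
  ring

/-- Transposition of digits: the multiplicities `m_i` attached to the multiplicities `ν_k`. -/
def transposeDigits (p r L : ℕ) (ν : ℕ → ℕ) (i : ℕ) : ℕ :=
  if i < r then ∑ k ∈ Finset.range L, digit p i (ν k) * p ^ k
  else ν (i - r) / p ^ r

theorem digit_transposeDigits {p : ℕ} (hp : 0 < p) {r L : ℕ} (ν : ℕ → ℕ) {i k : ℕ} (hi : i < r)
    (hk : k < L) : digit p k (transposeDigits p r L ν i) = digit p i (ν k) := by
  rw [transposeDigits, if_pos hi]
  exact digit_sum hp (c := fun k => digit p i (ν k)) (fun k => digit_lt hp _ _) hk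

/-- Transposition preserves the degree: the `i`-th digit of `ν_k`, for `i < r`, has weight `p ^ (i +
k)` on both sides, and the quotient `⌊ν_k / p ^ r⌋` has weight `p ^ (r + k)`. -/
theorem sum_transposeDigits (p r L : ℕ) (ν : ℕ → ℕ) :
    ∑ i ∈ Finset.range (r + L), p ^ i * transposeDigits p r L ν i =
      ∑ k ∈ Finset.range L, p ^ k * ν k := by
  rw [Finset.sum_range_add]
  have h1 : ∑ i ∈ Finset.range r, p ^ i * transposeDigits p r L ν i =
      ∑ k ∈ Finset.range L, p ^ k * ∑ i ∈ Finset.range r, digit p i (ν k) * p ^ i := by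
    simp only [Finset.mul_sum]
    rw [Finset.sum_comm]
    refine Finset.sum_congr rfl fun i hi => ?_
    rw [transposeDigits, if_pos (Finset.mem_range.1 hi), Finset.mul_sum]
    exact Finset.sum_congr rfl fun k _ => by ring
  rw [h1, ← Finset.sum_add_distrib]
  refine Finset.sum_congr rfl fun k _ => ?_
  conv_rhs => rw [← sum_digit_add p r (ν k)]
  rw [transposeDigits, if_neg (by omega), Nat.add_sub_cancel_left, pow_add]
  ring

/-- The numbers in `[1, d]` that are prime to `p`. -/
def coprimes (p d : ℕ) : Finset ℕ := (Finset.Icc 1 d).filter fun n => n.Coprime p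

theorem pow_mul_inj {p : ℕ} (hp : p.Prime) {n n' k k' : ℕ} (hn : n.Coprime p) (hn' : n'.Coprime p)
    (h : p ^ k * n = p ^ k' * n') : k = k' ∧ n = n' := by
  have key : ∀ {n n' k k' : ℕ}, n'.Coprime p → p ^ k * n = p ^ k' * n' → k ≤ k' := by
    intro n n' k k' hn' h
    have : p ^ k ∣ p ^ k' := (Nat.Coprime.pow_left k hn'.symm).dvd_of_dvd_mul_right (Dvd.intro _ h)
    exact (Nat.pow_dvd_pow_iff_le_right hp.one_lt).1 this
  have hk := le_antisymm (key hn' h) (key hn h.symm)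
  subst hk
  exact ⟨rfl, Nat.eq_of_mul_eq_mul_left (pow_pos hp.pos _) h⟩

theorem exists_eq_pow_mul {p : ℕ} (hp : p.Prime) {m d : ℕ} (hm : m ∈ Finset.Icc 1 d) :
    ∃ n ∈ coprimes p d, ∃ k ≤ d, p ^ k * n = m := by
  rw [Finset.mem_Icc] at hm
  have h0 : m ≠ 0 := by omega
  obtain ⟨k, n, hn, rfl⟩ := Nat.exists_eq_pow_mul_and_not_dvd h0 p hp.one_lt.ne'
  have hn0 : 0 < n := Nat.pos_of_ne_zero fun h => by simp [h] at h0
  have hpk : 0 < p ^ k := pow_pos hp.pos k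
  refine ⟨n, Finset.mem_filter.2 ⟨Finset.mem_Icc.2 ⟨hn0, ?_⟩, ?_⟩, k, ?_, rfl⟩
  · exact (Nat.le_mul_of_pos_left n hpk).trans hm.2
  · exact ((Nat.Prime.coprime_iff_not_dvd hp).2 hn).symm
  · exact (Nat.lt_pow_self hp.one_lt).le.trans ((Nat.le_mul_of_pos_right _ hn0).trans hm.2)

/-- Every `m ≥ 1` is uniquely `p ^ k n` with `n` prime to `p`, and `m ≤ d` forces `k ≤ d < L`. The
pairs with `p ^ k n > d` contribute trivial factors. -/
theorem prod_Icc_eq {p : ℕ} (hp : p.Prime) {N : Type*} [CommMonoid N] {d L : ℕ} (hL : d < L)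
    (f : ℕ → N) (hf : ∀ m, d < m → f m = 1) :
    ∏ m ∈ Finset.Icc 1 d, f m = ∏ n ∈ coprimes p d, ∏ k ∈ Finset.range L, f (p ^ k * n) := by
  classical
  rw [← Finset.prod_product', ← Finset.prod_image (s := coprimes p d ×ˢ Finset.range L)
    (g := fun q => p ^ q.2 * q.1)]
  · refine Finset.prod_subset ?_ ?_
    · intro m hm
      obtain ⟨n, hn, k, hk, rfl⟩ := exists_eq_pow_mul hp hm
      exact Finset.mem_image.2 ⟨(n, k), Finset.mem_product.2 ⟨hn, Finset.mem_range.2 (by omega)⟩,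
        rfl⟩
    · intro m hm hm'
      obtain ⟨⟨n, k⟩, hq, rfl⟩ := Finset.mem_image.1 hm
      have hn := (Finset.mem_Icc.1 (Finset.mem_filter.1 (Finset.mem_product.1 hq).1).1).1
      apply hf
      have : 0 < p ^ k * n := Nat.mul_pos (pow_pos hp.pos k) hn
      rw [Finset.mem_Icc] at hm'
      simp only at *
      omega
  · rintro ⟨n, k⟩ h ⟨n', k'⟩ h' e
    have hn := (Finset.mem_filter.1 (Finset.mem_product.1 h).1).2
    have hn' := (Finset.mem_filter.1 (Finset.mem_product.1 h').1).2
    obtain ⟨h1, h2⟩ := pow_mul_inj hp hn hn' e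
    exact Prod.ext h2 h1

theorem sum_Icc_eq {p : ℕ} (hp : p.Prime) {d L : ℕ} (hL : d < L)
    (f : ℕ → ℕ) (hf : ∀ m, d < m → f m = 0) :
    ∑ m ∈ Finset.Icc 1 d, f m = ∑ n ∈ coprimes p d, ∑ k ∈ Finset.range L, f (p ^ k * n) :=
  prod_Icc_eq (N := Multiplicative ℕ) hp hL f hf

/-- The parts of a partition with given multiplicities. -/
theorem exists_partition_count {p : ℕ} (hp : p.Prime) {d K : ℕ} (c : ℕ → ℕ → ℕ)
    (hc : ∑ n ∈ coprimes p d, ∑ i ∈ Finset.range K, p ^ i * n * c n i = d) :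
    ∃ μ : d.Partition, ∀ n ∈ coprimes p d, ∀ i < K, μ.parts.count (p ^ i * n) = c n i := by
  classical
  set s : Multiset ℕ := ∑ n ∈ coprimes p d, ∑ i ∈ Finset.range K,
    Multiset.replicate (c n i) (p ^ i * n) with hs
  refine ⟨⟨s, ?_, ?_⟩, ?_⟩
  · intro m hm
    rw [hs, Multiset.mem_sum] at hm
    obtain ⟨n, hn, hm⟩ := hm
    rw [Multiset.mem_sum] at hm
    obtain ⟨i, hi, hm⟩ := hm
    rw [Multiset.eq_of_mem_replicate hm]
    exact Nat.mul_pos (pow_pos hp.pos i) (Finset.mem_Icc.1 (Finset.mem_filter.1 hn).1).1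
  · rw [hs, Multiset.sum_sum]
    conv_rhs => rw [← hc]
    refine Finset.sum_congr rfl fun n _ => ?_
    rw [Multiset.sum_sum]
    refine Finset.sum_congr rfl fun i _ => ?_
    rw [Multiset.sum_replicate, smul_eq_mul, mul_comm]
  · intro n hn i hi
    change s.count _ = _
    have hn' := (Finset.mem_filter.1 hn).2
    rw [hs, Multiset.count_sum', Finset.sum_eq_single n, Multiset.count_sum',
      Finset.sum_eq_single i, Multiset.count_replicate_self]
    · intro j _ hj
      rw [Multiset.count_replicate, if_neg]
      exact fun h => hj (pow_mul_inj hp hn' hn' h).1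
    · exact fun h => absurd (Finset.mem_range.2 hi) h
    · intro n' hn'' hne
      rw [Multiset.count_sum']
      refine Finset.sum_eq_zero fun j _ => ?_
      rw [Multiset.count_replicate, if_neg]
      exact fun h => hne (pow_mul_inj hp (Finset.mem_filter.1 hn'').2 hn' h).2
    · exact fun h => absurd hn h

end Digits

/-! ### Monic families in place of powers of generators -/

section Triangular

variable {A : Type*} [CommRing A]

/-- The subring generated by `p A` and the `y_j` with `1 ≤ j < m`. -/
def lowerRing (p : ℕ) (y : ℕ → A) (m : ℕ) : Subring A :=
  Subring.closure (y '' {j | 1 ≤ j ∧ j < m} ∪ Set.range fun a => (p : A) * a)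

theorem lowerRing_mono (p : ℕ) (y : ℕ → A) : Monotone (lowerRing p y) := fun _ _ h =>
  Subring.closure_mono (Set.union_subset_union_left _
    (Set.image_mono fun _ hj => ⟨hj.1, hj.2.trans_le h⟩))

theorem mul_mem_lowerRing (p : ℕ) (y : ℕ → A) (m : ℕ) (a : A) : (p : A) * a ∈ lowerRing p y m :=
  Subring.subset_closure (Or.inr ⟨a, rfl⟩)

theorem mem_lowerRing {p : ℕ} {y : ℕ → A} {m j : ℕ} (h1 : 1 ≤ j) (h2 : j < m) :
    y j ∈ lowerRing p y m :=
  Subring.subset_closure (Or.inl ⟨j, ⟨h1, h2⟩, rfl⟩)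

/-- `a` is a monic polynomial of degree `e` in `y` with coefficients in `U`. -/
def IsMonicIn (U : Subring A) (y : A) (e : ℕ) (a : A) : Prop :=
  ∃ P : Polynomial U, P.Monic ∧ P.natDegree = e ∧ P.eval₂ U.subtype y = a

theorem isMonicIn_pow [Nontrivial A] (U : Subring A) (y : A) (e : ℕ) : IsMonicIn U y e (y ^ e) := by
  exact ⟨Polynomial.X ^ e, Polynomial.monic_X_pow e, Polynomial.natDegree_X_pow e, by simp⟩

theorem isMonicIn_of_sub_mem [Nontrivial A] {U : Subring A} {y : A} {e : ℕ} {a : A} (he : e ≠ 0)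
    (h : a - y ^ e ∈ U) : IsMonicIn U y e a := by
  refine ⟨Polynomial.X ^ e + Polynomial.C ⟨_, h⟩, Polynomial.monic_X_pow_add_C _ he,
    Polynomial.natDegree_X_pow_add_C, by simp⟩

theorem IsMonicIn.mul {U : Subring A} {y : A} {e e' : ℕ} {a a' : A} (h : IsMonicIn U y e a)
    (h' : IsMonicIn U y e' a') : IsMonicIn U y (e + e') (a * a') := by
  obtain ⟨P, h1, h2, h3⟩ := h
  obtain ⟨P', h1', h2', h3'⟩ := h'
  exact ⟨P * P', h1.mul h1', by rw [h1.natDegree_mul h1', h2, h2'],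
    by rw [Polynomial.eval₂_mul, h3, h3']⟩

theorem isMonicIn_one [Nontrivial A] (U : Subring A) (y : A) : IsMonicIn U y 0 1 := by
  simpa using isMonicIn_pow U y 0

theorem IsMonicIn.pow [Nontrivial A] {U : Subring A} {y : A} {e : ℕ} {a : A}
    (h : IsMonicIn U y e a) (n : ℕ) :
    IsMonicIn U y (n * e) (a ^ n) := by
  induction n with
  | zero => simpa using isMonicIn_one U y
  | succ n ih =>
    rw [pow_succ, Nat.succ_mul]
    exact ih.mul h

theorem isMonicIn_prod [Nontrivial A] {U : Subring A} {y : A} {ι : Type*} (s : Finset ι)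
    {e : ι → ℕ} {a : ι → A}
    (h : ∀ i ∈ s, IsMonicIn U y (e i) (a i)) :
    IsMonicIn U y (∑ i ∈ s, e i) (∏ i ∈ s, a i) := by
  classical
  induction s using Finset.induction_on with
  | empty => simpa using isMonicIn_one U y
  | insert i s hi ih =>
    rw [Finset.sum_insert hi, Finset.prod_insert hi]
    exact (h i (Finset.mem_insert_self _ _)).mul
      (ih fun j hj => h j (Finset.mem_insert_of_mem hj))

/-- The group generated by `p A` and the products `∏_{1 ≤ m ≤ M} T_m(ν_m)`. -/
def prodSpan (p : ℕ) (T : ℕ → ℕ → A) (M : ℕ) : AddSubgroup A :=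
  AddSubgroup.closure (Set.range (fun ν : ℕ → ℕ => ∏ m ∈ Finset.Icc 1 M, T m (ν m)) ∪
    Set.range fun a => (p : A) * a)

/-- Monomials in the `y_m` span modulo `p`, and replacing `y_m ^ e` by a monic polynomial of degree
`e` over the ring of the earlier generators is a unitriangular change. The induction adds one
generator at a time. For `p = 0` the statement is about honest spans. -/
theorem lowerRing_le_prodSpan (p : ℕ) {y : ℕ → A} {T : ℕ → ℕ → A}
    (hT : ∀ m e, IsMonicIn (lowerRing p y m) (y m) e (T m e)) (M : ℕ) {f : A}
    (hf : f ∈ lowerRing p y (M + 1)) : f ∈ prodSpan p T M := by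
  induction M generalizing f with
  | zero =>
    -- Without generators, the ring is `ℤ + p A`: its image modulo `p` consists of integers.
    have hle : lowerRing p y 1 ≤
        (⊥ : Subring (A ⧸ Ideal.span {(p : A)})).comap (Ideal.Quotient.mk _) := by
      rw [lowerRing, Subring.closure_le]
      rintro _ (⟨j, hj, rfl⟩ | ⟨a, rfl⟩)
      · exact absurd hj.2 (by have := hj.1; omega)
      · rw [SetLike.mem_coe, Subring.mem_comap,
          Ideal.Quotient.eq_zero_iff_mem.2 (Ideal.mem_span_singleton.2 ⟨a, rfl⟩)]
        exact zero_mem _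
    obtain ⟨n, hn⟩ := Subring.mem_bot.1 (Subring.mem_comap.1 (hle hf))
    rw [← map_intCast (Ideal.Quotient.mk (Ideal.span {(p : A)})), eq_comm, Ideal.Quotient.eq,
      Ideal.mem_span_singleton] at hn
    obtain ⟨a, ha⟩ := hn
    rw [sub_eq_iff_eq_add] at ha
    rw [ha]
    refine add_mem (AddSubgroup.subset_closure (Or.inr ⟨a, rfl⟩)) ?_
    have h1 : (1 : A) ∈ prodSpan p T 0 := AddSubgroup.subset_closure (Or.inl ⟨0, by simp⟩)
    rw [← zsmul_one]
    exact zsmul_mem h1 n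
  | succ M ih =>
    have h1 : ∀ f ∈ lowerRing p y (M + 1), ∀ e, f * T (M + 1) e ∈ prodSpan p T (M + 1) := by
      intro f hf e
      have hf' := ih hf
      refine AddSubgroup.closure_induction (p := fun f _ => f * T (M + 1) e ∈
        prodSpan p T (M + 1)) ?_ ?_ ?_ ?_ hf'
      · rintro _ (⟨ν, rfl⟩ | ⟨a, rfl⟩)
        · refine AddSubgroup.subset_closure (Or.inl ⟨Function.update ν (M + 1) e, ?_⟩)
          simp only
          rw [Finset.prod_Icc_succ_top (by omega), Function.update_self]
          congr 1
          refine Finset.prod_congr rfl fun m hm => ?_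
          rw [Function.update_of_ne]
          rw [Finset.mem_Icc] at hm
          omega
        · exact AddSubgroup.subset_closure (Or.inr ⟨a * T (M + 1) e, by simp [mul_assoc]⟩)
      · rw [zero_mul]
        exact zero_mem _
      · intro a b _ _ ha hb
        rw [add_mul]
        exact add_mem ha hb
      · intro a _ ha
        rw [neg_mul]
        exact neg_mem ha
    -- Strong induction on the exponent: `f T(e)` and `f y ^ e` differ by smaller powers of `y` with
    -- coefficients in the lower ring.
    have h2 : ∀ e, ∀ f ∈ lowerRing p y (M + 1), f * y (M + 1) ^ e ∈ prodSpan p T (M + 1) := by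
      intro e
      induction e using Nat.strong_induction_on with
      | _ e ihe =>
        intro f hf
        obtain ⟨P, hP, hdeg, hev⟩ := hT (M + 1) e
        have h3 := h1 f hf e
        rw [← hev, Polynomial.eval₂_eq_sum_range, hdeg, Finset.sum_range_succ] at h3
        have hlead : P.coeff e = 1 := by rw [← hdeg]; exact hP
        rw [hlead, map_one, one_mul, mul_add, Finset.mul_sum] at h3
        refine (AddSubgroup.add_mem_cancel_left _ (sum_mem fun j hj => ?_)).1 h3
        rw [← mul_assoc]
        exact ihe j (Finset.mem_range.1 hj) _ (mul_mem hf (P.coeff j).2)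
    -- Every element is a polynomial in the last generator over the lower ring.
    have h3 : lowerRing p y (M + 1 + 1) ≤
        (Polynomial.eval₂RingHom (lowerRing p y (M + 1)).subtype (y (M + 1))).range := by
      nth_rewrite 1 [lowerRing]
      rw [Subring.closure_le]
      rintro _ (⟨j, hj, rfl⟩ | ⟨a, rfl⟩)
      · by_cases h : j = M + 1
        · exact ⟨Polynomial.X, by simp [h]⟩
        · exact ⟨Polynomial.C ⟨y j, mem_lowerRing hj.1 (by have := hj.2; omega)⟩, by simp⟩
      · exact ⟨Polynomial.C ⟨_, mul_mem_lowerRing p y (M + 1) a⟩, by simp⟩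
    obtain ⟨P, rfl⟩ := h3 hf
    rw [Polynomial.coe_eval₂RingHom, Polynomial.eval₂_eq_sum_range]
    exact sum_mem fun j _ => h2 j _ (P.coeff j).2

end Triangular

/-! ### Source and target factors attached to one element `x` -/

namespace FrobLift

variable {p : ℕ} {A : Type*} [CommRing A] (F : FrobLift p A)

/-- The elements `∏_k g_{i,k} ^ {c_k}` for `i < r`, where the `c_k` are the digits of `c`. -/
def srcElt (r L i c : ℕ) (x : A) : A :=
  if i < r then ∏ k ∈ Finset.range L, F.src (r - i) (F.δ^[i] x) k ^ digit p k c
  else (F.δ^[i] x) ^ c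

/-- The images of the elements `srcElt`, up to a power of `p`. -/
def tgtElt (r L i c : ℕ) (x : A) : A :=
  if i < r then ∏ k ∈ Finset.range L, (F.δ^[k] (F.tgt r x i)) ^ digit p k c
  else (F.δ^[i - r] (F.tgt r x r)) ^ c

/-- A monic polynomial of degree `e` in `δ^k x` modulo `p`. -/
def monElt (r k e : ℕ) (x : A) : A :=
  (∏ i ∈ Finset.range r, (F.δ^[k] (F.tgt r x i)) ^ digit p i e) *
    (F.δ^[k] (F.tgt r x r)) ^ (e / p ^ r)

theorem map_srcElt {θ : A →+* A} (hθ : ∀ a, θ (F.φ a) = F.φ (θ a)) (hp : p.Prime) {r : ℕ} {x : A}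
    (hx : θ x = p ^ r * x) {L c : ℕ} (hc : c < p ^ L) (i : ℕ) :
    θ (F.srcElt r L i c x) =
      p ^ (if i < r then (r - i) * c + dp p c else 0) * F.tgtElt r L i c x := by
  by_cases hi : i < r
  · rw [srcElt, tgtElt, if_pos hi, if_pos hi, if_pos hi, map_prod,
      ← sum_digit_mul_srcExp hp.two_le (r - i) hc, ← Finset.prod_pow_eq_pow_sum,
      ← Finset.prod_mul_distrib]
    refine Finset.prod_congr rfl fun k _ => ?_
    rw [map_pow, map_src hθ hp.ne_zero (map_iterate_delta_eq hθ hp.ne_zero hx hi.le), mul_pow,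
      ← pow_mul, mul_comm (srcExp _ _ _)]
  · rw [srcElt, tgtElt, if_neg hi, if_neg hi, if_neg hi, pow_zero, one_mul, map_pow,
      ← map_iterate_delta_add hθ hp.ne_zero hx, Nat.sub_add_cancel (by omega)]

/-- The factors `δ^k t_i` are collected by `k` instead of by `i`. This is where the digits are
transposed: the `k`-th digit of `m_i` is the `i`-th digit of `ν_k`. -/
theorem prod_tgtElt (hp : p.Prime) (r L : ℕ) (ν : ℕ → ℕ) (x : A) :
    ∏ i ∈ Finset.range (r + L), F.tgtElt r L i (transposeDigits p r L ν i) x =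
      ∏ k ∈ Finset.range L, F.monElt r k (ν k) x := by
  simp only [monElt]
  rw [Finset.prod_range_add, Finset.prod_mul_distrib]
  congr 1
  · rw [Finset.prod_comm]
    refine Finset.prod_congr rfl fun i hi => ?_
    rw [Finset.mem_range] at hi
    rw [tgtElt, if_pos hi]
    refine Finset.prod_congr rfl fun k hk => ?_
    rw [digit_transposeDigits hp.pos ν hi (Finset.mem_range.1 hk)]
  · refine Finset.prod_congr rfl fun k _ => ?_
    rw [tgtElt, if_neg (by omega), transposeDigits, if_neg (by omega), Nat.add_sub_cancel_left]

/-- `δ^k t_i` is monic of degree `p ^ i` in `δ^k x`, so the degrees add up to the base `p` expansion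
of `e`, truncated at `p ^ r`. -/
theorem isMonicIn_monElt [Nontrivial A] (hp : p.Prime) {E : ℕ → Subring A} (hE : Monotone E)
    (hpE : ∀ n a, (p : A) * a ∈ E n) {x : A} (hx : ∀ k, F.δ^[k] x ∈ E (k + 1)) (r k e : ℕ) :
    IsMonicIn (E k) (F.δ^[k] x) e (F.monElt r k e x) := by
  have h : ∀ i ≤ r, IsMonicIn (E k) (F.δ^[k] x) (p ^ i) (F.δ^[k] (F.tgt r x i)) := fun i hi =>
    isMonicIn_of_sub_mem (pow_ne_zero _ hp.ne_zero)
      (F.iterate_delta_tgt_sub_mem hp hE hpE hx r i hi k)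
  have h2 := (isMonicIn_prod (Finset.range r)
    fun i hi => (h i (Finset.mem_range.1 hi).le).pow (digit p i e)).mul
      ((h r le_rfl).pow (e / p ^ r))
  rwa [mul_comm (e / p ^ r), sum_digit_add] at h2

/-- Modulo `p` the factors are `± (δ^i x) ^ (p ^ k)`, and the digits of `c` recombine to the
exponent `c`. -/
theorem srcElt_congr (hp : p.Prime) {r L c : ℕ} (hc : c < p ^ L) (i : ℕ) (x : A) :
    ∃ (ε : ℤ) (b : A), (ε = 1 ∨ ε = -1) ∧
      F.srcElt r L i c x = ε * (F.δ^[i] x) ^ c + p * b := by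
  by_cases hi : i < r
  · choose ε b hε h using fun k => F.src_congr hp (Nat.sub_pos_of_lt hi) (F.δ^[i] x) k
    have hmk : Ideal.Quotient.mk (Ideal.span {(p : A)}) (F.srcElt r L i c x) =
        Ideal.Quotient.mk (Ideal.span {(p : A)})
          (((∏ k ∈ Finset.range L, ε k ^ digit p k c : ℤ) : A) * (F.δ^[i] x) ^ c) := by
      rw [srcElt, if_pos hi]
      rw [show (F.δ^[i] x) ^ c = (F.δ^[i] x) ^ ∑ k ∈ Finset.range L, digit p k c * p ^ k by
        rw [sum_digit hc], ← Finset.prod_pow_eq_pow_sum]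
      push_cast
      rw [← Finset.prod_mul_distrib, map_prod, map_prod]
      refine Finset.prod_congr rfl fun k _ => ?_
      rw [h, map_pow, map_add, Ideal.Quotient.eq_zero_iff_mem.2
        (Ideal.mem_span_singleton.2 ⟨b k, rfl⟩), add_zero, ← map_pow, mul_pow, ← pow_mul,
        mul_comm (digit p k c)]
    rw [Ideal.Quotient.eq, Ideal.mem_span_singleton] at hmk
    obtain ⟨a, ha⟩ := hmk
    refine ⟨_, a, ?_, sub_eq_iff_eq_add'.1 ha⟩
    rw [← Int.isUnit_iff]
    refine Finset.prod_induction _ IsUnit (fun _ _ => IsUnit.mul) isUnit_one fun k _ => ?_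
    exact (Int.isUnit_iff.2 (hε k)).pow _
  · exact ⟨1, 0, Or.inl rfl, by simp [srcElt, hi]⟩

end FrobLift

/-! ### Coefficients and grading; complete and elementary symmetric functions -/

section Basics

variable {R : Type*} [CommRing R]

theorem vals_mapDomain (σ : Equiv.Perm ℕ) (m : ℕ →₀ ℕ) : vals (m.mapDomain σ) = vals m := by
  classical
  rw [vals, vals, Finsupp.mapDomain_support_of_injective σ.injective,
    Finset.image_val_of_injOn σ.injective.injOn, Multiset.map_map]
  refine Multiset.map_congr rfl fun i _ => ?_
  rw [Function.comp_apply, Finsupp.mapDomain_apply σ.injective]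

/-- The symmetric function whose coefficient at `m` is `c m`, where `c m` only depends on the
multiset of the nonzero exponents and vanishes in large degree. -/
def ofCoeff (c : (ℕ →₀ ℕ) → R) (hc : ∀ m m', vals m = vals m' → c m = c m') (N : ℕ)
    (hN : ∀ m, c m ≠ 0 → m.degree ≤ N) : symFun R :=
  ⟨c, fun σ => by
    ext m
    obtain ⟨m, rfl⟩ := (Finsupp.mapDomain_surjective σ.surjective) m
    exact (coeff_rename_perm σ (c : MvPowerSeries ℕ R) m).trans
      (hc _ _ (vals_mapDomain σ m).symm), N, hN⟩

/-- The coefficient of a monomial in a symmetric function. -/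
def cf (m : ℕ →₀ ℕ) : symFun R →ₗ[R] R :=
  (MvPowerSeries.coeff m).comp (symFun R).val.toLinearMap

theorem cf_apply (m : ℕ →₀ ℕ) (f : symFun R) : cf m f = MvPowerSeries.coeff m f.1 := rfl

theorem cf_ofCoeff (c : (ℕ →₀ ℕ) → R) (hc) (N : ℕ) (hN) (m : ℕ →₀ ℕ) :
    cf m (ofCoeff c hc N hN) = c m := rfl

theorem ext_cf {f g : symFun R} (h : ∀ m, cf m f = cf m g) : f = g :=
  Subtype.ext (MvPowerSeries.ext h)

open Classical in
theorem cf_mul (m : ℕ →₀ ℕ) (f g : symFun R) :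
    cf m (f * g) = ∑ q ∈ Finset.HasAntidiagonal.antidiagonal m, cf q.1 f * cf q.2 g :=
  MvPowerSeries.coeff_mul _ _ _

open Classical in
theorem cf_one (m : ℕ →₀ ℕ) : cf m (1 : symFun R) = if m = 0 then 1 else 0 :=
  MvPowerSeries.coeff_one _

theorem cf_eq_zero_of_mem {d : ℕ} {f : symFun R} (hf : f ∈ symDeg R d) {m : ℕ →₀ ℕ}
    (hm : m.degree ≠ d) : cf m f = 0 := by
  by_contra h
  exact hm (hf m h)

theorem mul_mem_symDeg {d e : ℕ} {f g : symFun R} (hf : f ∈ symDeg R d) (hg : g ∈ symDeg R e) :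
    f * g ∈ symDeg R (d + e) := by
  classical
  intro m hm
  change cf m (f * g) ≠ 0 at hm
  rw [cf_mul] at hm
  obtain ⟨q, hq, hne⟩ := Finset.exists_ne_zero_of_sum_ne_zero hm
  rw [Finset.HasAntidiagonal.mem_antidiagonal] at hq
  rw [← hq, map_add, hf _ (left_ne_zero_of_mul hne), hg _ (right_ne_zero_of_mul hne)]

theorem one_mem_symDeg : (1 : symFun R) ∈ symDeg R 0 := by
  classical
  intro m hm
  change cf m 1 ≠ 0 at hm
  rw [cf_one] at hm
  by_cases h : m = 0
  · simp [h]
  · exact absurd (if_neg h) hm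

theorem pow_mem_symDeg {d : ℕ} {f : symFun R} (hf : f ∈ symDeg R d) (n : ℕ) :
    f ^ n ∈ symDeg R (d * n) := by
  induction n with
  | zero => simpa using one_mem_symDeg
  | succ n ih =>
    rw [pow_succ, Nat.mul_succ]
    exact mul_mem_symDeg ih hf

theorem prod_mem_symDeg {ι : Type*} (s : Finset ι) {d : ι → ℕ} {f : ι → symFun R}
    (h : ∀ i ∈ s, f i ∈ symDeg R (d i)) : ∏ i ∈ s, f i ∈ symDeg R (∑ i ∈ s, d i) := by
  classical
  induction s using Finset.induction_on with
  | empty => simpa using one_mem_symDeg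
  | insert i s hi ih =>
    rw [Finset.sum_insert hi, Finset.prod_insert hi]
    exact mul_mem_symDeg (h i (Finset.mem_insert_self _ _))
      (ih fun j hj => h j (Finset.mem_insert_of_mem hj))

theorem natCast_mul_mem_symDeg {d : ℕ} {f : symFun R} (n : ℕ) (hf : f ∈ symDeg R d) :
    (n : symFun R) * f ∈ symDeg R d := by
  rw [← nsmul_eq_mul]
  exact nsmul_mem hf n

/-- The component of degree `d`. -/
def proj (d : ℕ) : symFun R →ₗ[R] symFun R where
  toFun f := ofCoeff (fun m => if m.degree = d then cf m f else 0)
    (fun m m' h => by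
      have h1 : m.degree = m'.degree := by rw [← sum_vals, ← sum_vals, h]
      have h2 : cf m f = cf m' f := coeff_eq_of_vals f.2 h
      simp only [h1, h2]) d
    (fun m hm => by
      by_contra h
      exact hm (if_neg (by omega)))
  map_add' f g := ext_cf fun m => by
    rw [map_add, cf_ofCoeff, cf_ofCoeff, cf_ofCoeff, map_add]
    split_ifs <;> simp
  map_smul' c f := ext_cf fun m => by
    rw [map_smul, cf_ofCoeff, cf_ofCoeff, map_smul]
    split_ifs <;> simp

theorem cf_proj (d : ℕ) (f : symFun R) (m : ℕ →₀ ℕ) :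
    cf m (proj d f) = if m.degree = d then cf m f else 0 := rfl

theorem proj_mem (d : ℕ) (f : symFun R) : proj d f ∈ symDeg R d := by
  intro m hm
  by_contra h
  exact hm (if_neg h)

theorem proj_eq {d e : ℕ} {f : symFun R} (hf : f ∈ symDeg R d) :
    proj e f = if d = e then f else 0 := by
  apply ext_cf
  intro m
  rw [cf_proj]
  by_cases h : m.degree = d
  · rw [h]
    split_ifs <;> simp
  · have := cf_eq_zero_of_mem hf h
    split_ifs <;> simp [this]

theorem proj_self {d : ℕ} {f : symFun R} (hf : f ∈ symDeg R d) : proj d f = f := by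
  rw [proj_eq hf, if_pos rfl]

theorem sum_proj {N : ℕ} {f : symFun R} (hN : ∀ m, cf m f ≠ 0 → m.degree ≤ N) :
    ∑ d ∈ Finset.range (N + 1), proj d f = f := by
  apply ext_cf
  intro m
  simp only [map_sum, cf_proj]
  rw [Finset.sum_ite_eq]
  by_cases h : cf m f = 0
  · simp [h]
  · rw [if_pos (Finset.mem_range.2 (Nat.lt_succ_of_le (hN m h)))]

/-- A product of the given degree in a spanning set of products of homogeneous elements. -/
theorem mem_closure_of_mem_prodSpan {p : ℕ} {T : ℕ → ℕ → symFun R}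
    (hT : ∀ m e, T m e ∈ symDeg R (m * e)) {d M : ℕ} {f : symFun R} (hf : f ∈ symDeg R d)
    (hfM : f ∈ prodSpan p T M) :
    f ∈ AddSubgroup.closure ({g | ∃ ν : ℕ → ℕ, ∑ m ∈ Finset.Icc 1 M, m * ν m = d ∧
      g = ∏ m ∈ Finset.Icc 1 M, T m (ν m)} ∪ {g | ∃ a ∈ symDeg R d, g = (p : symFun R) * a}) := by
  -- Projection to degree `d` commutes with multiplication by `p` and keeps or kills each product of
  -- homogeneous factors, so it maps the spanning set into its homogeneous part.
  rw [← proj_self hf]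
  refine AddSubgroup.closure_induction (p := fun f _ => proj d f ∈ AddSubgroup.closure _)
    ?_ ?_ ?_ ?_ hfM
  · rintro _ (⟨ν, rfl⟩ | ⟨a, rfl⟩)
    · simp only
      rw [proj_eq (prod_mem_symDeg _ fun m _ => hT m (ν m))]
      split_ifs with h
      · exact AddSubgroup.subset_closure (Or.inl ⟨ν, h, rfl⟩)
      · exact zero_mem _
    · refine AddSubgroup.subset_closure (Or.inr ⟨proj d a, proj_mem d a, ?_⟩)
      simp only
      rw [← nsmul_eq_mul, map_nsmul, nsmul_eq_mul]
  · rw [map_zero]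
    exact zero_mem _
  · intro a b _ _ ha hb
    rw [map_add]
    exact add_mem ha hb
  · intro a _ ha
    rw [map_neg]
    exact neg_mem ha

theorem psum_mem_symDeg (n : ℕ) : psum R n ∈ symDeg R n := by
  classical
  intro m hm
  change MvPowerSeries.coeff m (psumSeries R n) ≠ 0 at hm
  rw [coeff_psumSeries] at hm
  have : ∃ i, m = Finsupp.single i n := by
    by_contra h
    exact hm (if_neg h)
  obtain ⟨i, rfl⟩ := this
  simp

/-- The complete homogeneous symmetric function `h_n`. -/
def hsym (R : Type*) [CommRing R] (n : ℕ) : symFun R :=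
  ofCoeff (fun m => if m.degree = n then 1 else 0)
    (fun m m' h => by rw [← sum_vals, ← sum_vals, h]) n
    (fun m hm => by
      by_contra h
      exact hm (if_neg (by omega)))

theorem cf_hsym (n : ℕ) (m : ℕ →₀ ℕ) : cf m (hsym R n) = if m.degree = n then 1 else 0 := rfl

theorem hsym_mem_symDeg (n : ℕ) : hsym R n ∈ symDeg R n := by
  intro m hm
  by_contra h
  exact hm (if_neg h)

theorem hsym_zero : hsym R 0 = 1 := by
  classical
  apply ext_cf
  intro m
  rw [cf_hsym, cf_one]
  congr 1
  rw [Finsupp.degree_eq_zero_iff]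

open Classical in
/-- The elementary symmetric function `e_n`. -/
def esym (R : Type*) [CommRing R] (n : ℕ) : symFun R :=
  ofCoeff (fun m => if vals m = Multiset.replicate n 1 then 1 else 0)
    (fun m m' h => by rw [h]) n
    (fun m hm => by
      have h : vals m = Multiset.replicate n 1 := by
        by_contra h
        exact hm (if_neg h)
      rw [← sum_vals, h]
      simp)

open Classical in
theorem cf_esym (n : ℕ) (m : ℕ →₀ ℕ) :
    cf m (esym R n) = if vals m = Multiset.replicate n 1 then 1 else 0 := rfl

theorem esym_mem_symDeg (n : ℕ) : esym R n ∈ symDeg R n := by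
  classical
  intro m hm
  change cf m (esym R n) ≠ 0 at hm
  rw [cf_esym] at hm
  have h : vals m = Multiset.replicate n 1 := by
    by_contra h
    exact hm (if_neg h)
  rw [← sum_vals, h]
  simp

/-- The exponent vector `∑_{i ∈ S} ε_i`. -/
def ind (S : Finset ℕ) : ℕ →₀ ℕ := Finsupp.indicator S fun _ _ => 1

theorem ind_apply (S : Finset ℕ) (i : ℕ) : ind S i = if i ∈ S then 1 else 0 := by
  rw [ind, Finsupp.indicator_apply]
  split_ifs <;> rfl

theorem support_ind (S : Finset ℕ) : (ind S).support = S := by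
  ext i
  rw [Finsupp.mem_support_iff, ind_apply]
  split_ifs with h <;> simp [h]

theorem vals_eq_replicate_iff {n : ℕ} {m : ℕ →₀ ℕ} :
    vals m = Multiset.replicate n 1 ↔ ∃ S : Finset ℕ, S.card = n ∧ m = ind S := by
  rw [Multiset.eq_replicate, card_vals]
  constructor
  · rintro ⟨h1, h2⟩
    refine ⟨m.support, h1, ?_⟩
    ext i
    rw [ind_apply]
    split_ifs with h
    · exact h2 _ (Multiset.mem_map.2 ⟨i, h, rfl⟩)
    · exact Finsupp.notMem_support_iff.1 h
  · rintro ⟨S, h1, rfl⟩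
    refine ⟨by rw [support_ind, h1], fun a ha => ?_⟩
    obtain ⟨i, hi, rfl⟩ := Multiset.mem_map.1 ha
    rw [support_ind] at hi
    exact (ind_apply S i).trans (if_pos hi)

theorem degree_ind (S : Finset ℕ) : (ind S).degree = S.card := by
  rw [← sum_vals, vals_eq_replicate_iff.2 ⟨S, rfl, rfl⟩]
  simp

theorem cf_esym_mul (n : ℕ) (f : symFun R) (m : ℕ →₀ ℕ) :
    cf m (esym R n * f) = ∑ S ∈ m.support.powersetCard n, cf (m - ind S) f := by
  classical
  rw [cf_mul]
  symm
  refine Finset.sum_of_injOn (fun S => (ind S, m - ind S)) ?_ ?_ ?_ ?_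
  · intro S _ S' _ h
    have h1 : ind S = ind S' := (Prod.ext_iff.1 h).1
    rw [← support_ind S, h1, support_ind]
  · intro S hS
    rw [SetLike.mem_coe, Finset.mem_powersetCard] at hS
    rw [SetLike.mem_coe, Finset.HasAntidiagonal.mem_antidiagonal]
    refine add_tsub_cancel_of_le fun i => ?_
    rw [ind_apply]
    split_ifs with h
    · exact Nat.one_le_iff_ne_zero.2 (Finsupp.mem_support_iff.1 (hS.1 h))
    · exact Nat.zero_le _
  · rintro ⟨a, b⟩ hab hn
    rw [Finset.HasAntidiagonal.mem_antidiagonal] at hab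
    simp only at hab
    simp only
    rw [cf_esym, if_neg, zero_mul]
    intro h
    obtain ⟨S, hS, rfl⟩ := vals_eq_replicate_iff.1 h
    refine hn ⟨S, ?_, ?_⟩
    · rw [SetLike.mem_coe, Finset.mem_powersetCard]
      refine ⟨fun i hi => ?_, hS⟩
      rw [Finsupp.mem_support_iff, ← hab, Finsupp.add_apply, ind_apply, if_pos hi]
      omega
    · simp only
      rw [← hab, add_tsub_cancel_left]
  · intro S hS
    rw [Finset.mem_powersetCard] at hS
    rw [cf_esym, if_pos (vals_eq_replicate_iff.2 ⟨S, hS.2, rfl⟩), one_mul]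

theorem cf_psum_mul {n : ℕ} (hn : n ≠ 0) (f : symFun R) (m : ℕ →₀ ℕ) :
    cf m (psum R n * f) =
      ∑ i ∈ m.support.filter fun i => n ≤ m i, cf (m - Finsupp.single i n) f := by
  classical
  rw [cf_mul]
  symm
  refine Finset.sum_of_injOn (fun i => (Finsupp.single i n, m - Finsupp.single i n)) ?_ ?_ ?_ ?_
  · intro i _ j _ h
    exact Finsupp.single_left_injective hn (Prod.ext_iff.1 h).1
  · intro i hi
    rw [SetLike.mem_coe, Finset.mem_filter] at hi
    rw [SetLike.mem_coe, Finset.HasAntidiagonal.mem_antidiagonal]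
    exact add_tsub_cancel_of_le (Finsupp.single_le_iff.2 hi.2)
  · rintro ⟨a, b⟩ hab hni
    rw [Finset.HasAntidiagonal.mem_antidiagonal] at hab
    simp only at hab
    simp only
    have : cf a (psum R n) = if ∃ i, a = Finsupp.single i n then 1 else 0 := coeff_psumSeries R n a
    rw [this, if_neg, zero_mul]
    rintro ⟨i, rfl⟩
    have hle : n ≤ m i := by
      rw [← hab]
      simp
    refine hni ⟨i, ?_, ?_⟩
    · rw [SetLike.mem_coe, Finset.mem_filter, Finsupp.mem_support_iff]
      omega
    · simp only
      rw [← hab, add_tsub_cancel_left]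
  · intro i hi
    have : cf (Finsupp.single i n) (psum R n) =
      if ∃ j, Finsupp.single i n = Finsupp.single j n then 1 else 0 := coeff_psumSeries R n _
    simp only
    rw [this, if_pos ⟨i, rfl⟩, one_mul]

theorem degree_sub_of_le {a m : ℕ →₀ ℕ} (h : a ≤ m) : (m - a).degree + a.degree = m.degree := by
  rw [← map_add, tsub_add_cancel_of_le h]

/-- Newton's identity. -/
theorem newton (n : ℕ) :
    (n : symFun R) * hsym R n = ∑ j ∈ Finset.Icc 1 n, psum R j * hsym R (n - j) := by
  classical
  apply ext_cf
  intro m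
  rw [← nsmul_eq_mul, map_nsmul, map_sum, cf_hsym]
  -- In degree `n`, the coefficient of `x ^ m` in `p_j h_{n-j}` counts the `i` with `j ≤ m_i`.
  -- Summed over `j` this gives `∑ m_i = n`.
  have h1 : ∀ j ∈ Finset.Icc 1 n, cf m (psum R j * hsym R (n - j)) =
      ∑ i ∈ m.support, if j ≤ m i then if m.degree = n then (1 : R) else 0 else 0 := by
    intro j hj
    rw [Finset.mem_Icc] at hj
    rw [cf_psum_mul (by omega), Finset.sum_filter]
    refine Finset.sum_congr rfl fun i _ => ?_
    by_cases h : j ≤ m i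
    · rw [if_pos h, if_pos h, cf_hsym]
      have h2 := degree_sub_of_le (Finsupp.single_le_iff.2 h)
      rw [Finsupp.degree_single] at h2
      congr 1
      apply propext
      omega
    · rw [if_neg h, if_neg h]
  rw [Finset.sum_congr rfl h1, Finset.sum_comm]
  by_cases hd : m.degree = n
  · simp only [hd, if_true]
    rw [nsmul_one]
    have h2 : ∀ i ∈ m.support,
        ∑ j ∈ Finset.Icc 1 n, (if j ≤ m i then (1 : R) else 0) = (m i : ℕ) := by
      intro i _
      have hle : m i ≤ n := hd ▸ Finsupp.le_degree i m
      rw [← Finset.sum_filter, 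
        show (Finset.Icc 1 n).filter (fun j => j ≤ m i) = Finset.Icc 1 (m i) by
        ext j
        rw [Finset.mem_filter, Finset.mem_Icc, Finset.mem_Icc]
        omega]
      simp
    rw [Finset.sum_congr rfl h2, ← Nat.cast_sum]
    congr 1
    exact hd.symm
  · simp [hd]

/-- In degree `n` the coefficient of `x ^ m` is the alternating sum of the binomial coefficients of
the size of the support of `m`, which is nonzero because `n ≠ 0`. -/
theorem sum_esym_mul_hsym {n : ℕ} (hn : n ≠ 0) :
    ∑ i ∈ Finset.range (n + 1), (-1) ^ i * (esym R i * hsym R (n - i)) = 0 := by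
  classical
  apply ext_cf
  intro m
  rw [map_sum, map_zero]
  have h1 : ∀ i ∈ Finset.range (n + 1), cf m ((-1) ^ i * (esym R i * hsym R (n - i))) =
      if m.degree = n then (((-1) ^ i * (m.support.card.choose i : ℤ) : ℤ) : R) else 0 := by
    intro i hi
    rw [Finset.mem_range] at hi
    have e1 : ((-1) ^ i * (esym R i * hsym R (n - i)) : symFun R) =
        ((-1) ^ i : R) • (esym R i * hsym R (n - i)) := by
      rw [Algebra.smul_def]
      simp
    rw [e1, map_smul, cf_esym_mul]
    have h2 : ∀ S ∈ m.support.powersetCard i, cf (m - ind S) (hsym R (n - i)) =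
        if m.degree = n then 1 else 0 := by
      intro S hS
      rw [Finset.mem_powersetCard] at hS
      have hle : ind S ≤ m := fun j => by
        rw [ind_apply]
        split_ifs with h
        · exact Nat.one_le_iff_ne_zero.2 (Finsupp.mem_support_iff.1 (hS.1 h))
        · exact Nat.zero_le _
      have h3 := degree_sub_of_le hle
      rw [degree_ind, hS.2] at h3
      rw [cf_hsym]
      congr 1
      apply propext
      omega
    rw [Finset.sum_congr rfl h2, Finset.sum_const, Finset.card_powersetCard]
    split_ifs <;> simp
  rw [Finset.sum_congr rfl h1]
  by_cases hd : m.degree = n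
  · simp only [hd, if_true]
    have hc : m.support.card ≤ n := by
      rw [← hd, ← sum_vals, ← card_vals]
      exact Multiset.card_nsmul_le_sum (fun a ha => pos_of_mem_vals ha) |>.trans' (by simp)
    have hc0 : m.support.card ≠ 0 := by
      rw [Finset.card_ne_zero, Finsupp.support_nonempty_iff]
      rintro rfl
      exact hn (by simpa using hd.symm)
    have h4 := Int.alternating_sum_range_choose (n := m.support.card)
    rw [if_neg hc0] at h4
    rw [← Int.cast_sum, ← Finset.sum_subset (Finset.range_subset_range.2 (Nat.succ_le_succ hc)),
      h4, Int.cast_zero]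
    intro i _ hi
    rw [Nat.choose_eq_zero_of_lt (by simpa using hi)]
    simp
  · simp [hd]

end Basics

/-! ### The `h_n` generate the ring: lexicographic leading terms -/

section Spanning

variable {R : Type*} [CommRing R]

theorem vals_toFinsupp (l : List ℕ) (hl : ∀ a ∈ l, 0 < a) : vals l.toFinsupp = l := by
  have hs : l.toFinsupp.support = Finset.range l.length := by
    ext i
    rw [Finsupp.mem_support_iff, Finset.mem_range]
    constructor
    · intro h
      by_contra hi
      exact h (List.toFinsupp_apply_le _ _ (by omega))
    · intro h
      rw [List.toFinsupp_apply_lt _ _ h]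
      exact (hl _ (List.getElem_mem h)).ne'
  rw [vals, hs]
  change ((List.range l.length).map l.toFinsupp : Multiset ℕ) = l
  congr 1
  apply List.ext_getElem
  · simp
  · intro i h1 h2
    rw [List.getElem_map, List.getElem_range, List.toFinsupp_apply_lt _ _ h2]

/-- The partition as a weakly decreasing exponent vector. -/
def expo {d : ℕ} (μ : d.Partition) : ℕ →₀ ℕ := (μ.parts.sort (· ≥ ·)).toFinsupp

theorem vals_expo {d : ℕ} (μ : d.Partition) : vals (expo μ) = μ.parts := by
  rw [expo, vals_toFinsupp _ fun a ha => μ.parts_pos ((Multiset.mem_sort _).1 ha), Multiset.sort_eq]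

theorem expo_injective {d : ℕ} : Function.Injective (expo (d := d)) := fun μ ν h =>
  Nat.Partition.ext (by rw [← vals_expo, h, vals_expo])

theorem degree_expo {d : ℕ} (μ : d.Partition) : (expo μ).degree = d := by
  rw [← sum_vals, vals_expo, μ.parts_sum]

theorem antitone_expo {d : ℕ} (μ : d.Partition) : Antitone (expo μ) := by
  intro i j hij
  by_cases hj : j < (μ.parts.sort (· ≥ ·)).length
  · rw [expo, List.toFinsupp_apply_lt _ _ hj, List.toFinsupp_apply_lt _ _ (hij.trans_lt hj)]
    rcases hij.eq_or_lt with rfl | h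
    · exact le_rfl
    · exact List.pairwise_iff_getElem.1 (Multiset.pairwise_sort μ.parts (· ≥ ·)) i j _ _ h
  · rw [expo, List.toFinsupp_apply_le _ _ (by omega)]
    exact Nat.zero_le _

theorem cf_eq_of_vals (f : symFun R) {m m' : ℕ →₀ ℕ} (h : vals m = vals m') : cf m f = cf m' f :=
  coeff_eq_of_vals f.2 h

theorem exists_partition_vals (m : ℕ →₀ ℕ) : ∃ μ : m.degree.Partition, vals m = μ.parts :=
  ⟨⟨vals m, fun h => pos_of_mem_vals h, sum_vals m⟩, rfl⟩

theorem eq_of_cf_expo {d : ℕ} {f g : symFun R} (hf : f ∈ symDeg R d) (hg : g ∈ symDeg R d)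
    (h : ∀ μ : d.Partition, cf (expo μ) f = cf (expo μ) g) : f = g := by
  apply ext_cf
  intro m
  by_cases hm : m.degree = d
  · subst hm
    obtain ⟨μ, hμ⟩ := exists_partition_vals m
    rw [cf_eq_of_vals f (hμ.trans (vals_expo μ).symm), h,
      cf_eq_of_vals g (hμ.trans (vals_expo μ).symm)]
  · rw [cf_eq_zero_of_mem hf hm, cf_eq_zero_of_mem hg hm]

/-- The monomial symmetric function `m_μ`. -/
def msym (R : Type*) [CommRing R] {d : ℕ} (μ : d.Partition) : symFun R :=
  ofCoeff (fun m => if vals m = μ.parts then 1 else 0) (fun m m' h => by rw [h]) d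
    (fun m hm => by
      have h : vals m = μ.parts := by
        by_contra h
        exact hm (if_neg h)
      rw [← sum_vals, h, μ.parts_sum])

theorem cf_msym {d : ℕ} (μ : d.Partition) (m : ℕ →₀ ℕ) :
    cf m (msym R μ) = if vals m = μ.parts then 1 else 0 := rfl

theorem cf_expo_msym {d : ℕ} (μ ν : d.Partition) :
    cf (expo ν) (msym R μ) = if ν = μ then 1 else 0 := by
  rw [cf_msym, vals_expo]
  congr 1
  exact propext Nat.Partition.ext_iff.symm

theorem msym_mem_symDeg {d : ℕ} (μ : d.Partition) : msym R μ ∈ symDeg R d := by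
  intro m hm
  change cf m (msym R μ) ≠ 0 at hm
  rw [cf_msym] at hm
  have h : vals m = μ.parts := by
    by_contra h
    exact hm (if_neg h)
  rw [← sum_vals, h, μ.parts_sum]

/-- The coordinates of a homogeneous symmetric function with respect to the monomial symmetric
functions. -/
def coordEquiv (R : Type*) [CommRing R] (d : ℕ) : symDeg R d ≃+ (d.Partition → R) where
  toFun f μ := cf (expo μ) f.1
  invFun w := ⟨∑ μ, w μ • msym R μ, Submodule.sum_mem _ fun μ _ =>
    Submodule.smul_mem _ _ (msym_mem_symDeg μ)⟩
  left_inv f := Subtype.ext (eq_of_cf_expo (Submodule.sum_mem _ fun μ _ =>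
    Submodule.smul_mem _ _ (msym_mem_symDeg μ)) f.2 fun ν => by simp [cf_expo_msym])
  right_inv w := by
    ext ν
    simp [cf_expo_msym]
  map_add' f g := by
    ext μ
    simp

/-- `a` is the largest exponent of `f` in the lexicographic order, with coefficient one. -/
def IsLead (f : symFun R) (a : ℕ →₀ ℕ) : Prop :=
  cf a f = 1 ∧ ∀ m, cf m f ≠ 0 → toLex m ≤ toLex a

theorem lex_add_le_add {m n a b : ℕ →₀ ℕ} (h1 : toLex m ≤ toLex a) (h2 : toLex n ≤ toLex b) :
    toLex (m + n) ≤ toLex (a + b) := by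
  rw [toLex_add, toLex_add]
  exact add_le_add h1 h2

theorem lex_eq_of_add_eq {m n a b : ℕ →₀ ℕ} (h1 : toLex m ≤ toLex a) (h2 : toLex n ≤ toLex b)
    (h : m + n = a + b) : m = a ∧ n = b := by
  have h3 : m = a := by
    by_contra hne
    have h4 : toLex m < toLex a := lt_of_le_of_ne h1 fun e => hne (toLex.injective e)
    have h5 : toLex m + toLex n < toLex a + toLex b := add_lt_add_of_lt_of_le h4 h2
    rw [← toLex_add, ← toLex_add, h] at h5
    exact lt_irrefl _ h5
  subst h3
  exact ⟨rfl, add_left_cancel h⟩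

theorem IsLead.mul {f g : symFun R} {a b : ℕ →₀ ℕ} (hf : IsLead f a) (hg : IsLead g b) :
    IsLead (f * g) (a + b) := by
  classical
  constructor
  · rw [cf_mul, Finset.sum_eq_single (a, b)]
    · rw [hf.1, hg.1, one_mul]
    · rintro ⟨m, n⟩ hmn hne
      rw [Finset.HasAntidiagonal.mem_antidiagonal] at hmn
      by_contra h
      have h1 := hf.2 m (left_ne_zero_of_mul h)
      have h2 := hg.2 n (right_ne_zero_of_mul h)
      have h4 := lex_eq_of_add_eq h1 h2 hmn
      exact hne (Prod.ext h4.1 h4.2)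
    · intro h
      have h' : (a, b) ∈ Finset.HasAntidiagonal.antidiagonal (a + b) :=
        (Finset.HasAntidiagonal.mem_antidiagonal (n := a + b) (a := (a, b))).2 (Eq.refl (a + b))
      exact absurd h' h
  · intro m hm
    rw [cf_mul] at hm
    obtain ⟨q, hq, hne⟩ := Finset.exists_ne_zero_of_sum_ne_zero hm
    rw [Finset.HasAntidiagonal.mem_antidiagonal] at hq
    rw [← hq]
    exact lex_add_le_add (hf.2 _ (left_ne_zero_of_mul hne)) (hg.2 _ (right_ne_zero_of_mul hne))

theorem isLead_one : IsLead (1 : symFun R) 0 := by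
  classical
  refine ⟨by rw [cf_one, if_pos rfl], fun m hm => ?_⟩
  rw [cf_one] at hm
  have : m = 0 := by
    by_contra h
    exact hm (if_neg h)
  rw [this]

theorem isLead_prod {ι : Type*} (s : Finset ι) {a : ι → ℕ →₀ ℕ} {f : ι → symFun R}
    (h : ∀ i ∈ s, IsLead (f i) (a i)) : IsLead (∏ i ∈ s, f i) (∑ i ∈ s, a i) := by
  classical
  induction s using Finset.induction_on with
  | empty => simpa using isLead_one
  | insert i s hi ih =>
    rw [Finset.sum_insert hi, Finset.prod_insert hi]
    exact (h i (Finset.mem_insert_self _ _)).mul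
      (ih fun j hj => h j (Finset.mem_insert_of_mem hj))

/-- If `ind S` were lexicographically larger, then at the first difference `i` one has `i ∈ S` and
`i ≥ n`, while `S` contains all of `range n`; this is one element too many. -/
theorem isLead_esym (n : ℕ) : IsLead (esym R n) (ind (Finset.range n)) := by
  classical
  refine ⟨by rw [cf_esym, if_pos (vals_eq_replicate_iff.2 ⟨_, Finset.card_range n, rfl⟩)], ?_⟩
  intro m hm
  rw [cf_esym] at hm
  have h : vals m = Multiset.replicate n 1 := by
    by_contra h
    exact hm (if_neg h)
  obtain ⟨S, hS, rfl⟩ := vals_eq_replicate_iff.1 h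
  by_contra hlt
  obtain ⟨i, hi1, hi2⟩ := Finsupp.Lex.lt_iff.1 (not_le.1 hlt)
  simp only [ofLex_toLex, ind_apply] at hi1 hi2
  have hiS : i ∈ S := by
    by_contra h
    rw [if_neg h] at hi2
    omega
  have hin : n ≤ i := by
    by_contra h
    rw [if_pos (Finset.mem_range.2 (by omega)), if_pos hiS] at hi2
    omega
  have hsub : insert i (Finset.range n) ⊆ S := by
    intro j hj
    rw [Finset.mem_insert, Finset.mem_range] at hj
    rcases hj with rfl | hj
    · exact hiS
    · by_contra h
      have := hi1 j (by omega)
      rw [if_pos (Finset.mem_range.2 hj), if_neg h] at this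
      omega
  have := Finset.card_le_card hsub
  rw [Finset.card_insert_of_notMem (by simpa using hin), Finset.card_range, hS] at this
  omega

/-- The number of indices `i` with `a_i > j`. -/
def conjPart (a : ℕ →₀ ℕ) (j : ℕ) : ℕ := (a.support.filter fun i => j < a i).card

theorem filter_eq_range {a : ℕ →₀ ℕ} (ha : Antitone a) (j : ℕ) :
    (a.support.filter fun i => j < a i) = Finset.range (conjPart a j) := by
  apply Finset.eq_of_subset_of_card_le
  · intro i hi
    rw [Finset.mem_range, conjPart]
    have h : Finset.range (i + 1) ⊆ a.support.filter fun i => j < a i := by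
      intro k hk
      rw [Finset.mem_filter] at hi ⊢
      have := ha (show k ≤ i by simpa [Nat.lt_succ_iff] using hk)
      refine ⟨?_, by omega⟩
      rw [Finsupp.mem_support_iff]
      omega
    have := Finset.card_le_card h
    rw [Finset.card_range] at this
    omega
  · rw [Finset.card_range, conjPart]

/-- The product of the `e_c`, where `c` runs over the parts of the conjugate partition. -/
def esymConj (R : Type*) [CommRing R] {d : ℕ} (μ : d.Partition) : symFun R :=
  ∏ j ∈ Finset.range d, esym R (conjPart (expo μ) j)

/-- Adding the columns of the Young diagram recovers its rows: `i` lies in column `j` exactly when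
`j` is less than the `i`-th part. -/
theorem sum_ind_conjPart {d : ℕ} (μ : d.Partition) :
    ∑ j ∈ Finset.range d, ind (Finset.range (conjPart (expo μ) j)) = expo μ := by
  ext i
  rw [Finsupp.finsetSum_apply]
  have h : ∀ j ∈ Finset.range d, ind (Finset.range (conjPart (expo μ) j)) i =
      if j < expo μ i then 1 else 0 := by
    intro j _
    rw [ind_apply, ← filter_eq_range (antitone_expo μ)]
    congr 1
    rw [Finset.mem_filter, Finsupp.mem_support_iff]
    apply propext
    omega
  rw [Finset.sum_congr rfl h, ← Finset.card_filter]
  have hle : expo μ i ≤ d := by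
    conv_rhs => rw [← degree_expo μ]
    exact Finsupp.le_degree i _
  rw [show (Finset.range d).filter (fun j => j < expo μ i) = Finset.range (expo μ i) by
    ext j
    rw [Finset.mem_filter, Finset.mem_range, Finset.mem_range]
    omega, Finset.card_range]

theorem isLead_esymConj {d : ℕ} (μ : d.Partition) : IsLead (esymConj R μ) (expo μ) := by
  rw [← sum_ind_conjPart]
  exact isLead_prod _ fun j _ => isLead_esym _

theorem esymConj_mem_symDeg {d : ℕ} (μ : d.Partition) : esymConj R μ ∈ symDeg R d := by
  have h := prod_mem_symDeg (R := R) (Finset.range d)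
    fun j _ => esym_mem_symDeg (R := R) (conjPart (expo μ) j)
  have h2 : ∑ j ∈ Finset.range d, conjPart (expo μ) j = d := by
    conv_rhs => rw [← degree_expo μ, ← sum_ind_conjPart, map_sum]
    refine Finset.sum_congr rfl fun j _ => ?_
    rw [degree_ind, Finset.card_range]
  rwa [h2] at h

/-- The coefficient matrix of the `e_{μ'}` at the exponents of partitions is triangular with unit
diagonal for the lexicographic order, hence invertible over any `R`. -/
theorem exists_sum_esymConj {d : ℕ} {f : symFun R} (hf : f ∈ symDeg R d) :
    ∃ c : d.Partition → R, f = ∑ μ, c μ • esymConj R μ := by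
  let _ : LinearOrder d.Partition := LinearOrder.lift' (fun μ => toLex (expo μ))
    (toLex.injective.comp expo_injective)
  set C : Matrix d.Partition d.Partition R := fun μ ν => cf (expo ν) (esymConj R μ) with hC
  have hdet : IsUnit C := by
    rw [Matrix.isUnit_iff_isUnit_det, Matrix.det_of_isLowerTriangular C]
    · rw [Finset.prod_eq_one fun μ _ => (isLead_esymConj μ).1]
      exact isUnit_one
    · intro μ ν hlt
      by_contra h
      have h1 := (isLead_esymConj μ).2 _ h
      exact absurd h1 (not_le.2 hlt)
  obtain ⟨c, hc⟩ := Matrix.vecMul_surjective_iff_isUnit.2 hdet fun ν => cf (expo ν) f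
  refine ⟨c, eq_of_cf_expo hf (Submodule.sum_mem _ fun μ _ => ?_) fun ν => ?_⟩
  · exact Submodule.smul_mem _ _ (esymConj_mem_symDeg μ)
  · rw [← congrFun hc ν]
    simp [Matrix.vecMul, dotProduct, hC]

theorem esym_zero : esym R 0 = 1 := by
  classical
  apply ext_cf
  intro m
  rw [cf_esym, cf_one]
  congr 1
  rw [Multiset.replicate_zero, ← Multiset.card_eq_zero, card_vals, Finset.card_eq_zero,
    Finsupp.support_eq_empty]

/-- The relation `∑ (-1)^i e_i h_{n-i} = 0` is solved recursively for `e_n`. -/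
theorem esym_mem_lowerRing (p n M : ℕ) (hn : n < M) :
    esym ℤ n ∈ lowerRing p (hsym ℤ) M := by
  induction n using Nat.strong_induction_on with
  | _ n ih =>
    by_cases h0 : n = 0
    · rw [h0, esym_zero]
      exact one_mem _
    · have h := sum_esym_mul_hsym (R := ℤ) h0
      rw [Finset.sum_range_succ, Nat.sub_self, hsym_zero, mul_one] at h
      have h1 : (-1) ^ n * esym ℤ n ∈ lowerRing p (hsym ℤ) M := by
        rw [eq_neg_of_add_eq_zero_right h]
        refine neg_mem (sum_mem fun i hi => ?_)
        rw [Finset.mem_range] at hi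
        exact mul_mem (pow_mem (neg_mem (one_mem _)) _) (mul_mem (ih i hi (by omega))
          (mem_lowerRing (by omega) (by omega)))
      have h2 := mul_mem (pow_mem (neg_mem (one_mem (lowerRing p (hsym ℤ) M))) n) h1
      rwa [← mul_assoc, ← mul_pow, show (-1 : symFun ℤ) * -1 = 1 by ring, one_pow, one_mul] at h2

/-- A symmetric function of degree `d` is a polynomial in `h_1, …, h_d`. -/
theorem mem_lowerRing_hsym (p : ℕ) {d : ℕ} {f : symFun ℤ} (hf : f ∈ symDeg ℤ d) :
    f ∈ lowerRing p (hsym ℤ) (d + 1) := by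
  obtain ⟨c, rfl⟩ := exists_sum_esymConj hf
  refine sum_mem fun μ _ => zsmul_mem (prod_mem fun j hj => esym_mem_lowerRing _ _ _ ?_) _
  have h2 : ∑ j ∈ Finset.range d, conjPart (expo μ) j = d := by
    conv_rhs => rw [← degree_expo μ, ← sum_ind_conjPart, map_sum]
    refine Finset.sum_congr rfl fun j _ => ?_
    rw [degree_ind, Finset.card_range]
  have := Finset.single_le_sum (f := fun j => conjPart (expo μ) j) (fun _ _ => Nat.zero_le _) hj
  omega

end Spanning

/-! ### The Hall form: power sum derivations and duality of `h` and `m` -/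

section HallForm

variable (K : Type*) [Field K] [CharZero K]

/-- The product of the power sums `p_a`, where `a` runs over a multiset. -/
def pprod (R : Type*) [CommRing R] (s : Multiset ℕ) : symFun R := (s.map (psum R)).prod

theorem pprod_cons {R : Type*} [CommRing R] (n : ℕ) (s : Multiset ℕ) :
    pprod R (n ::ₘ s) = psum R n * pprod R s := by simp [pprod]

theorem pprod_zero {R : Type*} [CommRing R] : pprod R 0 = 1 := by simp [pprod]

theorem pprod_add {R : Type*} [CommRing R] (s t : Multiset ℕ) :
    pprod R (s + t) = pprod R s * pprod R t := by simp [pprod]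

theorem psumPar_eq {R : Type*} [CommRing R] (μ : Par) : psumPar R μ = pprod R μ.2.parts := rfl

theorem pprod_mem_symDeg {R : Type*} [CommRing R] (s : Multiset ℕ) :
    pprod R s ∈ symDeg R s.sum := by
  induction s using Multiset.induction_on with
  | empty => simpa [pprod] using one_mem_symDeg
  | cons a s ih =>
    rw [pprod_cons, Multiset.sum_cons]
    exact mul_mem_symDeg (psum_mem_symDeg a) ih

theorem exists_par (s : Multiset ℕ) (hs : ∀ a ∈ s, 0 < a) : ∃ μ : Par, μ.2.parts = s :=
  ⟨⟨s.sum, ⟨s, fun h => hs _ h, rfl⟩⟩, rfl⟩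

variable {K}

theorem psumBasis_apply (μ : Par) : psumBasis K μ = psumPar K μ := by
  rw [psumBasis, Module.Basis.mk_apply]

theorem psum_induction {P : symFun K → Prop} (hp : ∀ s : Multiset ℕ, (∀ a ∈ s, 0 < a) →
    P (pprod K s)) (h0 : P 0) (hadd : ∀ f g, P f → P g → P (f + g))
    (hsmul : ∀ (c : K) f, P f → P (c • f)) (f : symFun K) : P f := by
  have hf := top_le_span_psumPar K (Submodule.mem_top (x := f))
  induction hf using Submodule.span_induction with
  | mem x hx =>
    obtain ⟨μ, rfl⟩ := hx
    exact hp _ (parts_pos μ)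
  | zero => exact h0
  | add x y _ _ hx hy => exact hadd x y hx hy
  | smul c x _ hx => exact hsmul c x hx

theorem hom_ext_psum {V : Type*} [AddCommGroup V] [Module K V] {φ ψ : symFun K →ₗ[K] V}
    (h : ∀ s : Multiset ℕ, (∀ a ∈ s, 0 < a) → φ (pprod K s) = ψ (pprod K s)) : φ = ψ := by
  refine (psumBasis K).ext fun μ => ?_
  rw [psumBasis_apply]
  exact h _ (parts_pos μ)

variable (K)

/-- The linear map underlying `pderiv`. -/
def pderivLin (n : ℕ) : symFun K →ₗ[K] symFun K :=
  (psumBasis K).constr K fun μ =>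
    ((n * μ.2.parts.count n : ℕ) : K) • pprod K (μ.2.parts.erase n)

variable {K}

theorem pderivLin_pprod (n : ℕ) {s : Multiset ℕ} (hs : ∀ a ∈ s, 0 < a) :
    pderivLin K n (pprod K s) = ((n * s.count n : ℕ) : K) • pprod K (s.erase n) := by
  obtain ⟨μ, rfl⟩ := exists_par s hs
  rw [← psumPar_eq, ← psumBasis_apply, pderivLin, Module.Basis.constr_basis]

/-- By bilinearity it suffices to treat products of power sums, where removing a part `n` from `s +
t` means removing it from `s` or from `t`. -/
theorem pderivLin_mul (n : ℕ) (f g : symFun K) :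
    pderivLin K n (f * g) = f * pderivLin K n g + g * pderivLin K n f := by
  refine psum_induction (P := fun f => pderivLin K n (f * g) =
    f * pderivLin K n g + g * pderivLin K n f) (fun s hs => ?_) ?_ ?_ ?_ f
  · refine psum_induction (P := fun g => pderivLin K n (pprod K s * g) =
      pprod K s * pderivLin K n g + g * pderivLin K n (pprod K s)) (fun t ht => ?_)
      ?_ ?_ ?_ g
    · have hst : ∀ a ∈ s + t, 0 < a := fun a ha =>
        (Multiset.mem_add.1 ha).elim (hs a) (ht a)
      have key : ∀ s t : Multiset ℕ, ((n * s.count n : ℕ) : K) • pprod K ((s + t).erase n) =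
          ((n * s.count n : ℕ) : K) • (pprod K t * pprod K (s.erase n)) := by
        intro s t
        by_cases h : n ∈ s
        · rw [Multiset.erase_add_left_pos t h, pprod_add, mul_comm (pprod K t)]
        · rw [Multiset.count_eq_zero_of_notMem h]
          simp
      rw [← pprod_add, pderivLin_pprod n hst, pderivLin_pprod n hs, pderivLin_pprod n ht,
        mul_smul_comm, mul_smul_comm, ← key s t, ← key t s, add_comm t s, ← add_smul,
        Multiset.count_add]
      push_cast
      ring_nf
    · simp
    · intro g g' h h'
      rw [mul_add, map_add, map_add, h, h']
      ring
    · intro c g h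
      rw [mul_smul_comm, map_smul, map_smul, h, smul_add, mul_smul_comm, smul_mul_assoc]
  · simp
  · intro f f' h h'
    rw [add_mul, map_add, map_add, h, h']
    ring
  · intro c f h
    rw [smul_mul_assoc, map_smul, map_smul, h, smul_add, mul_smul_comm, smul_mul_assoc]

variable (K) in
/-- The derivation `n ∂/∂p_n`. -/
def pderiv (n : ℕ) : Derivation K (symFun K) (symFun K) :=
  Derivation.mk' (pderivLin K n) (pderivLin_mul n)

theorem pderiv_pprod (n : ℕ) {s : Multiset ℕ} (hs : ∀ a ∈ s, 0 < a) :
    pderiv K n (pprod K s) = ((n * s.count n : ℕ) : K) • pprod K (s.erase n) :=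
  pderivLin_pprod n hs

theorem pderiv_psum (n : ℕ) {m : ℕ} (hm : 0 < m) :
    pderiv K n (psum K m) = if n = m then (n : symFun K) else 0 := by
  have h := pderiv_pprod (K := K) n (s := {m}) (by simpa using hm)
  rw [show pprod K {m} = psum K m by simp [pprod]] at h
  rw [h]
  split_ifs with e
  · subst e
    simp [pprod, Algebra.smul_def]
  · simp [e]

theorem natCast_mul_cancel {k : ℕ} (hk : k ≠ 0) {f g : symFun K}
    (h : (k : symFun K) * f = k * g) : f = g := by
  apply ext_cf
  intro m
  have h1 := congrArg (cf m) h
  rw [← nsmul_eq_mul, ← nsmul_eq_mul, map_nsmul, map_nsmul, nsmul_eq_mul, nsmul_eq_mul] at h1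
  exact mul_left_cancel₀ (Nat.cast_ne_zero.2 hk) h1

/-- The derivation is applied to Newton's identity for `k h_k`. By induction on `k` the result for
`n ≤ k` is `(k - n) h_{k-n} + n h_{k-n}`, using Newton's identity once more for `h_{k-n}`. -/
theorem pderiv_hsym {n : ℕ} (hn : 0 < n) (k : ℕ) :
    pderiv K n (hsym K k) = if n ≤ k then hsym K (k - n) else 0 := by
  induction k using Nat.strong_induction_on with
  | _ k ih =>
    by_cases hk : k = 0
    · subst hk
      rw [hsym_zero, if_neg (by omega), Derivation.map_one_eq_zero]
    · apply natCast_mul_cancel hk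
      have h := congrArg (pderiv K n) (newton (R := K) k)
      have h0 : pderiv K n ((k : symFun K) * hsym K k) = k * pderiv K n (hsym K k) := by
        rw [← nsmul_eq_mul, map_nsmul, nsmul_eq_mul]
      rw [h0, map_sum] at h
      have h1 : ∀ j ∈ Finset.Icc 1 k, pderiv K n (psum K j * hsym K (k - j)) =
          psum K j * (if n ≤ k - j then hsym K (k - j - n) else 0) +
            (if n = j then n * hsym K (k - n) else 0) := by
        intro j hj
        rw [Finset.mem_Icc] at hj
        rw [Derivation.leibniz, ih (k - j) (by omega), pderiv_psum n (by omega), smul_eq_mul,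
          smul_eq_mul]
        congr 1
        split_ifs with e
        · rw [← e, mul_comm]
        · simp
      rw [Finset.sum_congr rfl h1, Finset.sum_add_distrib, Finset.sum_ite_eq] at h
      rw [h]
      by_cases hnk : n ≤ k
      · rw [if_pos (Finset.mem_Icc.2 ⟨hn, hnk⟩), if_pos hnk]
        have h2 : ∑ j ∈ Finset.Icc 1 k, psum K j *
            (if n ≤ k - j then hsym K (k - j - n) else 0) =
            ∑ j ∈ Finset.Icc 1 (k - n), psum K j * hsym K (k - n - j) := by
          rw [← Finset.sum_subset (Finset.Icc_subset_Icc_right (Nat.sub_le k n))]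
          · refine Finset.sum_congr rfl fun j hj => ?_
            rw [Finset.mem_Icc] at hj
            rw [if_pos (by omega), Nat.sub_right_comm]
          · intro j hj hj'
            rw [Finset.mem_Icc] at hj hj'
            rw [if_neg (by omega), mul_zero]
        rw [h2, ← newton, ← add_mul]
        congr 1
        rw [← Nat.cast_add]
        congr 1
        omega
      · rw [if_neg (by rw [Finset.mem_Icc]; omega), if_neg hnk, add_zero, mul_zero]
        refine Finset.sum_eq_zero fun j _ => ?_
        rw [if_neg (by omega), mul_zero]

/-- `h_b = ∏_i h_{b_i}`. -/
def hprod (R : Type*) [CommRing R] (b : ℕ →₀ ℕ) : symFun R := b.prod fun _ k => hsym R k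

theorem hprod_eq {R : Type*} [CommRing R] {b : ℕ →₀ ℕ} {S : Finset ℕ} (h : b.support ⊆ S) :
    hprod R b = ∏ i ∈ S, hsym R (b i) :=
  Finsupp.prod_of_support_subset _ h _ fun _ _ => hsym_zero

theorem hprod_mem_symDeg {R : Type*} [CommRing R] (b : ℕ →₀ ℕ) : hprod R b ∈ symDeg R b.degree :=
  prod_mem_symDeg _ fun _ _ => hsym_mem_symDeg _

theorem pderiv_prod {ι : Type*} [DecidableEq ι] (n : ℕ) (S : Finset ι) (f : ι → symFun K) :
    pderiv K n (∏ i ∈ S, f i) = ∑ i ∈ S, pderiv K n (f i) * ∏ j ∈ S.erase i, f j := by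
  induction S using Finset.induction_on with
  | empty => simp
  | insert a S ha ih =>
    rw [Finset.prod_insert ha, Derivation.leibniz, ih, Finset.sum_insert ha,
      Finset.erase_insert ha, smul_eq_mul, smul_eq_mul, add_comm, Finset.mul_sum,
      mul_comm (pderiv K n (f a))]
    congr 1
    refine Finset.sum_congr rfl fun i hi => ?_
    have hne : i ≠ a := fun e => ha (e ▸ hi)
    rw [Finset.erase_insert_of_ne hne.symm, Finset.prod_insert (fun h =>
      ha (Finset.mem_of_mem_erase h))]
    ring

theorem pderiv_hprod {n : ℕ} (hn : 0 < n) (b : ℕ →₀ ℕ) :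
    pderiv K n (hprod K b) =
      ∑ i ∈ b.support.filter fun i => n ≤ b i, hprod K (b - Finsupp.single i n) := by
  classical
  rw [hprod_eq subset_rfl, pderiv_prod, Finset.sum_filter]
  refine Finset.sum_congr rfl fun i hi => ?_
  rw [pderiv_hsym hn]
  split_ifs with h
  · rw [hprod_eq (S := b.support), ← Finset.mul_prod_erase _ _ hi]
    · congr 1
      · simp
      · refine Finset.prod_congr rfl fun j hj => ?_
        rw [Finsupp.tsub_apply, Finsupp.single_eq_of_ne (Finset.ne_of_mem_erase hj), Nat.sub_zero]
    · exact Finsupp.support_tsub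
  · rw [zero_mul]

theorem zPar_eq {μ : Par} {N : ℕ} (h : μ.1 ≤ N) :
    zPar μ = ∏ i ∈ Finset.Icc 1 N, i ^ μ.2.parts.count i * (μ.2.parts.count i).factorial := by
  refine Finset.prod_subset (Finset.Icc_subset_Icc_right h) fun i _ hi => ?_
  have : μ.2.parts.count i = 0 := by
    rw [Multiset.count_eq_zero]
    intro hm
    have h1 := μ.2.parts_pos hm
    have h2 := Multiset.le_sum_of_mem hm
    rw [μ.2.parts_sum] at h2
    exact hi (Finset.mem_Icc.2 ⟨h1, h2⟩)
  simp [this]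

theorem zPar_cons {μ ν : Par} {n : ℕ} (hn : 0 < n) (h : ν.2.parts = n ::ₘ μ.2.parts) :
    zPar ν = n * (μ.2.parts.count n + 1) * zPar μ := by
  have hd : ν.1 = n + μ.1 := by
    rw [← ν.2.parts_sum, h, Multiset.sum_cons, μ.2.parts_sum]
  have hmem : n ∈ Finset.Icc 1 ν.1 := Finset.mem_Icc.2 (by omega)
  rw [zPar, zPar_eq (μ := μ) (N := ν.1) (by omega), ← Finset.mul_prod_erase _ _ hmem,
    ← Finset.mul_prod_erase (Finset.Icc 1 ν.1) (fun i => i ^ μ.2.parts.count i *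
      (μ.2.parts.count i).factorial) hmem, h, Multiset.count_cons_self, Nat.factorial_succ]
  have : ∀ i ∈ (Finset.Icc 1 ν.1).erase n, i ^ (n ::ₘ μ.2.parts).count i *
      ((n ::ₘ μ.2.parts).count i).factorial =
      i ^ μ.2.parts.count i * (μ.2.parts.count i).factorial := by
    intro i hi
    rw [Multiset.count_cons_of_ne (Finset.ne_of_mem_erase hi)]
  rw [Finset.prod_congr rfl this]
  ring

theorem sForm_symm (s : K) (f g : symFun K) : sForm K s f g = sForm K s g f := by
  classical
  have : sForm K s = (sForm K s).flip := by
    refine (psumBasis K).ext fun μ => (psumBasis K).ext fun ν => ?_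
    rw [LinearMap.flip_apply, psumBasis_apply, psumBasis_apply, sForm_psumPar, sForm_psumPar]
    by_cases h : μ = ν
    · rw [h]
    · rw [if_neg h, if_neg (Ne.symm h)]
  conv_lhs => rw [this]
  rfl

/-- On products of power sums this adjointness is the identity `z_ν = n m_n(ν) z_τ`, where `τ`
arises from `ν` by removing a part `n`. -/
theorem sForm_psum_mul {n : ℕ} (hn : 0 < n) (f g : symFun K) :
    sForm K 1 (psum K n * f) g = sForm K 1 f (pderiv K n g) := by
  classical
  refine psum_induction (P := fun f => sForm K 1 (psum K n * f) g =
    sForm K 1 f (pderiv K n g)) (fun s hs => ?_) ?_ ?_ ?_ f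
  · refine psum_induction (P := fun g => sForm K 1 (psum K n * pprod K s) g =
      sForm K 1 (pprod K s) (pderiv K n g)) (fun t ht => ?_)
      ?_ ?_ ?_ g
    · rw [pderiv_pprod n ht, map_smul, ← pprod_cons]
      have hs' : ∀ a ∈ n ::ₘ s, 0 < a := fun a ha => by
        rcases Multiset.mem_cons.1 ha with rfl | h
        · exact hn
        · exact hs a h
      obtain ⟨μ, rfl⟩ := exists_par s hs
      obtain ⟨ν, rfl⟩ := exists_par t ht
      obtain ⟨ρ, hρ⟩ := exists_par _ hs'
      obtain ⟨τ, hτ⟩ := exists_par (ν.2.parts.erase n) fun a ha =>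
        ht a (Multiset.mem_of_mem_erase ha)
      rw [← hρ, ← hτ, ← psumPar_eq, ← psumPar_eq, ← psumPar_eq, ← psumPar_eq, sForm_psumPar,
        sForm_psumPar, one_pow, one_mul, one_pow, one_mul, smul_eq_mul]
      by_cases hν : n ∈ ν.2.parts
      · have e1 : ν.2.parts = n ::ₘ τ.2.parts := by rw [hτ, Multiset.cons_erase hν]
        by_cases e : μ = τ
        · subst e
          have e2 : ρ = ν := par_ext (by rw [hρ, e1])
          rw [if_pos e2, if_pos rfl, e2, zPar_cons hn e1, e1, Multiset.count_cons_self]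
          push_cast
          ring
        · rw [if_neg e, if_neg, mul_zero]
          intro e2
          rw [e2] at hρ
          exact e (par_ext ((Multiset.cons_inj_right n).1 (hρ.symm.trans e1)))
      · rw [Multiset.count_eq_zero_of_notMem hν, mul_zero, Nat.cast_zero, zero_mul, if_neg]
        rintro rfl
        rw [hρ] at hν
        exact hν (Multiset.mem_cons_self _ _)
    · simp
    · intro g g' h h'
      rw [map_add, map_add, map_add, h, h']
    · intro c g h
      rw [map_smul, Derivation.map_smul, map_smul, h]
  · simp
  · intro f f' h h'
    rw [mul_add, map_add, map_add, LinearMap.add_apply, LinearMap.add_apply, h, h']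
  · intro c f h
    rw [mul_smul_comm, map_smul, map_smul, LinearMap.smul_apply, LinearMap.smul_apply, h]

theorem cf_zero_mul {R : Type*} [CommRing R] (f g : symFun R) : cf 0 (f * g) = cf 0 f * cf 0 g := by
  classical
  rw [cf_mul]
  simp

theorem cf_zero_eq_zero {R : Type*} [CommRing R] {d : ℕ} (hd : d ≠ 0) {f : symFun R}
    (hf : f ∈ symDeg R d) : cf 0 f = 0 :=
  cf_eq_zero_of_mem hf (by simpa using hd.symm)

theorem sForm_one (f : symFun K) : sForm K 1 1 f = cf 0 f := by
  classical
  have : sForm K 1 1 = cf 0 := by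
    refine hom_ext_psum fun s hs => ?_
    obtain ⟨μ, rfl⟩ := exists_par s hs
    obtain ⟨ν, hν⟩ := exists_par 0 (by simp)
    have h1 : (1 : symFun K) = psumPar K ν := by rw [psumPar_eq, hν, pprod_zero]
    rw [← psumPar_eq]
    have h2 : sForm K 1 1 (psumPar K μ) = sForm K 1 (psumPar K ν) (psumPar K μ) := by rw [← h1]
    rw [h2, sForm_psumPar]
    by_cases h : ν = μ
    · rw [if_pos h, ← h, ← h1, cf_one, if_pos rfl, zPar]
      simp [hν]
    · rw [if_neg h, psumPar_eq]
      refine (cf_zero_eq_zero (d := μ.2.parts.sum) (fun h0 => h (par_ext ?_))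
        (pprod_mem_symDeg _)).symm
      rw [hν, eq_comm, Multiset.eq_zero_iff_forall_notMem]
      intro a ha
      have h1 := parts_pos μ a ha
      have h2 := Multiset.le_sum_of_mem ha
      omega
  rw [this]

theorem cf_zero_hprod {R : Type*} [CommRing R] (b : ℕ →₀ ℕ) :
    cf b (1 : symFun R) = cf 0 (hprod R b) := by
  classical
  rw [cf_one]
  by_cases h : b = 0
  · subst h
    rw [if_pos rfl, hprod, Finsupp.prod_zero_index, cf_one, if_pos rfl]
  · rw [if_neg h]
    exact (cf_zero_eq_zero (fun e => h ((Finsupp.degree_eq_zero_iff b).1 e))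
      (hprod_mem_symDeg b)).symm

/-- The complete and the monomial symmetric functions are dual for the Hall form. -/
theorem sForm_hprod (b : ℕ →₀ ℕ) (f : symFun K) : sForm K 1 (hprod K b) f = cf b f := by
  rw [sForm_symm]
  refine psum_induction (P := fun f => sForm K 1 f (hprod K b) = cf b f) (fun s hs => ?_) ?_ ?_ ?_ f
  -- Both sides satisfy the same recursion: the adjoint of `p_n` lowers one index of `h_b` by `n`,
  -- and multiplication by `p_n` raises one exponent by `n`.
  · induction s using Multiset.induction_on generalizing b with
    | empty => rw [pprod_zero, sForm_one, cf_zero_hprod]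
    | cons n s ih =>
      have hn := hs n (Multiset.mem_cons_self _ _)
      rw [pprod_cons, sForm_psum_mul hn, pderiv_hprod hn, cf_psum_mul hn.ne', map_sum]
      exact Finset.sum_congr rfl fun i _ => ih _ fun a ha => hs a (Multiset.mem_cons_of_mem ha)
  · simp
  · intro f f' h h'
    rw [map_add, map_add, LinearMap.add_apply, h, h']
  · intro c f h
    rw [map_smul, map_smul, LinearMap.smul_apply, h]

/-- The functional `f ↦ ∂f/∂p_n (0)`, up to the factor `n`, vanishes outside degree `n`. -/
theorem cf_zero_pderiv {n d : ℕ} (hd : d ≠ n) {f : symFun K} (hf : f ∈ symDeg K d) :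
    cf 0 (pderiv K n f) = 0 := by
  -- Composing with the projection to degree `d` gives a linear statement on the whole ring, which
  -- can be checked on products of power sums.
  have h : (cf 0 ∘ₗ (pderiv K n).toLinearMap) ∘ₗ proj d = (0 : symFun K →ₗ[K] K) := by
    refine hom_ext_psum fun s hs => ?_
    rw [LinearMap.comp_apply, proj_eq (pprod_mem_symDeg s), LinearMap.zero_apply]
    split_ifs with e
    · change cf 0 (pderiv K n (pprod K s)) = 0
      rw [pderiv_pprod n hs, map_smul]
      by_cases hn : n ∈ s
      · have h1 := Multiset.sum_erase hn
        rw [cf_zero_eq_zero (d := (s.erase n).sum) (by omega) (pprod_mem_symDeg _), smul_zero]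
      · rw [Multiset.count_eq_zero_of_notMem hn]
        simp
    · simp
  have h2 := LinearMap.congr_fun h f
  rw [LinearMap.comp_apply, proj_self hf] at h2
  exact h2

end HallForm

/-! ### The plethysm `theta`, the Adams operation, and the passage to `ℂ` -/

section Rename

theorem rename_expand {σ τ R : Type*} [CommRing R] (f : σ → τ) [Filter.TendstoCofinite f] {p : ℕ}
    (hp : p ≠ 0) (g : MvPowerSeries σ R) :
    MvPowerSeries.rename f (MvPowerSeries.expand p hp g) =
      MvPowerSeries.expand p hp (MvPowerSeries.rename f g) := by
  rw [MvPowerSeries.rename_eq_subst, MvPowerSeries.rename_eq_subst,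
    MvPowerSeries.expand_subst p hp (MvPowerSeries.HasSubst.X_comp f), MvPowerSeries.expand,
    MvPowerSeries.substAlgHom_apply, MvPowerSeries.subst_comp_subst_apply
      (MvPowerSeries.HasSubst.X_pow hp) (MvPowerSeries.HasSubst.X_comp f)]
  congr 1
  funext i
  rw [MvPowerSeries.subst_pow (MvPowerSeries.HasSubst.X_comp f),
    MvPowerSeries.subst_X (MvPowerSeries.HasSubst.X_comp f)]
  simp

/-- The fibres of `i ↦ i / s` are finite, so identifying variables along it is defined on power
series. -/
instance tendstoCofinite_div (s : ℕ) [NeZero s] : Filter.TendstoCofinite fun i : ℕ => i / s := by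
  rw [Filter.tendstoCofinite_iff_finite_preimage_singleton]
  intro j
  refine (Set.finite_Iio (s * (j + 1))).subset fun i hi => ?_
  have h : i / s = j := hi
  rw [Set.mem_Iio, ← h, mul_comm]
  exact Nat.lt_mul_of_div_lt (Nat.lt_succ_self _) (Nat.pos_of_ne_zero (NeZero.ne s))

variable {R : Type*} [CommRing R]

theorem degree_of_coeff_rename {σ τ : Type*} (f : σ → τ) [Filter.TendstoCofinite f]
    {g : MvPowerSeries σ R} {x : τ →₀ ℕ}
    (h : MvPowerSeries.coeff x (MvPowerSeries.rename f g) ≠ 0) :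
    ∃ m : σ →₀ ℕ, m.degree = x.degree ∧ MvPowerSeries.coeff m g ≠ 0 := by
  rw [MvPowerSeries.coeff_rename] at h
  obtain ⟨m, hm, hne⟩ := Finset.exists_ne_zero_of_sum_ne_zero h
  rw [Set.Finite.mem_toFinset, Set.mem_preimage, Set.mem_singleton_iff] at hm
  exact ⟨m, by rw [← hm, Finsupp.degree_mapDomain], hne⟩

/-- The permutation of the indices that moves whole blocks of length `s`. -/
def blockPerm (s : ℕ) [NeZero s] (σ : Equiv.Perm ℕ) : Equiv.Perm ℕ :=
  (Nat.divModEquiv s).trans ((σ.prodCongr (Equiv.refl _)).trans (Nat.divModEquiv s).symm)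

theorem blockPerm_div (s : ℕ) [NeZero s] (σ : Equiv.Perm ℕ) (i : ℕ) :
    blockPerm s σ i / s = σ (i / s) := by
  have h : ((Nat.divModEquiv s) (blockPerm s σ i)).1 = σ ((Nat.divModEquiv s) i).1 := by
    rw [blockPerm, Equiv.trans_apply, Equiv.trans_apply, Equiv.apply_symm_apply]
    rfl
  exact h

/-- The plethysm `f ↦ f(x_0, …, x_0, x_1, …, x_1, …)` in which each variable occurs `s` times; it
multiplies the power sums by `s`. -/
def theta (R : Type*) [CommRing R] (s : ℕ) [NeZero s] : symFun R →ₐ[R] symFun R :=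
  ((MvPowerSeries.rename fun i : ℕ => i / s).comp (symFun R).val).codRestrict (symFun R) (by
    intro f
    refine ⟨fun σ => ?_, ?_⟩
    · change MvPowerSeries.rename σ (MvPowerSeries.rename (fun i : ℕ => i / s) f.1) =
        MvPowerSeries.rename (fun i : ℕ => i / s) f.1
      -- `f` is invariant under the permutation of blocks of length `s`, which induces `σ` after
      -- division by `s`.
      conv_rhs => rw [← f.2.1 (blockPerm s σ)]
      rw [MvPowerSeries.rename_rename, MvPowerSeries.rename_rename]
      congr 2
      funext i
      exact (blockPerm_div s σ i).symm
    · obtain ⟨N, hN⟩ := f.2.2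
      refine ⟨N, fun m hm => ?_⟩
      obtain ⟨m', h1, h2⟩ := degree_of_coeff_rename (fun i : ℕ => i / s) (g := f.1) hm
      rw [← h1]
      exact hN m' h2)

theorem theta_mem_symDeg (s : ℕ) [NeZero s] {d : ℕ} {f : symFun R} (hf : f ∈ symDeg R d) :
    theta R s f ∈ symDeg R d := by
  intro m hm
  obtain ⟨m', h1, h2⟩ := degree_of_coeff_rename (fun i : ℕ => i / s) (g := f.1) hm
  rw [← h1]
  exact hf m' h2

/-- The monomial `x_j ^ n` comes from exactly the `s` monomials `x_i ^ n` with `s j ≤ i < s (j +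
1)`. -/
theorem theta_psum (s : ℕ) [NeZero s] {n : ℕ} (hn : n ≠ 0) :
    theta R s (psum R n) = s * psum R n := by
  classical
  have hs : 0 < s := Nat.pos_of_ne_zero (NeZero.ne s)
  apply ext_cf
  intro x
  rw [← nsmul_eq_mul, map_nsmul]
  have e : ∀ m, cf m (psum R n) = if ∃ i, m = Finsupp.single i n then 1 else 0 :=
    coeff_psumSeries R n
  have h0 : cf x (theta R s (psum R n)) = ∑ m ∈ (Filter.TendstoCofinite.finite_preimage_singleton
      (Finsupp.mapDomain fun i : ℕ => i / s) x).toFinset, cf m (psum R n) :=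
    MvPowerSeries.coeff_rename _ _ _
  rw [h0, e]
  split_ifs with hx
  · obtain ⟨j, rfl⟩ := hx
    rw [← Finset.sum_of_injOn (s := Finset.Ico (s * j) (s * (j + 1)))
      (f := fun _ => (1 : R)) (fun i => Finsupp.single i n)]
    · simp [Nat.mul_succ]
    · intro i _ i' _ h
      exact Finsupp.single_left_injective hn h
    · intro i hi
      rw [Finset.coe_Ico, Set.mem_Ico] at hi
      rw [SetLike.mem_coe, Set.Finite.mem_toFinset, Set.mem_preimage, Finsupp.mapDomain_single,
        Set.mem_singleton_iff]
      congr 1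
      exact Nat.div_eq_of_lt_le (by linarith [mul_comm s j]) (by linarith [mul_comm s (j + 1)])
    · intro m hm hni
      rw [Set.Finite.mem_toFinset, Set.mem_preimage, Set.mem_singleton_iff] at hm
      rw [e, if_neg]
      rintro ⟨i, rfl⟩
      rw [Finsupp.mapDomain_single] at hm
      have hij : i / s = j := Finsupp.single_left_injective hn hm
      refine hni ⟨i, ?_, rfl⟩
      rw [Finset.coe_Ico, Set.mem_Ico, ← hij]
      exact ⟨Nat.mul_div_le i s, Nat.lt_mul_div_succ i hs⟩
    · intro i _
      rw [e, if_pos ⟨i, rfl⟩]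
  · rw [nsmul_zero]
    refine Finset.sum_eq_zero fun m hm => ?_
    rw [Set.Finite.mem_toFinset, Set.mem_preimage, Set.mem_singleton_iff] at hm
    rw [e, if_neg]
    rintro ⟨i, rfl⟩
    rw [Finsupp.mapDomain_single] at hm
    exact hx ⟨_, hm.symm⟩

theorem theta_pprod (s : ℕ) [NeZero s] {t : Multiset ℕ} (ht : ∀ a ∈ t, 0 < a) :
    theta R s (pprod R t) = ((s : R) ^ Multiset.card t) • pprod R t := by
  induction t using Multiset.induction_on with
  | empty => simp [pprod]
  | cons a t ih =>
    rw [pprod_cons, map_mul, theta_psum s (ht a (Multiset.mem_cons_self _ _)).ne',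
      ih fun b hb => ht b (Multiset.mem_cons_of_mem hb), Multiset.card_cons, pow_succ',
      Algebra.smul_def, Algebra.smul_def, map_mul, map_natCast]
    ring

/-- `theta` multiplies `p_λ` by `s ^ ℓ(λ)`. This turns the elementary divisors of a form into those
of an operator. -/
theorem sForm_eq_theta {K : Type*} [Field K] [CharZero K] (s : ℕ) [NeZero s] (f g : symFun K) :
    sForm K s f g = sForm K 1 (theta K s f) g := by
  classical
  refine psum_induction (P := fun f => sForm K s f g = sForm K 1 (theta K s f) g)
    (fun t ht => ?_) ?_ ?_ ?_ f
  · rw [theta_pprod s ht, map_smul, LinearMap.smul_apply]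
    refine psum_induction (P := fun g => sForm K s (pprod K t) g =
      ((s : K) ^ Multiset.card t) • sForm K 1 (pprod K t) g) (fun u hu => ?_) ?_ ?_ ?_ g
    · obtain ⟨μ, rfl⟩ := exists_par t ht
      obtain ⟨ν, rfl⟩ := exists_par u hu
      rw [← psumPar_eq, ← psumPar_eq, sForm_psumPar, sForm_psumPar, smul_eq_mul]
      split_ifs <;> simp
    · simp
    · intro g g' h h'
      rw [map_add, map_add, h, h', smul_add]
    · intro c g h
      rw [map_smul, map_smul, h, smul_comm]
  · simp
  · intro f f' h h'
    rw [map_add, map_add, map_add, LinearMap.add_apply, LinearMap.add_apply, h, h']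
  · intro c f h
    rw [map_smul, map_smul, map_smul, LinearMap.smul_apply, LinearMap.smul_apply, h]

/-- The Adams operation `f ↦ f(x_0 ^ p, x_1 ^ p, …)`. -/
def adams (R : Type*) [CommRing R] {p : ℕ} (hp : p ≠ 0) : symFun R →ₐ[R] symFun R :=
  ((MvPowerSeries.expand p hp).comp (symFun R).val).codRestrict (symFun R) (by
    intro f
    refine ⟨fun σ => ?_, ?_⟩
    · change MvPowerSeries.rename σ (MvPowerSeries.expand p hp f.1) =
        MvPowerSeries.expand p hp f.1
      rw [rename_expand, f.2.1 σ]
    · obtain ⟨N, hN⟩ := f.2.2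
      refine ⟨p * N, fun m hm => ?_⟩
      obtain ⟨m', h1, rfl⟩ := MvPowerSeries.support_expand_subset p hp f.1 hm
      simp only
      rw [map_nsmul, smul_eq_mul]
      exact Nat.mul_le_mul_left p (hN m' h1))

theorem adams_mem_symDeg {p : ℕ} (hp : p ≠ 0) {d : ℕ} {f : symFun R} (hf : f ∈ symDeg R d) :
    adams R hp f ∈ symDeg R (p * d) := by
  intro m hm
  obtain ⟨m', h1, rfl⟩ := MvPowerSeries.support_expand_subset p hp f.1 hm
  simp only
  rw [map_nsmul, smul_eq_mul, hf m' h1]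

theorem theta_adams {p : ℕ} (hp : p ≠ 0) (s : ℕ) [NeZero s] (f : symFun R) :
    theta R s (adams R hp f) = adams R hp (theta R s f) :=
  Subtype.ext (rename_expand (fun i : ℕ => i / s) hp f.1)

theorem adams_psum {p : ℕ} (hp : p ≠ 0) (n : ℕ) :
    adams R hp (psum R n) = psum R (p * n) := by
  classical
  apply ext_cf
  intro m
  have e : ∀ n m, cf m (psum R n) = if ∃ i, m = Finsupp.single i n then 1 else 0 :=
    coeff_psumSeries R
  have h0 : cf m (adams R hp (psum R n)) =
      MvPowerSeries.coeff m (MvPowerSeries.expand p hp (psum R n).1) := rfl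
  by_cases h : ∃ i, ¬ p ∣ m i
  · obtain ⟨i, hi⟩ := h
    rw [h0, MvPowerSeries.coeff_expand_of_not_dvd p hp _ hi, e, if_neg]
    rintro ⟨j, rfl⟩
    apply hi
    rw [Finsupp.single_apply]
    split_ifs <;> simp
  · push Not at h
    obtain ⟨m', rfl⟩ : ∃ m', m = p • m' := by
      refine ⟨m.mapRange (fun a => a / p) (Nat.zero_div p), ?_⟩
      ext i
      simp [Nat.mul_div_cancel' (h i)]
    rw [h0, MvPowerSeries.coeff_expand_smul, e]
    change cf m' (psum R n) = _
    rw [e]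
    congr 1
    apply propext
    constructor
    · rintro ⟨i, rfl⟩
      exact ⟨i, by rw [Finsupp.smul_single, smul_eq_mul]⟩
    · rintro ⟨i, hi⟩
      refine ⟨i, nsmul_right_injective hp ?_⟩
      simp only
      rw [hi, Finsupp.smul_single, smul_eq_mul]

theorem exists_eq_natCast_mul {p : ℕ} {f : symFun ℤ} (h : ∀ m, (p : ℤ) ∣ cf m f) :
    ∃ g, f = (p : symFun ℤ) * g := by
  obtain ⟨N, hN⟩ := f.2.2
  refine ⟨ofCoeff (fun m => cf m f / p) (fun m m' e => by simp only [cf_eq_of_vals f e]) N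
    (fun m hm => hN m fun e => hm ?_), ?_⟩
  · have : cf m f = 0 := e
    rw [this, Int.zero_ediv]
  · apply ext_cf
    intro m
    rw [← nsmul_eq_mul, map_nsmul, cf_ofCoeff, nsmul_eq_mul, Int.mul_ediv_cancel' (h m)]

theorem int_natCast_mul_cancel {k : ℕ} (hk : k ≠ 0) {f g : symFun ℤ}
    (h : (k : symFun ℤ) * f = k * g) : f = g := by
  apply ext_cf
  intro m
  have h1 := congrArg (cf m) h
  rw [← nsmul_eq_mul, ← nsmul_eq_mul, map_nsmul, map_nsmul, nsmul_eq_mul, nsmul_eq_mul] at h1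
  exact mul_left_cancel₀ (Nat.cast_ne_zero.2 hk) h1

theorem mem_symDeg_of_natCast_mul {k : ℕ} (hk : k ≠ 0) {d : ℕ} {f : symFun ℤ}
    (h : (k : symFun ℤ) * f ∈ symDeg ℤ d) : f ∈ symDeg ℤ d := by
  intro m hm
  refine h m ?_
  change cf m ((k : symFun ℤ) * f) ≠ 0
  rw [← nsmul_eq_mul, map_nsmul, nsmul_eq_mul]
  exact mul_ne_zero (Nat.cast_ne_zero.2 hk) hm

/-- Over `ZMod p` the coefficients are fixed by the Frobenius, so raising the variables to the
`p`-th power is raising the series to the `p`-th power. -/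
theorem exists_adams_eq {p : ℕ} (hp : p.Prime) (f : symFun ℤ) :
    ∃ g, adams ℤ hp.ne_zero f = f ^ p + p * g := by
  have : Fact p.Prime := ⟨hp⟩
  have h : ∀ m, (p : ℤ) ∣ cf m (adams ℤ hp.ne_zero f - f ^ p) := by
    intro m
    rw [← ZMod.intCast_zmod_eq_zero_iff_dvd, map_sub, Int.cast_sub, sub_eq_zero]
    have e := MvPowerSeries.map_frobenius_expand p hp.ne_zero
      (f := MvPowerSeries.map (Int.castRingHom (ZMod p)) f.1)
    rw [ZMod.frobenius_zmod, MvPowerSeries.map_id, RingHom.id_apply, ← MvPowerSeries.map_expand,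
      ← map_pow] at e
    have e2 := congrArg (MvPowerSeries.coeff m) e
    rw [MvPowerSeries.coeff_map, MvPowerSeries.coeff_map] at e2
    exact e2
  obtain ⟨g, hg⟩ := exists_eq_natCast_mul h
  exact ⟨g, sub_eq_iff_eq_add'.1 hg⟩

/-- The Adams operation is a lift of the Frobenius. -/
def adamsLift {p : ℕ} (hp : p.Prime) : FrobLift p (symFun ℤ) where
  φ := adams ℤ hp.ne_zero
  δ f := (exists_adams_eq hp f).choose
  spec f := (exists_adams_eq hp f).choose_spec
  cancel _ _ h := int_natCast_mul_cancel hp.ne_zero h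

theorem delta_mem_symDeg {p : ℕ} (hp : p.Prime) {d : ℕ} {f : symFun ℤ} (hf : f ∈ symDeg ℤ d) :
    (adamsLift hp).δ f ∈ symDeg ℤ (p * d) := by
  apply mem_symDeg_of_natCast_mul hp.ne_zero
  have h := (adamsLift hp).spec f
  rw [← sub_eq_iff_eq_add'] at h
  rw [← h]
  refine Submodule.sub_mem _ (adams_mem_symDeg hp.ne_zero hf) ?_
  rw [mul_comm]
  exact pow_mem_symDeg hf p

theorem iterate_delta_mem_symDeg {p : ℕ} (hp : p.Prime) {d : ℕ} {f : symFun ℤ}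
    (hf : f ∈ symDeg ℤ d) (k : ℕ) : (adamsLift hp).δ^[k] f ∈ symDeg ℤ (p ^ k * d) := by
  induction k with
  | zero => simpa using hf
  | succ k ih =>
    rw [Function.iterate_succ_apply', pow_succ', mul_assoc]
    exact delta_mem_symDeg hp ih

/-- The inclusion `toComplex` as a ring homomorphism. -/
def toComplexHom : symFun ℤ →+* symFun ℂ :=
  { toComplex with
    map_one' := Subtype.ext (map_one (MvPowerSeries.map (Int.castRingHom ℂ)))
    map_mul' := fun f g => Subtype.ext (map_mul (MvPowerSeries.map (Int.castRingHom ℂ)) f.1 g.1) }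

theorem toComplexHom_apply (f : symFun ℤ) : toComplexHom f = toComplex f := rfl

theorem cf_toComplex (m : ℕ →₀ ℕ) (f : symFun ℤ) : cf m (toComplex f) = ((cf m f : ℤ) : ℂ) :=
  MvPowerSeries.coeff_map (Int.castRingHom ℂ) m f.1

theorem toComplex_mem_symDeg {d : ℕ} {f : symFun ℤ} (hf : f ∈ symDeg ℤ d) :
    toComplex f ∈ symDeg ℂ d := by
  intro m hm
  refine hf m fun h => hm ?_
  change cf m (toComplex f) = 0
  rw [cf_toComplex, cf_apply, h, Int.cast_zero]

theorem toComplex_hsym (n : ℕ) : toComplex (hsym ℤ n) = hsym ℂ n := by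
  apply ext_cf
  intro m
  rw [cf_toComplex, cf_hsym, cf_hsym]
  split_ifs <;> simp

theorem toComplex_psum (n : ℕ) : toComplex (psum ℤ n) = psum ℂ n := by
  classical
  apply ext_cf
  intro m
  have e : cf m (psum ℤ n) = if ∃ i, m = Finsupp.single i n then 1 else 0 :=
    coeff_psumSeries ℤ n m
  have e' : cf m (psum ℂ n) = if ∃ i, m = Finsupp.single i n then 1 else 0 :=
    coeff_psumSeries ℂ n m
  rw [cf_toComplex, e, e']
  split_ifs <;> simp

theorem toComplex_hprod (b : ℕ →₀ ℕ) : toComplex (hprod ℤ b) = hprod ℂ b := by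
  rw [← toComplexHom_apply, hprod, hprod, Finsupp.prod, Finsupp.prod, map_prod]
  exact Finset.prod_congr rfl fun i _ => toComplex_hsym _

theorem toComplex_theta (s : ℕ) [NeZero s] (f : symFun ℤ) :
    toComplex (theta ℤ s f) = theta ℂ s (toComplex f) :=
  Subtype.ext (MvPowerSeries.rename_map (fun i : ℕ => i / s) (Int.castRingHom ℂ) f.1).symm

end Rename

/-! ### Generators are detected by the pairing with `p_m` -/

section Indecomposable

/-- The Hall pairing with `p_m`; on the component of degree `m` it is the multiplicity of `h_m`
modulo decomposable elements. -/
def lin (m : ℕ) : symFun ℤ →+ ℂ :=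
  ((cf 0).toAddMonoidHom.comp (pderiv ℂ m : symFun ℂ →ₗ[ℂ] symFun ℂ).toAddMonoidHom).comp toComplex

theorem lin_apply (m : ℕ) (f : symFun ℤ) : lin m f = cf 0 (pderiv ℂ m (toComplex f)) := rfl

theorem lin_mul (m : ℕ) (f g : symFun ℤ) :
    lin m (f * g) = ((cf 0 f : ℤ) : ℂ) * lin m g + ((cf 0 g : ℤ) : ℂ) * lin m f := by
  rw [lin_apply, lin_apply, lin_apply, ← toComplexHom_apply, map_mul, toComplexHom_apply,
    toComplexHom_apply, Derivation.leibniz, map_add, smul_eq_mul, smul_eq_mul, cf_zero_mul,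
    cf_zero_mul, cf_toComplex, cf_toComplex]

theorem lin_mul_eq_zero (m : ℕ) {f g : symFun ℤ} (hf : cf 0 f = 0) (hg : cf 0 g = 0) :
    lin m (f * g) = 0 := by
  rw [lin_mul, hf, hg, Int.cast_zero, zero_mul, zero_mul, add_zero]

theorem lin_eq_zero {m d : ℕ} (h : d ≠ m) {f : symFun ℤ} (hf : f ∈ symDeg ℤ d) : lin m f = 0 :=
  cf_zero_pderiv h (toComplex_mem_symDeg hf)

theorem lin_natCast_mul (m k : ℕ) (f : symFun ℤ) : lin m (k * f) = k * lin m f := by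
  rw [← nsmul_eq_mul, map_nsmul, nsmul_eq_mul]

theorem lin_intCast_mul (m : ℕ) (k : ℤ) (f : symFun ℤ) : lin m (k * f) = k * lin m f := by
  rw [← zsmul_eq_mul, map_zsmul, zsmul_eq_mul]

theorem lin_hsym {m : ℕ} (hm : 0 < m) : lin m (hsym ℤ m) = 1 := by
  classical
  rw [lin_apply, toComplex_hsym, pderiv_hsym hm, if_pos le_rfl, Nat.sub_self, hsym_zero, cf_one,
    if_pos rfl]

theorem lin_psum {m : ℕ} (hm : 0 < m) : lin m (psum ℤ m) = m := by
  classical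
  rw [lin_apply, toComplex_psum, pderiv_psum m hm, if_pos rfl, ← mul_one (m : symFun ℂ),
    ← nsmul_eq_mul, map_nsmul, cf_one, if_pos rfl, nsmul_eq_mul, mul_one]

theorem lowerRing_induction {y : ℕ → symFun ℤ} {m : ℕ} (S : Subring (symFun ℤ)) (p : ℕ)
    (h1 : ∀ j, 1 ≤ j → j < m → y j ∈ S) (h2 : ∀ a, (p : symFun ℤ) * a ∈ S) :
    lowerRing p y m ≤ S := by
  rw [lowerRing, Subring.closure_le]
  rintro _ (⟨j, hj, rfl⟩ | ⟨a, rfl⟩)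
  · exact h1 j hj.1 hj.2
  · exact h2 a

/-- The elements on which the pairing with `p_m` vanishes after applying `ψ`, as a ring. -/
theorem lin_eq_zero_of_mem_lowerRing {ψ : symFun ℤ →+* symFun ℤ} {q : ℕ} (hq : 0 < q)
    (hψ : ∀ d, ∀ f ∈ symDeg ℤ d, ψ f ∈ symDeg ℤ (q * d)) {m : ℕ} {f : symFun ℤ}
    (hf : f ∈ lowerRing 0 (hsym ℤ) m) : lin (q * m) (ψ f) = 0 := by
  let S : Subring (symFun ℤ) :=
    { carrier := {f | lin (q * m) (ψ f) = 0}
      mul_mem' := by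
        intro a b ha hb
        rw [Set.mem_ofPred_eq] at *
        rw [map_mul, lin_mul, ha, hb, mul_zero, mul_zero, add_zero]
      one_mem' := by
        rw [Set.mem_ofPred_eq, map_one, lin_apply, ← toComplexHom_apply, map_one,
          Derivation.map_one_eq_zero, map_zero]
      add_mem' := by
        intro a b ha hb
        rw [Set.mem_ofPred_eq] at *
        rw [map_add, map_add, ha, hb, add_zero]
      zero_mem' := by
        rw [Set.mem_ofPred_eq, map_zero, map_zero]
      neg_mem' := by
        intro a ha
        rw [Set.mem_ofPred_eq] at *
        rw [map_neg, map_neg, ha, neg_zero] }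
  refine lowerRing_induction S 0 (fun j h1 h2 => ?_) (fun a => ?_) hf
  · exact lin_eq_zero (fun e => h2.ne (Nat.eq_of_mul_eq_mul_left hq e))
      (hψ j _ (hsym_mem_symDeg j))
  · rw [Nat.cast_zero, zero_mul]
    exact zero_mem S

instance : Nontrivial (symFun ℤ) :=
  ⟨0, 1, fun h => by
    classical
    have := congrArg (cf 0) h
    rw [map_zero, cf_one, if_pos rfl] at this
    exact zero_ne_one this⟩

/-- A product of powers of `h_j` of degree `m` that involves `h_m` is `h_m` itself. The modulus is
`0` here, so `lowerRing 0` is the plain subring generated by the `h_j` with `j < m`. -/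
theorem exists_sub_smul_hsym_mem {m : ℕ} (hm : 0 < m) {f : symFun ℤ} (hf : f ∈ symDeg ℤ m) :
    ∃ c : ℤ, f - c * hsym ℤ m ∈ lowerRing 0 (hsym ℤ) m := by
  have h1 := lowerRing_le_prodSpan 0 (T := fun m e => hsym ℤ m ^ e)
    (fun m e => isMonicIn_pow (lowerRing 0 (hsym ℤ) m) (hsym ℤ m) e) m (mem_lowerRing_hsym 0 hf)
  have h2 := mem_closure_of_mem_prodSpan (T := fun m e => hsym ℤ m ^ e)
    (fun m e => pow_mem_symDeg (hsym_mem_symDeg m) e) hf h1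
  refine AddSubgroup.closure_induction
    (p := fun f _ => ∃ c : ℤ, f - c * hsym ℤ m ∈ lowerRing 0 (hsym ℤ) m) ?_ ?_ ?_ ?_ h2
  · rintro _ (⟨ν, hν, rfl⟩ | ⟨a, _, rfl⟩)
    · have hmem : m ∈ Finset.Icc 1 m := Finset.mem_Icc.2 ⟨hm, le_rfl⟩
      have hlow : ∀ j ∈ (Finset.Icc 1 m).erase m, hsym ℤ j ^ ν j ∈ lowerRing 0 (hsym ℤ) m := by
        intro j hj
        rw [Finset.mem_erase, Finset.mem_Icc] at hj
        exact pow_mem (mem_lowerRing hj.2.1 (by omega)) _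
      rw [← Finset.mul_prod_erase _ _ hmem]
      rw [← Finset.add_sum_erase _ _ hmem] at hν
      by_cases h0 : ν m = 0
      · refine ⟨0, ?_⟩
        rw [h0, pow_zero, one_mul, Int.cast_zero, zero_mul, sub_zero]
        exact prod_mem hlow
      · have h3 : ν m = 1 := by
          by_contra hne
          have : m * 2 ≤ m * ν m := Nat.mul_le_mul_left m (by omega)
          omega
        refine ⟨1, ?_⟩
        rw [h3, mul_one] at hν
        have h4 : ∑ j ∈ (Finset.Icc 1 m).erase m, j * ν j = 0 := by omega
        rw [Finset.sum_eq_zero_iff] at h4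
        rw [h3, Finset.prod_eq_one, pow_one, mul_one, Int.cast_one, one_mul, sub_self]
        · exact zero_mem _
        · intro j hj
          have h5 := h4 j hj
          rw [Finset.mem_erase, Finset.mem_Icc] at hj
          rcases Nat.mul_eq_zero.1 h5 with h | h
          · omega
          · rw [h, pow_zero]
    · refine ⟨0, ?_⟩
      rw [Nat.cast_zero, zero_mul, Int.cast_zero, zero_mul, sub_zero]
      exact zero_mem _
  · exact ⟨0, by rw [Int.cast_zero, zero_mul, sub_zero]; exact zero_mem _⟩
  · rintro a b _ _ ⟨c, hc⟩ ⟨c', hc'⟩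
    refine ⟨c + c', ?_⟩
    rw [Int.cast_add, add_mul, add_sub_add_comm]
    exact add_mem hc hc'
  · rintro a _ ⟨c, hc⟩
    refine ⟨-c, ?_⟩
    have e : -a - ((-c : ℤ) : symFun ℤ) * hsym ℤ m = -(a - c * hsym ℤ m) := by
      push_cast
      ring
    rw [e]
    exact neg_mem hc

theorem lin_eq_of_sub_mem {m : ℕ} (hm : 0 < m) {f : symFun ℤ} {c : ℤ}
    (h : f - c * hsym ℤ m ∈ lowerRing 0 (hsym ℤ) m) : lin m f = c := by
  have h1 := lin_eq_zero_of_mem_lowerRing (ψ := RingHom.id _) one_pos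
    (fun d f hf => by rw [one_mul]; exact hf) h
  rw [one_mul, RingHom.id_apply, map_sub, lin_intCast_mul, lin_hsym hm, mul_one,
    sub_eq_zero] at h1
  exact h1

/-- Applying `ψ` to Newton's identity leaves, up to decomposable elements, `m ψ(h_m) ≡ c p_{qm}`,
whose pairing is `c q m`. A general `f` is a multiple of `h_m` plus decomposable elements. -/
theorem lin_map {ψ : symFun ℤ →+* symFun ℤ} {q : ℕ} (hq : 0 < q)
    (hψ : ∀ d, ∀ f ∈ symDeg ℤ d, ψ f ∈ symDeg ℤ (q * d)) {m : ℕ} (hm : 0 < m) {c : ℕ}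
    (hc : ψ (psum ℤ m) = c * psum ℤ (q * m)) {f : symFun ℤ} (hf : f ∈ symDeg ℤ m) :
    lin (q * m) (ψ f) = c * q * lin m f := by
  have key : lin (q * m) (ψ (hsym ℤ m)) = c * q := by
    have h := congrArg (lin (q * m)) (congrArg ψ (newton (R := ℤ) m))
    have hmem : m ∈ Finset.Icc 1 m := Finset.mem_Icc.2 ⟨hm, le_rfl⟩
    rw [map_mul, map_natCast, lin_natCast_mul, map_sum, map_sum, Finset.sum_eq_single_of_mem m hmem,
      Nat.sub_self, hsym_zero, mul_one, hc, lin_natCast_mul, lin_psum (Nat.mul_pos hq hm)] at h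
    · refine mul_left_cancel₀ (Nat.cast_ne_zero.2 hm.ne') (h.trans ?_)
      push_cast
      ring
    · intro j hj hne
      rw [Finset.mem_Icc] at hj
      rw [map_mul]
      apply lin_mul_eq_zero
      · exact cf_zero_eq_zero (Nat.mul_pos hq hj.1).ne' (hψ j _ (psum_mem_symDeg j))
      · exact cf_zero_eq_zero (Nat.mul_pos hq (by omega : 0 < m - j)).ne'
          (hψ _ _ (hsym_mem_symDeg _))
  obtain ⟨k, hk⟩ := exists_sub_smul_hsym_mem hm hf
  have h1 := lin_eq_zero_of_mem_lowerRing hq hψ hk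
  rw [map_sub, map_sub, map_mul, map_intCast, lin_intCast_mul, key, sub_eq_zero] at h1
  rw [h1, lin_eq_of_sub_mem hm hk, mul_comm]

/-- `y_m` is `c h_m` plus a polynomial in the earlier `h_j`, and `c` is invertible modulo `p`; so
`h_m` is recovered by induction on `m`. -/
theorem mem_lowerRing_of_lin {p : ℕ} {y : ℕ → symFun ℤ} (hy : ∀ m, 0 < m → y m ∈ symDeg ℤ m)
    (hL : ∀ m, 0 < m → ∃ c : ℕ, c.Coprime p ∧ lin m (y m) = c) {d : ℕ} {f : symFun ℤ}
    (hf : f ∈ symDeg ℤ d) : f ∈ lowerRing p y (d + 1) := by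
  have key : ∀ m, 0 < m → hsym ℤ m ∈ lowerRing p y (m + 1) := by
    intro m
    induction m using Nat.strong_induction_on with
    | _ m ih =>
      intro hm
      obtain ⟨c, hc, hcL⟩ := hL m hm
      obtain ⟨k, hk⟩ := exists_sub_smul_hsym_mem hm (hy m hm)
      have hck : k = c := by
        have := (lin_eq_of_sub_mem hm hk).symm.trans hcL
        exact_mod_cast this
      subst hck
      have h1 : y m - ((c : ℤ) : symFun ℤ) * hsym ℤ m ∈ lowerRing p y (m + 1) := by
        refine lowerRing_induction (lowerRing p y (m + 1)) 0 (fun j h1 h2 => ?_) (fun a => ?_) hk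
        · exact lowerRing_mono p y (by omega) (ih j h2 h1)
        · rw [Nat.cast_zero, zero_mul]
          exact zero_mem _
      -- Bézout: `h_m = a (c h_m) + p (b h_m)`.
      obtain ⟨a, b, hab⟩ := Nat.isCoprime_iff_coprime.2 hc
      have h2 : hsym ℤ m = (a : symFun ℤ) * (y m - (y m - ((c : ℤ) : symFun ℤ) * hsym ℤ m)) +
          (p : symFun ℤ) * (b * hsym ℤ m) := by
        have h3 := congrArg (Int.cast : ℤ → symFun ℤ) hab
        push_cast at h3 ⊢
        linear_combination (-hsym ℤ m) * h3
      rw [h2]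
      exact add_mem (mul_mem (intCast_mem _ _) (sub_mem (mem_lowerRing hm (Nat.lt_succ_self m)) h1))
        (mul_mem_lowerRing p y _ _)
  refine lowerRing_induction (lowerRing p y (d + 1)) 0 (fun j h1 h2 => ?_) (fun a => ?_)
    (mem_lowerRing_hsym 0 hf)
  · exact lowerRing_mono p y (by omega) (key j h1)
  · rw [Nat.cast_zero, zero_mul]
    exact zero_mem _

/-- A homogeneous element is `θ`-divisible up to a power of `p`. -/
theorem exists_theta_eq (p r d : ℕ) [NeZero (p ^ r)] {f : symFun ℤ} (hf : f ∈ symDeg ℤ d) :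
    ∃ (K : ℕ), ∃ g ∈ symDeg ℤ d, theta ℤ (p ^ r) g = (p : symFun ℤ) ^ K * f := by
  let S : Subring (symFun ℤ) :=
    { carrier := {f | ∃ (K : ℕ) (g : symFun ℤ), theta ℤ (p ^ r) g = (p : symFun ℤ) ^ K * f}
      mul_mem' := by
        rintro a b ⟨K, g, h⟩ ⟨K', g', h'⟩
        exact ⟨K + K', g * g', by rw [map_mul, h, h']; ring⟩
      one_mem' := ⟨0, 1, by simp⟩
      add_mem' := by
        rintro a b ⟨K, g, h⟩ ⟨K', g', h'⟩
        refine ⟨K + K', (p : symFun ℤ) ^ K' * g + (p : symFun ℤ) ^ K * g', ?_⟩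
        rw [map_add, map_mul, map_mul, map_pow, map_pow, map_natCast, h, h']
        ring
      zero_mem' := ⟨0, 0, by simp⟩
      neg_mem' := by
        rintro a ⟨K, g, h⟩
        exact ⟨K, -g, by rw [map_neg, h]; ring⟩ }
  have h0 : ∀ a : symFun ℤ, ((0 : ℕ) : symFun ℤ) * a ∈ S := fun a => by
    rw [Nat.cast_zero, zero_mul]
    exact zero_mem S
  have hS : ∀ m, 0 < m → hsym ℤ m ∈ S := by
    intro m
    induction m using Nat.strong_induction_on with
    | _ m ih =>
      intro hm
      have hθ : ∀ d, ∀ f ∈ symDeg ℤ d, (theta ℤ (p ^ r)).toRingHom f ∈ symDeg ℤ (1 * d) := by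
        intro d f hf
        rw [one_mul]
        exact theta_mem_symDeg _ hf
      have h1 := theta_mem_symDeg (p ^ r) (hsym_mem_symDeg (R := ℤ) m)
      obtain ⟨c, hc⟩ := exists_sub_smul_hsym_mem hm h1
      have h2 := lin_map one_pos hθ hm (c := p ^ r) (by
        rw [one_mul]
        exact theta_psum (p ^ r) hm.ne') (hsym_mem_symDeg m)
      have h3 := lin_eq_of_sub_mem hm hc
      rw [one_mul, lin_hsym hm, Nat.cast_one, mul_one, mul_one] at h2
      have h4 : c = (p ^ r : ℕ) := by
        have := h3.symm.trans h2
        exact_mod_cast this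
      subst h4
      obtain ⟨K, g, hg⟩ := lowerRing_induction S 0 (fun j h1 h2 => ih j h2 h1) h0 hc
      -- `θ h_m = p ^ r h_m` plus decomposable elements, and `g` maps to `p ^ K` times the latter by
      -- induction.
      refine ⟨K + r, (p : symFun ℤ) ^ K * hsym ℤ m - g, ?_⟩
      rw [map_sub, hg, map_mul, map_pow, map_natCast]
      push_cast
      ring
  obtain ⟨K, g, hg⟩ := lowerRing_induction S 0 (fun j h1 _ => hS j h1) h0 (mem_lowerRing_hsym 0 hf)
  -- `θ` preserves degrees, so the preimage may be replaced by its component of degree `d`.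
  refine ⟨K, proj d g, proj_mem d g, ?_⟩
  obtain ⟨N, hN⟩ := g.2.2
  have h5 : theta ℤ (p ^ r) (proj d g) = proj d (theta ℤ (p ^ r) g) := by
    conv_rhs => rw [← sum_proj (N := max N d) (f := g) fun m hm =>
      (hN m hm).trans (le_max_left _ _), map_sum, map_sum]
    rw [Finset.sum_eq_single_of_mem d (Finset.mem_range.2 (by omega)) fun e _ he => by
      rw [proj_eq (theta_mem_symDeg _ (proj_mem e g)), if_neg he]]
    rw [proj_self (theta_mem_symDeg _ (proj_mem d g))]
  rw [h5, hg, ← Nat.cast_pow]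
  exact proj_self (natCast_mul_mem_symDeg _ hf)

end Indecomposable

/-! ### The source and target families of degree `d` -/

section Families

variable {p : ℕ} (hp : p.Prime)

/-- The generators `δ^k p_n` of degree `p ^ k n`, where `n` is prime to `p`. -/
def gen (m : ℕ) : symFun ℤ :=
  (adamsLift hp).δ^[m.factorization p] (psum ℤ (m / p ^ m.factorization p))

theorem factorization_pow_mul {p : ℕ} (hp : p.Prime) {n : ℕ} (hn : n.Coprime p) (k : ℕ) :
    (p ^ k * n).factorization p = k := by
  have hn' : ¬p ∣ n := (Nat.Prime.coprime_iff_not_dvd hp).1 hn.symm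
  have h0 : n ≠ 0 := fun h => hn' (h ▸ dvd_zero p)
  rw [Nat.factorization_mul (pow_ne_zero _ hp.ne_zero) h0, Finsupp.add_apply,
    hp.factorization_pow, Finsupp.single_eq_same, Nat.factorization_eq_zero_of_not_dvd hn',
    add_zero]

theorem gen_pow_mul {n : ℕ} (hn : n.Coprime p) (k : ℕ) :
    gen hp (p ^ k * n) = (adamsLift hp).δ^[k] (psum ℤ n) := by
  rw [gen, factorization_pow_mul hp hn, Nat.mul_div_cancel_left _ (pow_pos hp.pos k)]

theorem gen_mem_symDeg (m : ℕ) : gen hp m ∈ symDeg ℤ m := by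
  have h := iterate_delta_mem_symDeg hp
    (psum_mem_symDeg (R := ℤ) (m / p ^ m.factorization p)) (m.factorization p)
  rwa [Nat.ordProj_mul_ordCompl_eq_self] at h

/-- Passing from `f` to `φ f` multiplies the pairing by `p`. In `φ f = f ^ p + p δ f` the first term
is decomposable, so division by `p` leaves the pairing unchanged. -/
theorem lin_delta {m : ℕ} (hm : 0 < m) {f : symFun ℤ} (hf : f ∈ symDeg ℤ m) :
    lin (p * m) ((adamsLift hp).δ f) = lin m f := by
  have h1 := lin_map (ψ := (adams ℤ hp.ne_zero).toRingHom) (q := p) (c := 1) hp.pos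
    (fun d f hf => adams_mem_symDeg hp.ne_zero hf) hm
    (by rw [Nat.cast_one, one_mul]; exact adams_psum hp.ne_zero m) hf
  have h2 : (adams ℤ hp.ne_zero).toRingHom f = f ^ p + p * (adamsLift hp).δ f :=
    (adamsLift hp).spec f
  obtain ⟨q, hq⟩ := Nat.exists_eq_succ_of_ne_zero (Nat.sub_pos_of_lt hp.one_lt).ne'
  have h3 : lin (p * m) (f ^ p) = 0 := by
    have e : p = q + 1 + 1 := by have := hp.one_lt; omega
    have hf0 := cf_zero_eq_zero hm.ne' hf
    nth_rewrite 2 [e]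
    rw [pow_succ']
    refine lin_mul_eq_zero _ hf0 ?_
    rw [pow_succ', cf_zero_mul, hf0, zero_mul]
  rw [h2, map_add, h3, zero_add, lin_natCast_mul, Nat.cast_one, one_mul] at h1
  exact mul_left_cancel₀ (Nat.cast_ne_zero.2 hp.ne_zero) h1

theorem lin_gen {m : ℕ} (hm : 0 < m) : ∃ c : ℕ, c.Coprime p ∧ lin m (gen hp m) = c := by
  obtain ⟨n, hn, k, -, rfl⟩ := exists_eq_pow_mul hp (Finset.mem_Icc.2 ⟨hm, le_rfl⟩)
  rw [coprimes, Finset.mem_filter, Finset.mem_Icc] at hn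
  -- The pairing of `δ^k p_n` equals that of `p_n`, which is `n`.
  refine ⟨n, hn.2, ?_⟩
  rw [gen_pow_mul hp hn.2]
  clear hm
  have hn0 : 0 < n := hn.1.1
  clear hn
  induction k with
  | zero =>
    rw [pow_zero, one_mul]
    exact lin_psum hn0
  | succ k ih =>
    rw [Function.iterate_succ_apply', pow_succ', mul_assoc, lin_delta hp
      (Nat.mul_pos (pow_pos hp.pos k) hn0) (iterate_delta_mem_symDeg hp (psum_mem_symDeg n) k), ih]

theorem mem_lowerRing_gen {d : ℕ} {f : symFun ℤ} (hf : f ∈ symDeg ℤ d) :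
    f ∈ lowerRing p (gen hp) (d + 1) :=
  mem_lowerRing_of_lin (fun m _ => gen_mem_symDeg hp m) (fun _ hm => lin_gen hp hm) hf

theorem symDeg_of_eq {R : Type*} [CommRing R] {d e : ℕ} {f : symFun R} (hf : f ∈ symDeg R d)
    (h : d = e) : f ∈ symDeg R e := h ▸ hf

theorem tgt_mem_symDeg (r : ℕ) {n : ℕ} {x : symFun ℤ} (hx : x ∈ symDeg ℤ n) (i : ℕ) :
    (adamsLift hp).tgt r x i ∈ symDeg ℤ (p ^ i * n) := by
  induction i with
  | zero => exact symDeg_of_eq hx (by rw [pow_zero, one_mul])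
  | succ i ih =>
    rw [FrobLift.tgt, pow_succ', mul_assoc, ← Nat.cast_pow]
    exact Submodule.sub_mem _ (adams_mem_symDeg hp.ne_zero ih) (natCast_mul_mem_symDeg _
      (symDeg_of_eq (pow_mem_symDeg ih p) (mul_comm _ _)))

theorem src_mem_symDeg (e : ℕ) {n : ℕ} {g : symFun ℤ} (hg : g ∈ symDeg ℤ n) (k : ℕ) :
    (adamsLift hp).src e g k ∈ symDeg ℤ (p ^ k * n) := by
  induction k with
  | zero => exact symDeg_of_eq hg (by rw [pow_zero, one_mul])
  | succ k ih =>
    rw [FrobLift.src, pow_succ', mul_assoc, ← Nat.cast_pow]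
    exact Submodule.sub_mem _ (natCast_mul_mem_symDeg _ (adams_mem_symDeg hp.ne_zero ih))
      (symDeg_of_eq (pow_mem_symDeg ih p) (mul_comm _ _))

theorem prod_pow_digit_mem_symDeg {L n c : ℕ} (hc : c < p ^ L) {f : ℕ → symFun ℤ}
    (hf : ∀ k, f k ∈ symDeg ℤ (p ^ k * n)) :
    ∏ k ∈ Finset.range L, f k ^ digit p k c ∈ symDeg ℤ (n * c) := by
  refine symDeg_of_eq (prod_mem_symDeg _ fun k _ => pow_mem_symDeg (hf k) _) ?_
  nth_rewrite 2 [← sum_digit hc]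
  rw [Finset.mul_sum]
  exact Finset.sum_congr rfl fun k _ => by ring

theorem srcElt_mem_symDeg (r i : ℕ) {L n c : ℕ} (hc : c < p ^ L) {x : symFun ℤ}
    (hx : x ∈ symDeg ℤ n) : (adamsLift hp).srcElt r L i c x ∈ symDeg ℤ (p ^ i * n * c) := by
  rw [FrobLift.srcElt]
  split_ifs
  · exact prod_pow_digit_mem_symDeg hc
      fun k => src_mem_symDeg hp _ (iterate_delta_mem_symDeg hp hx i) k
  · exact pow_mem_symDeg (iterate_delta_mem_symDeg hp hx i) c

theorem tgtElt_mem_symDeg (r i : ℕ) {L n c : ℕ} (hc : c < p ^ L) {x : symFun ℤ}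
    (hx : x ∈ symDeg ℤ n) : (adamsLift hp).tgtElt r L i c x ∈ symDeg ℤ (p ^ i * n * c) := by
  rw [FrobLift.tgtElt]
  split_ifs with h
  · exact prod_pow_digit_mem_symDeg hc
      fun k => iterate_delta_mem_symDeg hp (tgt_mem_symDeg hp r hx i) k
  · refine symDeg_of_eq (pow_mem_symDeg
      (iterate_delta_mem_symDeg hp (tgt_mem_symDeg hp r hx r) (i - r)) c) ?_
    rw [← mul_assoc, ← pow_add, Nat.sub_add_cancel (by omega)]

theorem monElt_mem_symDeg (r k e : ℕ) {n : ℕ} {x : symFun ℤ} (hx : x ∈ symDeg ℤ n) :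
    (adamsLift hp).monElt r k e x ∈ symDeg ℤ (p ^ k * n * e) := by
  rw [FrobLift.monElt]
  refine symDeg_of_eq (mul_mem_symDeg (prod_mem_symDeg _ fun i _ => pow_mem_symDeg
    (iterate_delta_mem_symDeg hp (tgt_mem_symDeg hp r hx i) k) _)
    (pow_mem_symDeg (iterate_delta_mem_symDeg hp (tgt_mem_symDeg hp r hx r) k) _)) ?_
  conv_rhs => rw [← sum_digit_add p r e, mul_add, Finset.mul_sum]
  congr 1
  · exact Finset.sum_congr rfl fun i _ => by ring
  · ring

theorem sum_mul_count {d : ℕ} (μ : d.Partition) :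
    ∑ m ∈ Finset.Icc 1 d, m * μ.parts.count m = d := by
  conv_rhs => rw [← μ.parts_sum, Finset.sum_multiset_count]
  symm
  refine Finset.sum_subset_zero_on_sdiff (fun m hm => ?_) (fun m hm => ?_)
    (fun m _ => by rw [smul_eq_mul, mul_comm])
  · rw [Multiset.mem_toFinset] at hm
    exact Finset.mem_Icc.2 ⟨μ.parts_pos hm, Nat.Partition.le_of_mem_parts hm⟩
  · rw [Finset.mem_sdiff, Multiset.mem_toFinset] at hm
    rw [Multiset.count_eq_zero_of_notMem hm.2, mul_zero]

theorem count_eq_zero {d m : ℕ} (μ : d.Partition) (h : d < m) : μ.parts.count m = 0 := by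
  rw [Multiset.count_eq_zero]
  intro hm
  exact absurd (Nat.Partition.le_of_mem_parts hm) (by omega)

theorem count_lt {p : ℕ} (hp : p.Prime) {d m : ℕ} (μ : d.Partition) (hm : 0 < m) :
    μ.parts.count m < p ^ (d + 1) := by
  refine lt_of_le_of_lt ?_ (Nat.lt_pow_self hp.one_lt)
  by_cases h : d < m
  · rw [count_eq_zero μ h]
    exact Nat.zero_le _
  · have h1 := Finset.single_le_sum (f := fun m => m * μ.parts.count m) (fun _ _ => Nat.zero_le _)
      (Finset.mem_Icc.2 ⟨hm, not_lt.1 h⟩)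
    simp only [sum_mul_count] at h1
    exact (Nat.le_mul_of_pos_left _ hm).trans (h1.trans d.le_succ)

theorem sum_coprimes_count {p : ℕ} (hp : p.Prime) {d K : ℕ} (hK : d < K) (μ : d.Partition) :
    ∑ n ∈ coprimes p d, ∑ i ∈ Finset.range K, p ^ i * n * μ.parts.count (p ^ i * n) = d := by
  conv_rhs => rw [← sum_mul_count μ]
  rw [sum_Icc_eq hp hK]
  intro m hm
  rw [count_eq_zero μ hm, mul_zero]

theorem pos_of_mem_coprimes {p d n : ℕ} (h : n ∈ coprimes p d) : 0 < n := by
  rw [coprimes, Finset.mem_filter, Finset.mem_Icc] at h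
  exact h.1.1

theorem coprime_of_mem_coprimes {p d n : ℕ} (h : n ∈ coprimes p d) : n.Coprime p := by
  rw [coprimes, Finset.mem_filter] at h
  exact h.2

/-- A family of symmetric functions that spans modulo `p`, whose members `θ` maps to multiples of
the members of `tgtFam`. -/
def srcFam (r : ℕ) {d : ℕ} (μ : d.Partition) : symDeg ℤ d :=
  -- Multiplicities are at most `d < p ^ (d + 1)`, so `d + 1` digits suffice; the range `r + (d +
  -- 1)` covers every `p ^ i n ≤ d` and is the one produced by transposing digits.
  ⟨∏ n ∈ coprimes p d, ∏ i ∈ Finset.range (r + (d + 1)),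
    (adamsLift hp).srcElt r (d + 1) i (μ.parts.count (p ^ i * n)) (psum ℤ n),
    symDeg_of_eq (prod_mem_symDeg _ fun n hn => prod_mem_symDeg _ fun i _ =>
      srcElt_mem_symDeg hp r i (count_lt hp μ (Nat.mul_pos (pow_pos hp.pos i)
        (pos_of_mem_coprimes hn))) (psum_mem_symDeg n)) (sum_coprimes_count hp (by omega) μ)⟩

/-- See `srcFam`. -/
def tgtFam (r : ℕ) {d : ℕ} (μ : d.Partition) : symDeg ℤ d :=
  ⟨∏ n ∈ coprimes p d, ∏ i ∈ Finset.range (r + (d + 1)),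
    (adamsLift hp).tgtElt r (d + 1) i (μ.parts.count (p ^ i * n)) (psum ℤ n),
    symDeg_of_eq (prod_mem_symDeg _ fun n hn => prod_mem_symDeg _ fun i _ =>
      tgtElt_mem_symDeg hp r i (count_lt hp μ (Nat.mul_pos (pow_pos hp.pos i)
        (pos_of_mem_coprimes hn))) (psum_mem_symDeg n)) (sum_coprimes_count hp (by omega) μ)⟩

/-- The exponent of `p` in `divisorD`. -/
def expD (p r : ℕ) {d : ℕ} (μ : d.Partition) : ℕ :=
  ∑ n ∈ coprimes p d, ∑ i ∈ Finset.range r,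
    ((r - i) * μ.parts.count (p ^ i * n) + dp p (μ.parts.count (p ^ i * n)))

theorem divisorD_eq (p r : ℕ) {d : ℕ} (μ : d.Partition) : divisorD p r μ = p ^ expD p r μ := by
  rw [divisorD, expD, ← Finset.prod_pow_eq_pow_sum]
  exact Finset.prod_congr rfl fun n _ => Finset.prod_pow_eq_pow_sum _ _ _

theorem theta_srcFam (r : ℕ) [NeZero (p ^ r)] {d : ℕ} (μ : d.Partition) :
    theta ℤ (p ^ r) (srcFam hp r μ).1 = (p : symFun ℤ) ^ expD p r μ * (tgtFam hp r μ).1 := by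
  change theta ℤ (p ^ r) (∏ n ∈ coprimes p d, _) = _ * ∏ n ∈ coprimes p d, _
  rw [expD, ← Finset.prod_pow_eq_pow_sum, ← Finset.prod_mul_distrib, map_prod]
  refine Finset.prod_congr rfl fun n hn => ?_
  have h0 := pos_of_mem_coprimes hn
  rw [map_prod, ← Finset.prod_pow_eq_pow_sum]
  have h1 : ∀ i ∈ Finset.range (r + (d + 1)),
      theta ℤ (p ^ r) ((adamsLift hp).srcElt r (d + 1) i (μ.parts.count (p ^ i * n)) (psum ℤ n)) =
      (p : symFun ℤ) ^ (if i < r then (r - i) * μ.parts.count (p ^ i * n) +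
        dp p (μ.parts.count (p ^ i * n)) else 0) *
      (adamsLift hp).tgtElt r (d + 1) i (μ.parts.count (p ^ i * n)) (psum ℤ n) := fun i _ =>
    (adamsLift hp).map_srcElt (θ := (theta ℤ (p ^ r)).toRingHom)
      (fun a => theta_adams hp.ne_zero (p ^ r) a) hp
      (by rw [← Nat.cast_pow]; exact theta_psum (p ^ r) h0.ne')
      (count_lt hp μ (Nat.mul_pos (pow_pos hp.pos i) h0)) i
  rw [Finset.prod_congr rfl h1, Finset.prod_mul_distrib]
  congr 1
  rw [Finset.prod_range_add]
  conv_rhs => rw [← mul_one (∏ i ∈ Finset.range r, _)]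
  congr 1
  · exact Finset.prod_congr rfl fun i hi => by rw [if_pos (Finset.mem_range.1 hi)]
  · exact Finset.prod_eq_one fun i _ => by rw [if_neg (by omega), pow_zero]

theorem spansMod_of_closure {d : ℕ} {ι : Type*} [Fintype ι] {t : ι → symDeg ℤ d}
    {Z : Set (symFun ℤ)} (hcl : ∀ f ∈ symDeg ℤ d, f ∈ AddSubgroup.closure
      (Z ∪ {g | ∃ a ∈ symDeg ℤ d, g = (p : symFun ℤ) * a}))
    (hZ : ∀ z ∈ Z, ∃ (i : ι) (ε : ℤ), ∃ a ∈ symDeg ℤ d, z = ε * (t i).1 + (p : symFun ℤ) * a) :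
    SpansMod p t := by
  classical
  intro x
  have h : ∃ (c : ι → ℤ), ∃ a ∈ symDeg ℤ d,
      x.1 = ∑ i, (c i : symFun ℤ) * (t i).1 + (p : symFun ℤ) * a := by
    refine AddSubgroup.closure_induction (p := fun x _ => ∃ (c : ι → ℤ), ∃ a ∈ symDeg ℤ d,
      x = ∑ i, (c i : symFun ℤ) * (t i).1 + (p : symFun ℤ) * a) ?_ ?_ ?_ ?_ (hcl x.1 x.2)
    · rintro z (hz | ⟨a, ha, rfl⟩)
      · obtain ⟨i, ε, a, ha, rfl⟩ := hZ z hz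
        refine ⟨Pi.single i ε, a, ha, ?_⟩
        rw [Finset.sum_eq_single_of_mem i (Finset.mem_univ _) fun j _ hj => by
          rw [Pi.single_eq_of_ne hj, Int.cast_zero, zero_mul], Pi.single_eq_same]
      · exact ⟨0, a, ha, by simp⟩
    · exact ⟨0, 0, zero_mem _, by simp⟩
    · rintro _ _ _ _ ⟨c, a, ha, rfl⟩ ⟨c', a', ha', rfl⟩
      refine ⟨c + c', a + a', add_mem ha ha', ?_⟩
      simp only [Pi.add_apply, Int.cast_add, add_mul, Finset.sum_add_distrib, mul_add]
      ring
    · rintro _ _ ⟨c, a, ha, rfl⟩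
      refine ⟨-c, -a, neg_mem ha, ?_⟩
      simp only [Pi.neg_apply, Int.cast_neg]
      have e : ∑ i, -(c i : symFun ℤ) * (t i).1 = -∑ i, (c i : symFun ℤ) * (t i).1 := by
        rw [← Finset.sum_neg_distrib]
        exact Finset.sum_congr rfl fun i _ => by ring
      rw [e]
      ring
  obtain ⟨c, a, ha, hx⟩ := h
  refine ⟨c, ⟨a, ha⟩, Subtype.ext ?_⟩
  have e : ∀ z, (symDeg ℤ d).toAddSubgroup.subtype z = z.1 := fun _ => rfl
  rw [hx, ← e, map_add, map_sum, map_zsmul, zsmul_eq_mul, Int.cast_natCast]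
  congr 1
  refine Finset.sum_congr rfl fun i _ => ?_
  rw [map_zsmul, zsmul_eq_mul, e]

theorem exists_prod_eq_prod_coprimes {p : ℕ} (hp : p.Prime) {A : Type*} [CommRing A]
    {T : ℕ → ℕ → A} (hT : ∀ m, T m 0 = 1) {d L : ℕ} (hL : d < L) {ν : ℕ → ℕ}
    (hν : ∑ m ∈ Finset.Icc 1 d, m * ν m = d) :
    ∃ c : ℕ → ℕ → ℕ, ∑ n ∈ coprimes p d, ∑ k ∈ Finset.range L, p ^ k * n * c n k = d ∧
      ∏ m ∈ Finset.Icc 1 d, T m (ν m) =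
        ∏ n ∈ coprimes p d, ∏ k ∈ Finset.range L, T (p ^ k * n) (c n k) := by
  -- The values of `ν` outside `[1, d]` are unconstrained; they are set to zero before reindexing.
  obtain ⟨ν', h1, h2⟩ : ∃ ν' : ℕ → ℕ, (∀ m ∈ Finset.Icc 1 d, ν' m = ν m) ∧
      ∀ m, d < m → ν' m = 0 :=
    ⟨fun m => if m ≤ d then ν m else 0, fun m hm => if_pos (Finset.mem_Icc.1 hm).2,
      fun m hm => if_neg (by omega)⟩
  refine ⟨fun n k => ν' (p ^ k * n), ?_, ?_⟩
  · rw [← sum_Icc_eq hp hL (fun m => m * ν' m) fun m hm => by rw [h2 m hm, mul_zero]]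
    conv_rhs => rw [← hν]
    exact Finset.sum_congr rfl fun m hm => by rw [h1 m hm]
  · rw [← prod_Icc_eq hp hL (fun m => T m (ν' m)) fun m hm => by rw [h2 m hm, hT]]
    exact Finset.prod_congr rfl fun m hm => by rw [h1 m hm]

/-- Modulo `p` the member attached to `μ` is, up to sign, the monomial in the generators with
exponents the multiplicities of `μ`, and these monomials span. -/
theorem spansMod_srcFam (r d : ℕ) : SpansMod p (srcFam hp r (d := d)) := by
  refine spansMod_of_closure (fun f hf => mem_closure_of_mem_prodSpan
    (T := fun m e => gen hp m ^ e) (fun m e => pow_mem_symDeg (gen_mem_symDeg hp m) e) hf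
    (lowerRing_le_prodSpan p (fun m e => isMonicIn_pow _ _ _) d (mem_lowerRing_gen hp hf))) ?_
  rintro z ⟨ν, hν, rfl⟩
  have hzd := symDeg_of_eq (prod_mem_symDeg (Finset.Icc 1 d)
    fun m _ => pow_mem_symDeg (gen_mem_symDeg hp m) (ν m)) hν
  obtain ⟨c, hc, hz⟩ := exists_prod_eq_prod_coprimes hp (T := fun m e => gen hp m ^ e)
    (fun m => pow_zero _) (L := r + (d + 1)) (by omega) hν
  obtain ⟨μ, hμ⟩ := exists_partition_count hp c hc
  set I := Ideal.span {(p : symFun ℤ)} with hI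
  have key : ∃ E : ℤ, IsUnit E ∧ Ideal.Quotient.mk I (srcFam hp r μ).1 =
      E * Ideal.Quotient.mk I (∏ m ∈ Finset.Icc 1 d, gen hp m ^ ν m) := by
    have hone : ∀ n ∈ coprimes p d, ∀ i ∈ Finset.range (r + (d + 1)), ∃ E : ℤ, IsUnit E ∧
        Ideal.Quotient.mk I ((adamsLift hp).srcElt r (d + 1) i (μ.parts.count (p ^ i * n))
          (psum ℤ n)) = E * Ideal.Quotient.mk I (gen hp (p ^ i * n) ^ c n i) := by
      intro n hn i hi
      obtain ⟨ε, b, h1, h2⟩ := (adamsLift hp).srcElt_congr hp (r := r)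
        (count_lt hp μ (Nat.mul_pos (pow_pos hp.pos i) (pos_of_mem_coprimes hn))) i (psum ℤ n)
      refine ⟨ε, Int.isUnit_iff.2 h1, ?_⟩
      rw [h2, map_add, map_mul, map_intCast, hμ n hn i (Finset.mem_range.1 hi),
        gen_pow_mul hp (coprime_of_mem_coprimes hn), Ideal.Quotient.eq_zero_iff_mem.2
        (Ideal.mem_span_singleton.2 ⟨b, rfl⟩), add_zero]
    have hprod : ∀ (s : Finset ℕ) (f g : ℕ → symFun ℤ), (∀ i ∈ s, ∃ E : ℤ, IsUnit E ∧
        Ideal.Quotient.mk I (f i) = E * Ideal.Quotient.mk I (g i)) → ∃ E : ℤ, IsUnit E ∧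
        Ideal.Quotient.mk I (∏ i ∈ s, f i) = E * Ideal.Quotient.mk I (∏ i ∈ s, g i) := by
      intro s f g h
      choose! E hE h using h
      refine ⟨∏ i ∈ s, E i, Finset.prod_induction _ IsUnit (fun _ _ => IsUnit.mul) isUnit_one hE,
        ?_⟩
      have e : ((∏ i ∈ s, E i : ℤ) : symFun ℤ ⧸ I) = ∏ i ∈ s, (E i : symFun ℤ ⧸ I) :=
        map_prod (Int.castRingHom (symFun ℤ ⧸ I)) E s
      rw [map_prod, map_prod, e, ← Finset.prod_mul_distrib]
      exact Finset.prod_congr rfl h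
    rw [hz]
    exact hprod _ _ _ fun n hn => hprod _ _ _ (hone n hn)
  obtain ⟨E, hE, h⟩ := key
  rw [← map_intCast (Ideal.Quotient.mk I), ← map_mul, Ideal.Quotient.eq, hI,
    Ideal.mem_span_singleton] at h
  obtain ⟨a, ha⟩ := h
  have hEE : (E : symFun ℤ) * E = 1 := by
    rw [← Int.cast_mul, Int.isUnit_mul_self hE, Int.cast_one]
  -- The relation `src = E z + p a` is solved for the monomial `z` by means of `E * E = 1`.
  refine ⟨μ, E, -(E * a), neg_mem ?_, ?_⟩
  · have had : a ∈ symDeg ℤ d := by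
      apply mem_symDeg_of_natCast_mul hp.ne_zero
      rw [← ha, ← zsmul_eq_mul]
      exact sub_mem (srcFam hp r μ).2 (zsmul_mem hzd E)
    rw [← zsmul_eq_mul]
    exact zsmul_mem had E
  · linear_combination (-E : symFun ℤ) * ha - (∏ m ∈ Finset.Icc 1 d, gen hp m ^ ν m) * hEE

/-- The filtration is given by the generators of degree less than `p ^ k n`; it contains `δ^k p_n`,
of degree `p ^ k n`, from level `k + 1` on. -/
theorem isMonicIn_monElt_gen (r : ℕ) {n : ℕ} (hn : 0 < n) (hnp : n.Coprime p) (k e : ℕ) :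
    IsMonicIn (lowerRing p (gen hp) (p ^ k * n)) (gen hp (p ^ k * n)) e
      ((adamsLift hp).monElt r k e (psum ℤ n)) := by
  rw [gen_pow_mul hp hnp]
  refine (adamsLift hp).isMonicIn_monElt hp (E := fun k => lowerRing p (gen hp) (p ^ k * n))
    (fun i j hij => lowerRing_mono _ _ (Nat.mul_le_mul_right n (Nat.pow_le_pow_right hp.pos hij)))
    (fun _ a => mul_mem_lowerRing _ _ _ a) (fun k => ?_) r k e
  rw [← gen_pow_mul hp hnp]
  exact mem_lowerRing (Nat.mul_pos (pow_pos hp.pos k) hn)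
    (Nat.mul_lt_mul_of_pos_right (Nat.pow_lt_pow_right hp.one_lt (Nat.lt_succ_self k)) hn)

/-- A monic polynomial of degree `e` in `gen hp m` modulo `p`. -/
def monGen (r m e : ℕ) : symFun ℤ :=
  -- The value at `m = 0` is a convention that makes monicity hold for all `m`.
  if m = 0 then gen hp m ^ e
  else (adamsLift hp).monElt r (m.factorization p) e (psum ℤ (m / p ^ m.factorization p))

theorem monGen_pow_mul (r : ℕ) {n : ℕ} (hn : 0 < n) (hnp : n.Coprime p) (k e : ℕ) :
    monGen hp r (p ^ k * n) e = (adamsLift hp).monElt r k e (psum ℤ n) := by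
  rw [monGen, if_neg (Nat.mul_pos (pow_pos hp.pos k) hn).ne', factorization_pow_mul hp hnp,
    Nat.mul_div_cancel_left _ (pow_pos hp.pos k)]

theorem isMonicIn_monGen (r m e : ℕ) :
    IsMonicIn (lowerRing p (gen hp) m) (gen hp m) e (monGen hp r m e) := by
  by_cases hm : m = 0
  · rw [monGen, if_pos hm]
    exact isMonicIn_pow _ _ _
  · obtain ⟨n, hn, k, -, rfl⟩ := exists_eq_pow_mul hp
      (Finset.mem_Icc.2 ⟨Nat.pos_of_ne_zero hm, le_rfl⟩)
    have h1 := pos_of_mem_coprimes hn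
    have h2 := coprime_of_mem_coprimes hn
    rw [monGen_pow_mul hp r h1 h2]
    exact isMonicIn_monElt_gen hp r h1 h2 k e

theorem monGen_mem_symDeg (r m e : ℕ) : monGen hp r m e ∈ symDeg ℤ (m * e) := by
  rw [monGen]
  split_ifs with hm
  · exact pow_mem_symDeg (gen_mem_symDeg hp m) e
  · refine symDeg_of_eq (monElt_mem_symDeg hp r _ e (psum_mem_symDeg _)) ?_
    rw [Nat.ordProj_mul_ordCompl_eq_self]

theorem monGen_zero (r m : ℕ) : monGen hp r m 0 = 1 := by
  rw [monGen]
  split_ifs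
  · exact pow_zero _
  · simp [FrobLift.monElt, digit_zero_right]

/-- By triangularity the products of the monic elements `monGen` span modulo `p`. Each such product
is a member of the target family, namely for the partition whose multiplicities are obtained by
transposing digits. -/
theorem spansMod_tgtFam (r d : ℕ) : SpansMod p (tgtFam hp r (d := d)) := by
  refine spansMod_of_closure (fun f hf => mem_closure_of_mem_prodSpan (monGen_mem_symDeg hp r) hf
    (lowerRing_le_prodSpan p (isMonicIn_monGen hp r) d (mem_lowerRing_gen hp hf))) ?_
  rintro z ⟨ν, hν, rfl⟩
  obtain ⟨c, hc, hz⟩ := exists_prod_eq_prod_coprimes hp (monGen_zero hp r)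
    (L := d + 1) (by omega) hν
  obtain ⟨μ, hμ⟩ := exists_partition_count hp (d := d) (K := r + (d + 1))
    (fun n i => transposeDigits p r (d + 1) (c n) i) (by
      conv_rhs => rw [← hc]
      refine Finset.sum_congr rfl fun n _ => ?_
      have h := congrArg (n * ·) (sum_transposeDigits p r (d + 1) (c n))
      simp only [Finset.mul_sum] at h
      refine Eq.trans (Finset.sum_congr rfl fun i _ => ?_)
        (h.trans (Finset.sum_congr rfl fun i _ => ?_)) <;> ring)
  refine ⟨μ, 1, 0, zero_mem _, ?_⟩
  rw [hz, Int.cast_one, one_mul, mul_zero, add_zero]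
  refine Finset.prod_congr rfl fun n hn => ?_
  have h1 : ∀ k ∈ Finset.range (d + 1), monGen hp r (p ^ k * n) (c n k) =
      (adamsLift hp).monElt r k (c n k) (psum ℤ n) := fun k _ =>
    monGen_pow_mul hp r (pos_of_mem_coprimes hn) (coprime_of_mem_coprimes hn) k _
  rw [Finset.prod_congr rfl h1, ← FrobLift.prod_tgtElt _ hp]
  exact Finset.prod_congr rfl fun i hi => by rw [hμ n hn i (Finset.mem_range.1 hi)]

end Families

/-! ### Integral bases that diagonalize `theta`, and dual bases -/

section Duality

/-- A basis of an abelian group. -/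
abbrev IntBasis (ι M : Type*) [AddCommGroup M] := Module.Basis ι ℤ M

/-- The basis of monomial symmetric functions. -/
def msymBasis (d : ℕ) : IntBasis d.Partition (symDeg ℤ d) :=
  Module.Basis.ofEquivFun (coordEquiv ℤ d).toIntLinearEquiv

/-- The component of degree `d` of the plethysm `theta`. -/
def thetaDeg (s : ℕ) [NeZero s] (d : ℕ) : symDeg ℤ d →+ symDeg ℤ d where
  toFun f := ⟨theta ℤ s f.1, theta_mem_symDeg s f.2⟩
  map_zero' := Subtype.ext (map_zero (theta ℤ s))
  map_add' f g := Subtype.ext (map_add (theta ℤ s) f.1 g.1)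

/-- The inclusion of the component of degree `d`. -/
def coeHom (d : ℕ) : symDeg ℤ d →+ symFun ℤ where
  toFun f := f.1
  map_zero' := rfl
  map_add' _ _ := rfl

theorem map_zsmul_eq_mul {M A : Type*} [AddCommGroup M] [Ring A] (φ : M →+ A) (k : ℤ) (x : M) :
    φ (k • x) = k * φ x := by
  rw [map_zsmul, zsmul_eq_mul]

/-- The common source of both assertions of the theorem: the two families span modulo `p` and the
cokernel of `theta` is `p`-primary. -/
theorem exists_theta_bases {p : ℕ} (hp : p.Prime) (r d : ℕ) [NeZero (p ^ r)] :
    ∃ u v : IntBasis d.Partition (symDeg ℤ d), ∀ μ,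
      theta ℤ (p ^ r) (u μ).1 = (divisorD p r μ : symFun ℤ) * (v μ).1 := by
  have : Fact p.Prime := ⟨hp⟩
  have h1 : ∀ μ : d.Partition, thetaDeg (p ^ r) d (srcFam hp r μ) =
      ((p : ℤ) ^ expD p r μ) • tgtFam hp r μ := fun μ => Subtype.ext (by
    refine (theta_srcFam hp r μ).trans (Eq.trans ?_ (map_zsmul_eq_mul (coeHom d) _ _).symm)
    push_cast
    rfl)
  have h2 : ∀ x : symDeg ℤ d, ∃ (K : ℕ) (y : symDeg ℤ d),
      thetaDeg (p ^ r) d y = ((p : ℤ) ^ K) • x := fun x => by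
    obtain ⟨K, g, hg, h⟩ := exists_theta_eq p r d x.2
    refine ⟨K, ⟨g, hg⟩, Subtype.ext
      (h.trans (Eq.trans ?_ (map_zsmul_eq_mul (coeHom d) _ _).symm))⟩
    push_cast
    rfl
  obtain ⟨u, v, h⟩ := exists_bases_of_spansMod p (msymBasis d)
    (thetaDeg (p ^ r) d).toIntLinearMap (spansMod_srcFam hp r d) (spansMod_tgtFam hp r d) h1 h2
  refine ⟨u, v, fun μ => (congrArg Subtype.val (h μ)).trans ?_⟩
  refine (map_zsmul_eq_mul (coeHom d) _ _).trans ?_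
  rw [divisorD_eq]
  push_cast
  rfl

theorem hprod_expo {d : ℕ} (μ : d.Partition) :
    hprod ℤ (expo μ) = (μ.parts.map (hsym ℤ)).prod := by
  rw [← vals_expo, vals, Multiset.map_map]
  rfl

theorem exists_hprod_eq {d : ℕ} {ν : ℕ → ℕ} (hν : ∑ m ∈ Finset.Icc 1 d, m * ν m = d) :
    ∃ μ : d.Partition, hprod ℤ (expo μ) = ∏ m ∈ Finset.Icc 1 d, hsym ℤ m ^ ν m := by
  refine ⟨⟨∑ m ∈ Finset.Icc 1 d, Multiset.replicate (ν m) m, fun {i} hi => ?_, ?_⟩, ?_⟩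
  · rw [Multiset.mem_sum] at hi
    obtain ⟨m, hm, hi⟩ := hi
    rw [Multiset.eq_of_mem_replicate hi]
    exact (Finset.mem_Icc.1 hm).1
  · conv_rhs => rw [← hν]
    rw [Multiset.sum_sum]
    exact Finset.sum_congr rfl fun m _ => by rw [Multiset.sum_replicate, smul_eq_mul, mul_comm]
  · rw [hprod_expo]
    change (Multiset.mapAddMonoidHom (hsym ℤ) _).prod = _
    rw [map_sum, Multiset.prod_sum]
    refine Finset.prod_congr rfl fun m _ => ?_
    rw [Multiset.coe_mapAddMonoidHom, Multiset.map_replicate, Multiset.prod_replicate]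

/-- Modulus `0` means that the products of the `h_n` span over `ℤ`. -/
theorem spansMod_hprod (d : ℕ) : SpansMod 0 fun μ : d.Partition =>
    (⟨hprod ℤ (expo μ), symDeg_of_eq (hprod_mem_symDeg _) (degree_expo μ)⟩ : symDeg ℤ d) := by
  refine spansMod_of_closure (fun f hf => mem_closure_of_mem_prodSpan
    (T := fun m e => hsym ℤ m ^ e) (fun m e => pow_mem_symDeg (hsym_mem_symDeg m) e) hf
    (lowerRing_le_prodSpan 0 (fun m e => isMonicIn_pow _ _ _) d (mem_lowerRing_hsym 0 hf))) ?_
  rintro z ⟨ν, hν, rfl⟩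
  obtain ⟨μ, hμ⟩ := exists_hprod_eq hν
  exact ⟨μ, 1, 0, zero_mem _, by simp [hμ]⟩

/-- `h` is dual to `m`, so transforming `h` by the transpose of the transition matrix from `m` to
`v` gives a family dual to `v`. Pairing with `v` shows its independence. -/
theorem exists_dual_basis {M ι : Type*} [AddCommGroup M] [Fintype ι] (B : M →+ M →+ ℂ)
    (m : IntBasis ι M) {h : ι → M} (hspan : SpansMod 0 h)
    (hB : ∀ i f, B (h i) f = ((m.repr f i : ℤ) : ℂ)) (v : IntBasis ι M) :
    ∃ w : IntBasis ι M, ∀ i f, B (w i) f = ((v.repr f i : ℤ) : ℂ) := by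
  classical
  set w : ι → M := fun i => ∑ j, v.repr (m j) i • h j with hw
  have hBw : ∀ i f, B (w i) f = ((v.repr f i : ℤ) : ℂ) := by
    intro i f
    simp only [hw]
    rw [map_sum, AddMonoidHom.finsetSum_apply]
    conv_rhs => rw [← m.sum_repr f, map_sum, Finsupp.finsetSum_apply, Int.cast_sum]
    refine Finset.sum_congr rfl fun j _ => ?_
    rw [map_zsmul, AddMonoidHom.zsmul_apply, hB, map_zsmul, Finsupp.smul_apply, zsmul_eq_mul,
      smul_eq_mul, Int.cast_mul, mul_comm]
  -- The inverse transition matrix expresses `h` through `w`, so `w` spans.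
  have hexp : ∀ k, h k = ∑ i, m.repr (v i) k • w i := by
    intro k
    simp only [hw, Finset.smul_sum, smul_smul]
    rw [Finset.sum_comm]
    have h1 : ∀ j, ∑ i, (m.repr (v i) k * v.repr (m j) i) • h j =
        (if j = k then (1 : ℤ) else 0) • h j := by
      intro j
      rw [← Finset.sum_smul]
      congr 1
      have h2 := congrArg (fun x => m.repr x k) (v.sum_repr (m j))
      simp only [map_sum, map_zsmul, Finsupp.finsetSum_apply, Finsupp.smul_apply, smul_eq_mul,
        Module.Basis.repr_self, Finsupp.single_apply] at h2
      rw [← h2]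
      exact Finset.sum_congr rfl fun i _ => mul_comm _ _
    simp [h1]
  have hli : LinearIndependent ℤ w := by
    rw [Fintype.linearIndependent_iff]
    intro c hc i
    have h1 := congrArg (fun x => B x (v i)) hc
    simp only [map_sum, map_zsmul, AddMonoidHom.finsetSum_apply, AddMonoidHom.zsmul_apply, hBw,
      map_zero, AddMonoidHom.zero_apply, Module.Basis.repr_self] at h1
    rw [Finset.sum_eq_single_of_mem i (Finset.mem_univ _)] at h1
    · simpa using h1
    · intro j _ hj
      rw [Finsupp.single_eq_of_ne hj]
      simp
  have hsp : ⊤ ≤ Submodule.span ℤ (Set.range w) := by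
    intro f _
    obtain ⟨c, y, hf⟩ := hspan f
    rw [hf, Nat.cast_zero, zero_smul, add_zero]
    refine Submodule.sum_mem _ fun k _ => Submodule.smul_mem _ _ ?_
    rw [hexp]
    exact Submodule.sum_mem _ fun i _ => Submodule.smul_mem _ _ (Submodule.subset_span ⟨i, rfl⟩)
  refine ⟨Module.Basis.mk hli hsp, fun i f => ?_⟩
  rw [Module.Basis.mk_apply, hBw]

/-- The Hall form on `symDeg ℤ d` is unimodular: each basis has a dual basis. -/
theorem exists_dual {d : ℕ} (v : IntBasis d.Partition (symDeg ℤ d)) :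
    ∃ w : IntBasis d.Partition (symDeg ℤ d), ∀ (i : d.Partition) (f : symDeg ℤ d),
      sForm ℂ 1 (toComplex (w i).1) (toComplex f.1) = ((v.repr f i : ℤ) : ℂ) := by
  obtain ⟨w, hw⟩ := exists_dual_basis (sFormDeg 1 d) (msymBasis d) (spansMod_hprod d) (fun μ f => by
    change sForm ℂ ((1 : ℕ) : ℂ) (toComplex (hprod ℤ (expo μ))) (toComplex f.1) =
      ((cf (expo μ) f.1 : ℤ) : ℂ)
    rw [Nat.cast_one, toComplex_hprod, sForm_hprod, cf_toComplex]) v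
  refine ⟨w, fun i f => ?_⟩
  rw [← hw i f, ← Nat.cast_one]
  rfl

end Duality

/-! ### Coefficients of powers of the Cauchy kernel -/

section Kernel

/-- The coefficient of `y ^ b`, as a power series in `x`. -/
def yc (b : ℕ →₀ ℕ) (F : MvPowerSeries (ℕ ⊕ ℕ) ℤ) : MvPowerSeries ℕ ℤ :=
  fun a => MvPowerSeries.coeff (a.sumElim b) F

theorem coeff_yc (a b : ℕ →₀ ℕ) (F : MvPowerSeries (ℕ ⊕ ℕ) ℤ) :
    MvPowerSeries.coeff a (yc b F) = MvPowerSeries.coeff (a.sumElim b) F := rfl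

open Classical in
theorem yc_mul (b : ℕ →₀ ℕ) (F G : MvPowerSeries (ℕ ⊕ ℕ) ℤ) :
    yc b (F * G) = ∑ q ∈ Finset.HasAntidiagonal.antidiagonal b, yc q.1 F * yc q.2 G := by
  ext a
  rw [coeff_yc, MvPowerSeries.coeff_mul, ← Finsupp.image_sumElim_product_antidiagonal,
    Finset.sum_image, Finset.sum_product_right, map_sum]
  · exact Finset.sum_congr rfl fun q _ => (MvPowerSeries.coeff_mul a (yc q.1 F) (yc q.2 G)).symm
  · rintro ⟨⟨x, y⟩, ⟨z, w⟩⟩ _ ⟨⟨x', y'⟩, ⟨z', w'⟩⟩ _ h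
    simp only [Prod.mk.injEq] at h
    have h1 := DFunLike.congr_fun h.1
    have h2 := DFunLike.congr_fun h.2
    simp only [Prod.mk.injEq]
    exact ⟨⟨Finsupp.ext fun i => h1 (Sum.inl i), Finsupp.ext fun i => h2 (Sum.inl i)⟩,
      ⟨Finsupp.ext fun i => h1 (Sum.inr i), Finsupp.ext fun i => h2 (Sum.inr i)⟩⟩

open Classical in
theorem yc_one (b : ℕ →₀ ℕ) : yc b 1 = if b = 0 then 1 else 0 := by
  ext a
  rw [coeff_yc, MvPowerSeries.coeff_one]
  have h : a.sumElim b = 0 ↔ a = 0 ∧ b = 0 := by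
    constructor
    · intro h
      exact ⟨Finsupp.ext fun i => DFunLike.congr_fun h (Sum.inl i),
        Finsupp.ext fun i => DFunLike.congr_fun h (Sum.inr i)⟩
    · rintro ⟨rfl, rfl⟩
      ext (i | i) <;> rfl
  by_cases hb : b = 0
  · rw [if_pos hb, MvPowerSeries.coeff_one]
    congr 1
    exact propext (h.trans (and_iff_left hb))
  · rw [if_neg hb, if_neg fun e => hb (h.1 e).2, map_zero]

/-- `F` is the series `∑_n f_n(x) y_j ^ n`. -/
def IsSer (j : ℕ) (f : PowerSeries (MvPowerSeries ℕ ℤ)) (F : MvPowerSeries (ℕ ⊕ ℕ) ℤ) : Prop :=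
  ∀ b : ℕ →₀ ℕ, yc b F = if b = Finsupp.single j (b j) then PowerSeries.coeff (b j) f else 0

theorem IsSer.mul {j : ℕ} {f g : PowerSeries (MvPowerSeries ℕ ℤ)} {F G : MvPowerSeries (ℕ ⊕ ℕ) ℤ}
    (hF : IsSer j f F) (hG : IsSer j g G) : IsSer j (f * g) (F * G) := by
  classical
  intro b
  rw [yc_mul]
  split_ifs with h
  · generalize b j = n at h
    subst h
    rw [PowerSeries.coeff_mul, Finsupp.antidiagonal_single, Finset.sum_map]
    refine Finset.sum_congr rfl fun q _ => ?_
    simp only [Function.Embedding.coe_prodMap, Function.Embedding.coeFn_mk]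
    rw [hF, hG]
    simp
  · refine Finset.sum_eq_zero fun q hq => ?_
    rw [Finset.HasAntidiagonal.mem_antidiagonal] at hq
    rw [hF, hG]
    split_ifs with h1 h2
    · exfalso
      apply h
      rw [← hq, Finsupp.add_apply, Finsupp.single_add, ← h1, ← h2]
    · rw [mul_zero]
    · rw [zero_mul]
    · rw [zero_mul]

theorem isSer_one (j : ℕ) : IsSer j 1 1 := by
  classical
  intro b
  rw [yc_one]
  by_cases hb : b = 0
  · simp [hb]
  · rw [if_neg hb]
    split_ifs with h
    · rw [PowerSeries.coeff_one, if_neg]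
      intro h0
      rw [h0, Finsupp.single_zero] at h
      exact hb h
    · rfl

theorem IsSer.pow {j : ℕ} {f : PowerSeries (MvPowerSeries ℕ ℤ)} {F : MvPowerSeries (ℕ ⊕ ℕ) ℤ}
    (hF : IsSer j f F) (s : ℕ) : IsSer j (f ^ s) (F ^ s) := by
  induction s with
  | zero => simpa using isSer_one j
  | succ s ih =>
    rw [pow_succ, pow_succ]
    exact ih.mul hF

/-- The factors involve different variables `y_j`, so `y ^ b` arises in only one way. -/
theorem yc_prod {f : PowerSeries (MvPowerSeries ℕ ℤ)}
    {F : ℕ → MvPowerSeries (ℕ ⊕ ℕ) ℤ} (hF : ∀ j, IsSer j f (F j)) (T : Finset ℕ) (b : ℕ →₀ ℕ) :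
    yc b (∏ j ∈ T, F j) =
      if b.support ⊆ T then ∏ j ∈ T, PowerSeries.coeff (b j) f else 0 := by
  classical
  induction T using Finset.induction_on generalizing b with
  | empty =>
    rw [Finset.prod_empty, Finset.prod_empty, yc_one]
    simp only [Finset.subset_empty, Finsupp.support_eq_empty]
  | insert j T hj ih =>
    rw [Finset.prod_insert hj, yc_mul]
    by_cases hb : b.support ⊆ insert j T
    · rw [if_pos hb, Finset.sum_eq_single (Finsupp.single j (b j), b.erase j)]
      · rw [hF, ih, if_pos (by simp), if_pos, Finset.prod_insert hj]
        · congr 1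
          · simp
          · refine Finset.prod_congr rfl fun i hi => ?_
            rw [Finsupp.erase_ne (show i ≠ j from fun e => hj (e ▸ hi))]
        · rw [Finsupp.support_erase]
          intro i hi
          rw [Finset.mem_erase] at hi
          exact (Finset.mem_insert.1 (hb hi.2)).resolve_left hi.1
      · intro q hq hne
        rw [Finset.HasAntidiagonal.mem_antidiagonal] at hq
        rw [hF, ih]
        split_ifs with h1 h2
        · exfalso
          apply hne
          have h3 : q.2 j = 0 := Finsupp.notMem_support_iff.1 fun h => hj (h2 h)
          have h4 : q.1 j = b j := by rw [← hq, Finsupp.add_apply, h3, add_zero]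
          have h5 : q.1 = Finsupp.single j (b j) := by rw [h1, h4]
          refine Prod.ext h5 ?_
          have h6 := Finsupp.single_add_erase j b
          rw [← h5] at h6
          exact add_left_cancel (hq.trans h6.symm)
        · rw [mul_zero]
        · rw [zero_mul]
        · rw [zero_mul]
      · intro h
        rw [Finset.HasAntidiagonal.mem_antidiagonal] at h
        exact absurd (Finsupp.single_add_erase j b) h
    · rw [if_neg hb]
      refine Finset.sum_eq_zero fun q hq => ?_
      rw [Finset.HasAntidiagonal.mem_antidiagonal] at hq
      rw [hF, ih]
      split_ifs with h1 h2
      · exfalso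
        apply hb
        rw [← hq]
        refine Finsupp.support_add.trans
          (Finset.union_subset ?_ (h2.trans (Finset.subset_insert _ _)))
        rw [h1]
        exact Finsupp.support_single_subset.trans (by simp)
      · rw [mul_zero]
      · rw [zero_mul]
      · rw [zero_mul]

open Classical in
/-- The series `∑_n h_n y_j ^ n` in the variables `x_i` with `i` not in `S`. -/
def restH (j : ℕ) (S : Finset ℕ) : MvPowerSeries (ℕ ⊕ ℕ) ℤ := fun m =>
  -- Given the first condition, the last one says that the degree in `x` equals the exponent of
  -- `y_j`.
  if (∀ k, k ≠ j → m (Sum.inr k) = 0) ∧ (∀ i ∈ S, m (Sum.inl i) = 0) ∧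
    m.degree = 2 * m (Sum.inr j) then 1 else 0

open Classical in
theorem coeff_restH (j : ℕ) (S : Finset ℕ) (m : ℕ ⊕ ℕ →₀ ℕ) :
    MvPowerSeries.coeff m (restH j S) =
      if (∀ k, k ≠ j → m (Sum.inr k) = 0) ∧ (∀ i ∈ S, m (Sum.inl i) = 0) ∧
        m.degree = 2 * m (Sum.inr j) then 1 else 0 := rfl

/-- Multiplication by `x_i y_j` is a bijection from the monomials of `restH j S` onto those of its
monomials that contain `x_i`; the difference keeps the others. -/
theorem restH_insert (j : ℕ) {S : Finset ℕ} {i : ℕ} (hi : i ∉ S) :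
    (1 - MvPowerSeries.X (Sum.inl i) * MvPowerSeries.X (Sum.inr j)) * restH j S =
      restH j (insert i S) := by
  classical
  set e : ℕ ⊕ ℕ →₀ ℕ := Finsupp.single (Sum.inl i) 1 + Finsupp.single (Sum.inr j) 1 with he
  have hX : (MvPowerSeries.X (Sum.inl i) * MvPowerSeries.X (Sum.inr j) :
      MvPowerSeries (ℕ ⊕ ℕ) ℤ) = MvPowerSeries.monomial e 1 := by
    rw [MvPowerSeries.X, MvPowerSeries.X, MvPowerSeries.monomial_mul_monomial, mul_one]
  have hdeg : e.degree = 2 := by rw [he, map_add, Finsupp.degree_single, Finsupp.degree_single]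
  have hel : ∀ k, e (Sum.inl k) = if k = i then 1 else 0 := by
    intro k
    simp [he, Finsupp.single_apply, eq_comm]
  have her : ∀ k, e (Sum.inr k) = if k = j then 1 else 0 := by
    intro k
    simp [he, Finsupp.single_apply, eq_comm]
  ext m
  rw [sub_mul, one_mul, hX, map_sub, MvPowerSeries.coeff_monomial_mul, one_mul, coeff_restH,
    coeff_restH, coeff_restH]
  have hle : e ≤ m ↔ 1 ≤ m (Sum.inl i) ∧ 1 ≤ m (Sum.inr j) := by
    constructor
    · intro h
      have h1 := h (Sum.inl i)
      have h2 := h (Sum.inr j)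
      rw [hel, if_pos rfl] at h1
      rw [her, if_pos rfl] at h2
      exact ⟨h1, h2⟩
    · rintro ⟨h1, h2⟩ (k | k)
      · rw [hel]
        split_ifs with h
        · rw [h]; exact h1
        · exact Nat.zero_le _
      · rw [her]
        split_ifs with h
        · rw [h]; exact h2
        · exact Nat.zero_le _
  have hsub : e ≤ m → (m - e).degree + 2 = m.degree := by
    intro h
    rw [← hdeg, ← map_add, tsub_add_cancel_of_le h]
  by_cases hP : (∀ k, k ≠ j → m (Sum.inr k) = 0) ∧ (∀ i ∈ S, m (Sum.inl i) = 0) ∧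
        m.degree = 2 * m (Sum.inr j)
  · rw [if_pos hP]
    obtain ⟨h1, h2, h3⟩ := hP
    by_cases h0 : m (Sum.inl i) = 0
    · rw [if_neg fun h => by have := (hle.1 h).1; omega, sub_zero, if_pos]
      refine ⟨h1, fun k hk => ?_, h3⟩
      rcases Finset.mem_insert.1 hk with rfl | hk
      · exact h0
      · exact h2 k hk
    · have h4 : m (Sum.inl i) ≤ m.degree := Finsupp.le_degree _ _
      have h5 : e ≤ m := hle.2 ⟨by omega, by omega⟩
      have h6 := hsub h5
      rw [if_pos h5, if_pos, sub_self, if_neg]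
      · exact fun h => h0 (h.2.1 i (Finset.mem_insert_self _ _))
      · refine ⟨fun k hk => ?_, fun k hk => ?_, ?_⟩
        · rw [Finsupp.tsub_apply, h1 k hk, Nat.zero_sub]
        · rw [Finsupp.tsub_apply, h2 k hk, Nat.zero_sub]
        · rw [Finsupp.tsub_apply, her, if_pos rfl]
          omega
  · have hP' : ¬((∀ k, k ≠ j → m (Sum.inr k) = 0) ∧ (∀ k ∈ insert i S, m (Sum.inl k) = 0) ∧
        m.degree = 2 * m (Sum.inr j)) :=
      fun h => hP ⟨h.1, fun k hk => h.2.1 k (Finset.mem_insert_of_mem hk), h.2.2⟩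
    rw [if_neg hP, if_neg hP']
    split_ifs with h5 h6
    · exfalso
      apply hP
      obtain ⟨h1, h2, h3⟩ := h6
      have h7 := hsub h5
      have h8 := hle.1 h5
      refine ⟨fun k hk => ?_, fun k hk => ?_, ?_⟩
      · have := h1 k hk
        rwa [Finsupp.tsub_apply, her, if_neg hk] at this
      · have := h2 k hk
        rwa [Finsupp.tsub_apply, hel, if_neg (show k ≠ i from fun e => hi (e ▸ hk))] at this
      · rw [Finsupp.tsub_apply, her, if_pos rfl] at h3
        omega
    · rfl
    · rfl

theorem prod_cauchyFactor_mul (j : ℕ) (S : Finset ℕ) :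
    (∏ i ∈ S, cauchyFactor (i, j)) * restH j S = restH j ∅ := by
  classical
  induction S using Finset.induction_on with
  | empty => rw [Finset.prod_empty, one_mul]
  | insert i S hi ih =>
    rw [Finset.prod_insert hi, ← restH_insert j hi, ← ih]
    linear_combination ((∏ i ∈ S, cauchyFactor (i, j)) * restH j S) * cauchyFactor_mul (i, j)

theorem coeff_restH_of_le {j : ℕ} {S : Finset ℕ} {m q : ℕ ⊕ ℕ →₀ ℕ}
    (hm : ∀ i, m (Sum.inl i) ≠ 0 → i ∈ S) (hq : q ≤ m) :
    MvPowerSeries.coeff q (restH j S) = MvPowerSeries.coeff q (1 : MvPowerSeries (ℕ ⊕ ℕ) ℤ) := by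
  classical
  rw [coeff_restH, MvPowerSeries.coeff_one]
  congr 1
  apply propext
  constructor
  · rintro ⟨h1, h2, h3⟩
    have h4 : q = Finsupp.single (Sum.inr j) (q (Sum.inr j)) := by
      ext (i | k)
      · rw [Finsupp.single_apply, if_neg (by simp)]
        by_contra h0
        have h5 := hq (Sum.inl i)
        exact h0 (h2 i (hm i (by omega)))
      · by_cases hk : k = j
        · rw [hk, Finsupp.single_eq_same]
        · rw [h1 k hk, Finsupp.single_apply, if_neg]
          intro h
          exact hk (Sum.inr_injective h).symm
    have h6 : q.degree = q (Sum.inr j) := by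
      conv_lhs => rw [h4]
      exact Finsupp.degree_single _ _
    rw [h4, show q (Sum.inr j) = 0 by omega, Finsupp.single_zero]
  · rintro rfl
    simp

/-- A partial product over `S` times `restH j S` does not depend on `S`. Once `S` contains all
`x`-variables of a monomial `m`, the series `restH j S` agrees with `1` at all divisors of `m`, so
the coefficient at `m` is stationary. -/
theorem hasProd_cauchyFactor_fiber (j : ℕ) :
    HasProd (fun i => cauchyFactor (i, j)) (restH j ∅) := by
  classical
  rw [HasProd, SummationFilter.unconditional_filter,
    MvPowerSeries.WithPiTopology.tendsto_iff_coeff_tendsto]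
  intro m
  apply tendsto_nhds_of_eventually_eq
  rw [Filter.eventually_atTop]
  refine ⟨m.support.preimage Sum.inl Sum.inl_injective.injOn, fun S hS => ?_⟩
  rw [← prod_cauchyFactor_mul j S]
  conv_lhs => rw [← mul_one (∏ i ∈ S, cauchyFactor (i, j))]
  rw [MvPowerSeries.coeff_mul, MvPowerSeries.coeff_mul]
  refine Finset.sum_congr rfl fun q hq => ?_
  rw [Finset.HasAntidiagonal.mem_antidiagonal] at hq
  rw [coeff_restH_of_le (m := m) (fun i hi => hS (by simpa using hi))]
  rw [← hq]
  exact le_add_self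

/-- Regularity allows the double product to be evaluated first over `i`, then over `j`. -/
instance : RegularSpace (MvPowerSeries (ℕ ⊕ ℕ) ℤ) :=
  inferInstanceAs (RegularSpace ((ℕ ⊕ ℕ →₀ ℕ) → ℤ))

theorem hasProd_restH : HasProd (fun j => restH j ∅) cauchyKernel :=
  ((Equiv.prodComm ℕ ℕ).hasProd_iff.2 multipliable_cauchyFactor.hasProd).prod_fiberwise
    hasProd_cauchyFactor_fiber

theorem degree_sumElim (a b : ℕ →₀ ℕ) : (a.sumElim b).degree = a.degree + b.degree := by
  have h : a.sumElim b = a.mapDomain Sum.inl + b.mapDomain Sum.inr := by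
    ext (i | i)
    · rw [Finsupp.add_apply, Finsupp.mapDomain_apply Sum.inl_injective,
        Finsupp.mapDomain_of_notMem_range _ _ (by simp), add_zero]
      rfl
    · rw [Finsupp.add_apply, Finsupp.mapDomain_apply Sum.inr_injective,
        Finsupp.mapDomain_of_notMem_range _ _ (by simp), zero_add]
      rfl
  rw [h, map_add, Finsupp.degree_mapDomain, Finsupp.degree_mapDomain]

/-- The generating series of the complete symmetric functions. -/
def hSer : PowerSeries (symFun ℤ) := PowerSeries.mk (hsym ℤ)

theorem isSer_restH (j : ℕ) :
    IsSer j (PowerSeries.map (symFun ℤ).val.toRingHom hSer) (restH j ∅) := by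
  classical
  intro b
  ext a
  rw [coeff_yc, coeff_restH]
  split_ifs with h1 h2 h2
  · rw [PowerSeries.coeff_map, hSer, PowerSeries.coeff_mk]
    refine (if_pos ?_).symm
    have h3 := h1.2.2
    rw [degree_sumElim, Finsupp.sumElim_apply, Sum.elim_inr] at h3
    have h4 : b.degree = b j := by
      conv_lhs => rw [h2]
      exact Finsupp.degree_single _ _
    omega
  · exfalso
    apply h2
    ext k
    by_cases hk : k = j
    · rw [hk, Finsupp.single_eq_same]
    · rw [Finsupp.single_eq_of_ne hk]
      exact h1.1 k hk
  · rw [PowerSeries.coeff_map, hSer, PowerSeries.coeff_mk]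
    refine (if_neg fun h3 => h1 ⟨fun k hk => ?_, by simp, ?_⟩).symm
    · rw [Finsupp.sumElim_apply, Sum.elim_inr, h2, Finsupp.single_eq_of_ne hk]
    · have h4 : b.degree = b j := by
        conv_lhs => rw [h2]
        exact Finsupp.degree_single _ _
      rw [degree_sumElim, Finsupp.sumElim_apply, Sum.elim_inr]
      omega
  · rw [map_zero]

/-- The generating series of the power sums. -/
def pSer : PowerSeries (symFun ℤ) := PowerSeries.mk fun n => if n = 0 then 0 else psum ℤ n

theorem coeff_pSer_mul (f : PowerSeries (symFun ℤ)) (n : ℕ) :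
    PowerSeries.coeff n (pSer * f) =
      ∑ j ∈ Finset.Icc 1 n, psum ℤ j * PowerSeries.coeff (n - j) f := by
  rw [PowerSeries.coeff_mul, Finset.Nat.sum_antidiagonal_eq_sum_range_succ_mk,
    Finset.sum_range_succ', pSer]
  simp only [PowerSeries.coeff_mk, if_pos, zero_mul, add_zero, if_neg (Nat.succ_ne_zero _)]
  rw [Finset.range_eq_Ico, Finset.sum_Ico_add' (fun j => psum ℤ j * PowerSeries.coeff (n - j) f),
    zero_add]
  rfl

theorem coeff_X_mul_derivative (f : PowerSeries (symFun ℤ)) (n : ℕ) :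
    PowerSeries.coeff n (PowerSeries.X * PowerSeries.derivative (symFun ℤ) f) =
      n * PowerSeries.coeff n f := by
  cases n with
  | zero => simp
  | succ n =>
    rw [PowerSeries.coeff_succ_X_mul, PowerSeries.coeff_derivative, mul_comm]
    push_cast
    rfl

theorem X_mul_derivative_hSer :
    PowerSeries.X * PowerSeries.derivative (symFun ℤ) hSer = pSer * hSer := by
  ext1 n
  rw [coeff_X_mul_derivative, coeff_pSer_mul]
  simp only [hSer, PowerSeries.coeff_mk]
  exact newton n

/-- Newton's identities say that the logarithmic derivative of `H` is given by the power sums; for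
`H ^ s` it is multiplied by `s`. -/
theorem natCast_mul_coeff_hSer_pow (s n : ℕ) :
    (n : symFun ℤ) * PowerSeries.coeff n (hSer ^ s) =
      s * ∑ j ∈ Finset.Icc 1 n, psum ℤ j * PowerSeries.coeff (n - j) (hSer ^ s) := by
  have h : PowerSeries.X * PowerSeries.derivative (symFun ℤ) (hSer ^ s) =
      s • (pSer * hSer ^ s) := by
    cases s with
    | zero => simp
    | succ s =>
      rw [Derivation.leibniz_pow, Nat.succ_sub_one, smul_eq_mul, mul_smul_comm, mul_left_comm,
        X_mul_derivative_hSer, pow_succ]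
      congr 1
      ring
  rw [← coeff_X_mul_derivative, h, map_nsmul, coeff_pSer_mul, nsmul_eq_mul]

/-- Both sides satisfy Newton's recursion with `p_j` replaced by `s p_j`, and `n` can be cancelled.
-/
theorem coeff_hSer_pow (s : ℕ) [NeZero s] (n : ℕ) :
    PowerSeries.coeff n (hSer ^ s) = theta ℤ s (hsym ℤ n) := by
  induction n using Nat.strong_induction_on with
  | _ n ih =>
    by_cases hn : n = 0
    · subst hn
      rw [PowerSeries.coeff_zero_eq_constantCoeff_apply, map_pow, hSer,
        ← PowerSeries.coeff_zero_eq_constantCoeff_apply, PowerSeries.coeff_mk, hsym_zero, map_one,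
        one_pow]
    · apply int_natCast_mul_cancel hn
      have h := congrArg (theta ℤ s) (newton (R := ℤ) n)
      rw [map_mul, map_natCast, map_sum] at h
      rw [h, natCast_mul_coeff_hSer_pow, Finset.mul_sum]
      refine Finset.sum_congr rfl fun j hj => ?_
      rw [Finset.mem_Icc] at hj
      rw [map_mul, theta_psum s (by omega), ih (n - j) (by omega), mul_assoc]

/-- The coefficient of `y ^ b` in the `s`-th power of the Cauchy kernel. -/
theorem yc_cauchyKernel_pow (s : ℕ) [NeZero s] (b : ℕ →₀ ℕ) :
    yc b (cauchyKernel ^ s) = (theta ℤ s (hprod ℤ b)).1 := by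
  classical
  ext a
  have h1 : HasProd (fun j => restH j ∅ ^ s) (cauchyKernel ^ s) :=
    hasProd_restH.map (powMonoidHom s) (continuous_pow s)
  have h2 : ∀ j, IsSer j (PowerSeries.map (symFun ℤ).val.toRingHom (hSer ^ s)) (restH j ∅ ^ s) := by
    intro j
    rw [map_pow]
    exact (isSer_restH j).pow s
  rw [HasProd, SummationFilter.unconditional_filter,
    MvPowerSeries.WithPiTopology.tendsto_iff_coeff_tendsto] at h1
  refine tendsto_nhds_unique (h1 (a.sumElim b)) (tendsto_nhds_of_eventually_eq ?_)
  rw [Filter.eventually_atTop]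
  -- From here on, further factors `y_j` with `j` outside the support of `b` contribute only their
  -- constant term `1`.
  refine ⟨b.support, fun T hT => ?_⟩
  have h3 : ∏ j ∈ T, PowerSeries.coeff (b j)
      (PowerSeries.map (symFun ℤ).val.toRingHom (hSer ^ s)) = (theta ℤ s (hprod ℤ b)).1 := by
    rw [hprod_eq hT, map_prod]
    change _ = (symFun ℤ).val _
    rw [map_prod]
    exact Finset.prod_congr rfl fun j _ => by rw [PowerSeries.coeff_map, coeff_hSer_pow]; rfl
  rw [← coeff_yc, yc_prod h2, if_pos hT, h3]

end Kernel

/-! ### Elementary divisors and the expansion of the kernel -/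

section Main

/-- For powers of one prime, the divisibility chain is obtained by sorting the exponents. -/
theorem hasElementaryDivisors_of_bases {M ι : Type*} [AddCommGroup M] [Fintype ι] [DecidableEq ι]
    (B : M →+ M →+ ℂ) (u v : IntBasis ι M) (p : ℕ) (e : ι → ℕ)
    (h : ∀ i j, B (u i) (v j) = if i = j then ((p ^ e i : ℕ) : ℂ) else 0) :
    HasElementaryDivisors B ((Finset.univ : Finset ι).val.map fun i => p ^ e i) := by
  set τ := (Fintype.equivFin ι).symm with hτ
  set σ : Fin (Fintype.card ι) ≃ ι := (Tuple.sort (e ∘ τ)).trans τ with hσ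
  refine ⟨Fintype.card ι, fun i => p ^ e (σ i), u.reindex σ.symm, v.reindex σ.symm,
    fun i j hij => pow_dvd_pow p (Tuple.monotone_sort (e ∘ τ) hij), fun i j => ?_, ?_⟩
  · rw [Module.Basis.reindex_apply, Module.Basis.reindex_apply, Equiv.symm_symm, h]
    simp only [σ.injective.eq_iff]
  · rw [← Multiset.map_univ_val_equiv σ, Multiset.map_map]
    rfl

theorem toComplex_natCast_mul (k : ℕ) (f : symFun ℤ) :
    toComplex (k * f) = (k : ℂ) • toComplex f := by
  rw [← nsmul_eq_mul, map_nsmul, Nat.cast_smul_eq_nsmul]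

theorem hasElementaryDivisors_sFormDeg {p : ℕ} (hp : p.Prime) (r d : ℕ) :
    HasElementaryDivisors (sFormDeg (p ^ r) d)
      ((Finset.univ : Finset d.Partition).val.map fun μ => divisorD p r μ) := by
  classical
  have : NeZero (p ^ r) := ⟨pow_ne_zero r hp.ne_zero⟩
  obtain ⟨u, v, huv⟩ := exists_theta_bases hp r d
  -- The dual basis of `v` is used: `⟨θ u_μ, w_ν⟩ = D_r(μ) ⟨v_μ, w_ν⟩`.
  obtain ⟨w, hw⟩ := exists_dual v
  simp only [divisorD_eq]
  refine hasElementaryDivisors_of_bases _ u w p _ fun μ ν => ?_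
  change sForm ℂ ((p ^ r : ℕ) : ℂ) (toComplex (u μ).1) (toComplex (w ν).1) = _
  rw [sForm_eq_theta, ← toComplex_theta, huv, toComplex_natCast_mul, map_smul,
    LinearMap.smul_apply, sForm_symm, hw, Module.Basis.repr_self, Finsupp.single_apply, divisorD_eq]
  split_ifs <;> simp

theorem exists_sigma_basis {M : Type*} [AddCommGroup M] {κ N : ℕ → Type*}
    [∀ d, AddCommGroup (N d)] (inc : ∀ d, N d →+ M) (pr : ∀ d, M →+ N d)
    (h1 : ∀ d x, pr d (inc d x) = x) (h2 : ∀ d e x, d ≠ e → pr e (inc d x) = 0)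
    (h3 : ∀ x, ∃ n, x = ∑ d ∈ Finset.range n, inc d (pr d x)) (v : ∀ d, IntBasis (κ d) (N d)) :
    ∃ b : IntBasis (Σ d, κ d) M, ∀ i, b i = inc i.1 (v i.1 i.2) := by
  classical
  have hdual : ∀ i j : Σ d, κ d, (v i.1).repr (pr i.1 (inc j.1 (v j.1 j.2))) i.2 =
      if j = i then 1 else 0 := by
    rintro ⟨d, k⟩ ⟨e, l⟩
    by_cases hde : e = d
    · subst hde
      simp only [h1, Module.Basis.repr_self, Finsupp.single_apply, Sigma.mk.injEq, heq_eq_eq,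
        true_and]
    · simp only [h2 e d _ hde, map_zero, Finsupp.zero_apply]
      rw [if_neg fun h => hde (congrArg Sigma.fst h)]
  have hli : LinearIndependent ℤ fun i : Σ d, κ d => inc i.1 (v i.1 i.2) := by
    rw [linearIndependent_iff']
    intro s g hg i hi
    have h := congrArg (fun x => (v i.1).repr (pr i.1 x) i.2) hg
    simp only [map_sum, map_zsmul, Finsupp.finsetSum_apply, Finsupp.smul_apply, hdual, map_zero,
      Finsupp.zero_apply, smul_eq_mul, mul_ite, mul_one, mul_zero] at h
    rwa [Finset.sum_ite_eq' s i g, if_pos hi] at h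
  have hsp : ⊤ ≤ Submodule.span ℤ (Set.range fun i : Σ d, κ d => inc i.1 (v i.1 i.2)) := by
    intro x _
    obtain ⟨n, hn⟩ := h3 x
    rw [hn]
    refine Submodule.sum_mem _ fun d _ => ?_
    have h : (v d).repr.symm ((v d).repr (pr d x)) = pr d x := (v d).repr.symm_apply_apply _
    rw [← h, Module.Basis.repr_symm_apply, Finsupp.linearCombination_apply, Finsupp.sum, map_sum]
    refine Submodule.sum_mem _ fun k _ => ?_
    rw [map_zsmul]
    exact Submodule.smul_mem _ _ (Submodule.subset_span ⟨⟨d, k⟩, rfl⟩)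
  exact ⟨Module.Basis.mk hli hsp, fun i => Module.Basis.mk_apply hli hsp i⟩

/-- An abelian group has only one `ℤ`-module structure, so the structure used for the basis is
immaterial. -/
theorem exists_basis_of_intBasis {M ι : Type*} [AddCommGroup M] [inst : Module ℤ M]
    (b : IntBasis ι M) : ∃ b' : @Module.Basis ι ℤ M _ _ inst, ∀ i, b' i = b i := by
  obtain rfl : inst = AddCommGroup.toIntModule M := Subsingleton.elim _ _
  exact ⟨b, fun _ => rfl⟩

theorem exists_basis_symFun (v : ∀ d, IntBasis d.Partition (symDeg ℤ d)) :
    ∃ b : Module.Basis Par ℤ (symFun ℤ), ∀ μ, b μ = (v μ.1 μ.2).1 := by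
  let pr : ∀ d, symFun ℤ →+ symDeg ℤ d := fun d =>
    { toFun := fun f => ⟨proj d f, proj_mem d f⟩
      map_zero' := Subtype.ext (map_zero (proj d))
      map_add' := fun f g => Subtype.ext (map_add (proj d) f g) }
  obtain ⟨b, hb⟩ := exists_sigma_basis coeHom pr (fun d x => Subtype.ext (proj_self x.2))
    (fun d e x h => Subtype.ext ((proj_eq x.2).trans (if_neg h)))
    (fun x => by
      obtain ⟨N, hN⟩ := x.2.2
      exact ⟨N + 1, (sum_proj hN).symm⟩) v
  obtain ⟨b', hb'⟩ := exists_basis_of_intBasis b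
  exact ⟨b', fun μ => (hb' μ).trans (hb μ)⟩

open Classical in
theorem yc_inX (b : ℕ →₀ ℕ) (f : MvPowerSeries ℕ ℤ) : yc b (inX f) = if b = 0 then f else 0 := by
  ext a
  rw [coeff_yc]
  split_ifs with h
  · have e : a.sumElim b = a.embDomain Function.Embedding.inl := by
      rw [h]
      ext (i | i)
      · exact (Finsupp.embDomain_apply_self Function.Embedding.inl a i).symm
      · exact (Finsupp.embDomain_of_notMem_range _ _ _ (by simp)).symm
    rw [e]
    exact MvPowerSeries.coeff_embDomain_rename _ _ _
  · rw [map_zero]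
    refine MvPowerSeries.coeff_rename_eq_zero _ _ ?_
    rintro ⟨c, hc⟩
    refine h (Finsupp.ext fun i => ?_)
    have h1 := DFunLike.congr_fun hc (Sum.inr i)
    rw [Finsupp.mapDomain_of_notMem_range _ _ (by simp)] at h1
    exact h1.symm

open Classical in
theorem yc_inY (b : ℕ →₀ ℕ) (g : MvPowerSeries ℕ ℤ) :
    yc b (inY g) = MvPowerSeries.C (MvPowerSeries.coeff b g) := by
  ext a
  rw [coeff_yc, MvPowerSeries.coeff_C]
  split_ifs with h
  · have e : a.sumElim b = b.embDomain Function.Embedding.inr := by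
      rw [h]
      ext (i | i)
      · exact (Finsupp.embDomain_of_notMem_range _ _ _ (by simp)).symm
      · exact (Finsupp.embDomain_apply_self Function.Embedding.inr b i).symm
    rw [e]
    exact MvPowerSeries.coeff_embDomain_rename _ _ _
  · refine MvPowerSeries.coeff_rename_eq_zero _ _ ?_
    rintro ⟨c, hc⟩
    refine h (Finsupp.ext fun i => ?_)
    have h1 := DFunLike.congr_fun hc (Sum.inl i)
    rw [Finsupp.mapDomain_of_notMem_range _ _ (by simp)] at h1
    exact h1.symm

theorem coeff_inX_mul_inY (a b : ℕ →₀ ℕ) (f g : MvPowerSeries ℕ ℤ) :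
    MvPowerSeries.coeff (a.sumElim b) (inX f * inY g) =
      MvPowerSeries.coeff a f * MvPowerSeries.coeff b g := by
  classical
  rw [← coeff_yc, yc_mul, Finset.sum_eq_single (0, b)]
  · rw [yc_inX, if_pos rfl, yc_inY, MvPowerSeries.coeff_mul_C]
  · intro q hq hne
    rw [yc_inX, if_neg, zero_mul]
    intro h0
    apply hne
    rw [Finset.HasAntidiagonal.mem_antidiagonal, h0, zero_add] at hq
    exact Prod.ext h0 hq
  · intro h
    rw [Finset.HasAntidiagonal.mem_antidiagonal] at h
    exact absurd (zero_add b) h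

/-- As `w` is dual to `u`, the coordinates of `h_b` in the basis `u` are `⟨w_μ, h_b⟩`, the
coefficients of `x ^ b` in the `w_μ`. Then `θ` is applied term by term. -/
theorem theta_hprod {s d : ℕ} [NeZero s] {u v w : IntBasis d.Partition (symDeg ℤ d)}
    {D : d.Partition → ℕ} (huv : ∀ μ, theta ℤ s (u μ).1 = (D μ : symFun ℤ) * (v μ).1)
    (hw : ∀ (i : d.Partition) (f : symDeg ℤ d),
      sForm ℂ 1 (toComplex (w i).1) (toComplex f.1) = ((u.repr f i : ℤ) : ℂ))
    {b : ℕ →₀ ℕ} (hb : b.degree = d) :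
    theta ℤ s (hprod ℤ b) = ∑ μ, ((D μ * cf b (w μ).1 : ℤ) : symFun ℤ) * (v μ).1 := by
  set h : symDeg ℤ d := ⟨hprod ℤ b, symDeg_of_eq (hprod_mem_symDeg b) hb⟩ with hh
  have h1 : ∀ μ, u.repr h μ = cf b (w μ).1 := by
    intro μ
    have := hw μ h
    rw [sForm_symm, hh, toComplex_hprod, sForm_hprod, cf_toComplex] at this
    exact_mod_cast this.symm
  have h2 : hprod ℤ b = ∑ μ, ((cf b (w μ).1 : ℤ) : symFun ℤ) * (u μ).1 := by
    have h3 := congrArg (coeHom d) (u.sum_repr h)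
    rw [map_sum] at h3
    refine h3.symm.trans (Finset.sum_congr rfl fun μ _ => ?_)
    rw [h1]
    exact map_zsmul_eq_mul (coeHom d) _ _
  rw [h2, map_sum]
  refine Finset.sum_congr rfl fun μ _ => ?_
  rw [map_mul, map_intCast, huv]
  push_cast
  ring

/-- For a fixed exponent `b` of `y` only the finitely many partitions of the degree of `b`
contribute, and their sum is the expansion of `θ(h_b)`. -/
theorem hasSum_cauchyKernel_pow {s : ℕ} [NeZero s] {D : Par → ℕ}
    {u v w : ∀ d, IntBasis d.Partition (symDeg ℤ d)}
    (huv : ∀ d μ, theta ℤ s (u d μ).1 = (D ⟨d, μ⟩ : symFun ℤ) * (v d μ).1)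
    (hw : ∀ (d : ℕ) (i : d.Partition) (f : symDeg ℤ d),
      sForm ℂ 1 (toComplex (w d i).1) (toComplex f.1) = (((u d).repr f i : ℤ) : ℂ)) :
    HasSum (fun μ : Par => (D μ : MvPowerSeries (ℕ ⊕ ℕ) ℤ) *
      (inX (v μ.1 μ.2).1 * inY (w μ.1 μ.2).1)) (cauchyKernel ^ s) := by
  classical
  rw [MvPowerSeries.WithPiTopology.hasSum_iff_hasSum_coeff]
  intro m
  obtain ⟨a, b, rfl⟩ : ∃ a b : ℕ →₀ ℕ, a.sumElim b = m :=
    ⟨_, _, Finsupp.comapDomain_sumElim_comapDomain m⟩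
  have hc : ∀ μ : Par, MvPowerSeries.coeff (a.sumElim b) ((D μ : MvPowerSeries (ℕ ⊕ ℕ) ℤ) *
      (inX (v μ.1 μ.2).1 * inY (w μ.1 μ.2).1)) =
      D μ * (cf a (v μ.1 μ.2).1 * cf b (w μ.1 μ.2).1) := by
    intro μ
    rw [← nsmul_eq_mul, map_nsmul, coeff_inX_mul_inY, nsmul_eq_mul]
    rfl
  simp only [hc]
  set S : Finset Par := (Finset.univ : Finset b.degree.Partition).map
    (Function.Embedding.sigmaMk b.degree) with hS
  have hsum : MvPowerSeries.coeff (a.sumElim b) (cauchyKernel ^ s) =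
      ∑ μ ∈ S, (D μ * (cf a (v μ.1 μ.2).1 * cf b (w μ.1 μ.2).1) : ℤ) := by
    rw [← coeff_yc, yc_cauchyKernel_pow, theta_hprod (huv b.degree) (hw b.degree) rfl, hS,
      Finset.sum_map, ← cf_apply, map_sum]
    refine Finset.sum_congr rfl fun μ _ => ?_
    rw [← zsmul_eq_mul, map_zsmul, smul_eq_mul]
    change _ = (D ⟨b.degree, μ⟩ : ℤ) * (cf a (v b.degree μ).1 * cf b (w b.degree μ).1)
    ring
  rw [hsum]
  refine hasSum_sum_of_ne_finset_zero fun μ hμ => ?_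
  have h0 : cf b (w μ.1 μ.2).1 = 0 := by
    refine cf_eq_zero_of_mem (w μ.1 μ.2).2 fun e => hμ ?_
    obtain ⟨d, μ⟩ := μ
    simp only at e
    subst e
    exact Finset.mem_map.2 ⟨μ, Finset.mem_univ _, rfl⟩
  rw [h0, mul_zero, mul_zero]

end Main

end SymFun

end

theorem mainTheorem3 (p r : ℕ) (hp : p.Prime) (hr : r ≤ p) :
    (∀ d : ℕ, SymFun.HasElementaryDivisors (SymFun.sFormDeg (p ^ r) d)
      ((Finset.univ : Finset d.Partition).val.map fun μ => SymFun.divisorD p r μ)) ∧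
    ∃ G N : Module.Basis SymFun.Par ℤ (SymFun.symFun ℤ),
      (∀ μ : SymFun.Par, G μ ∈ SymFun.symDeg ℤ μ.1 ∧ N μ ∈ SymFun.symDeg ℤ μ.1) ∧
      HasSum
        (fun μ : SymFun.Par => (SymFun.divisorD p r μ.2 : MvPowerSeries (ℕ ⊕ ℕ) ℤ) *
          (SymFun.inX (G μ) * SymFun.inY (N μ)))
        (SymFun.cauchyKernel ^ p ^ r) := by
  refine ⟨fun d => SymFun.hasElementaryDivisors_sFormDeg hp r d, ?_⟩
  have : NeZero (p ^ r) := ⟨pow_ne_zero r hp.ne_zero⟩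
  choose u v huv using fun d => SymFun.exists_theta_bases hp r d
  -- Here the dual basis of `u` is needed, since the `h_b` are expanded in `u` before `θ` is
  -- applied.
  choose w hw using fun d => SymFun.exists_dual (u d)
  obtain ⟨G, hG⟩ := SymFun.exists_basis_symFun v
  obtain ⟨N, hN⟩ := SymFun.exists_basis_symFun w
  refine ⟨G, N, fun μ => ?_, ?_⟩
  · rw [hG, hN]
    exact ⟨(v μ.1 μ.2).2, (w μ.1 μ.2).2⟩
  · simp only [hG, hN]
    exact SymFun.hasSum_cauchyKernel_pow (D := fun μ => SymFun.divisorD p r μ.2) huv hw
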